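/- Let $\mathcal S,\mathcal X,\mathcal Y,\widehat{\mathcal S}$ be finite sets, $\bar P_S$ a probability distribution on $\mathcal S$ (the source) and $\bar P_{Y|X}$ a conditional probability distribution from $\mathcal X$ to $\mathcal Y$ (the discrete memoryless channel). For $R_0\ge 0$, a code of block length $n$ with common randomness of rate $R_0$ is a pair of stochastic maps: an encoder $f_n$, given by a conditional distribution $P_{X^n|S^nC}$ on $\mathcal X^n$, and a decoder $g_n$, given by a conditional distribution $P_{\widehat S^n|Y^nC}$ on $\widehat{\mathcal S}^n$, where $C$ ranges over the integers in $[1,2^{nR_0}]$. With $C$ uniform on $M_n=\lfloor 2^{nR_0}\rfloor$ values and independent of the i.i.d. source $S^n\sim\bar P_S^{\otimes n}$, the code induces $$P_{S^nX^nY^n\widehat S^n}(\mathbf s,\mathbf x,\mathbf y,\widehat{\mathbf s})=\sum_{c=1}^{M_n}\frac1{M_n}\prod_{i=1}^n\bar P_S(s_i)\;P_{X^n|S^nC}(\mathbf x|\mathbf s,c)\prod_{i=1}^n\bar P_{Y|X}(y_i|x_i)\;P_{\widehat S^n|Y^nC}(\widehat{\mathbf s}|\mathbf y,c).$$ A pair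 $(\bar P_{SXY\widehat S},R_0)$, with $\bar P_{SXY\widehat S}$ a probability distribution on $\mathcal S\times\mathcal X\times\mathcal Y\times\widehat{\mathcal S}$ and $R_0\ge0$, is achievable if there is a sequence of codes with common randomness of rate $R_0$ such that the total variation distance between $P_{S^nX^nY^n\widehat S^n}$ and $\bar P_{SXY\widehat S}^{\otimes n}$ tends to $0$ as $n\to\infty$. The strong coordination region $\mathcal R$ is the set of achievable pairs. Theorem. $\mathcal R_1\subseteq\mathcal R\subseteq\mathcal R_2$, where $\mathcal R_1$ (resp. $\mathcal R_2$) is the set of pairs $(\bar P_{SXY\widehat S},R_0)$ such that $\bar P_{SXY\widehat S}=\bar P_S\bar P_{X|S}\bar P_{Y|X}\bar P_{\widehat S|SXY}$ for some conditional distributions $\bar P_{X|S},\bar P_{\widehat S|SXY}$, and there is a random variable $U$ with values in a finite set $\mathcal U$, $|\mathcal U|\le|\mathcal S||\mathcal X||\mathcal Y||\widehat{\mathcal S}|+1$, with a joint distribution of the form $$\bar P_{SXYU\widehat S}=\bar P_S\,\bar P_{U|S}\,\bar P_{X|US}\,\bar P_{Y|X}\,\bar P_{\widehat S|UY}$$ whose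 $(S,X,Y,\widehat S)$-marginal is $\bar P_{SXY\widehat S}$, and such that - for $\mathcal R_1$: $I(U;S)<I(U;Y)$ and $R_0>I(U;SX\widehat S|Y)$; - for $\mathcal R_2$: $I(U;S)\le I(X;Y)$ and $R_0\ge I(U;SX\widehat S|Y)$. All information quantities are in bits (logarithms to base $2$). -/

import Mathlib

/-! Finite-alphabet distributions are represented by their mass functions, i.e. by elements of
`stdSimplex ℝ α`; a conditional distribution `P_{B|A}` is a map `α → β → ℝ` all of whose values are
in `stdSimplex ℝ β`. -/

noncomputable section

namespace StrongCoordination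

universe u v w t

section Information

variable {Ω α β γ : Type*} [Fintype Ω] [Fintype α] [Fintype β] [Fintype γ]

open Classical in
/-- The law of the random variable `A` on the finite probability space `(Ω, Q)`. -/
def law (Q : Ω → ℝ) (A : Ω → α) (a : α) : ℝ :=
  ∑ ω with A ω = a, Q ω

/-- Shannon entropy `H(A)`, in bits. -/
def entropy (Q : Ω → ℝ) (A : Ω → α) : ℝ :=
  (∑ a, Real.negMulLog (law Q A a)) / Real.log 2

/-- Mutual information `I(A;B)`, in bits. -/
def mutualInfo (Q : Ω → ℝ) (A : Ω → α) (B : Ω → β) : ℝ :=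
  entropy Q A + entropy Q B - entropy Q (fun ω => (A ω, B ω))

/-- Conditional mutual information `I(A;B|C) = H(A,C) + H(B,C) - H(A,B,C) - H(C)`, in bits. -/
def condMutualInfo (Q : Ω → ℝ) (A : Ω → α) (B : Ω → β) (C : Ω → γ) : ℝ :=
  entropy Q (fun ω => (A ω, C ω)) + entropy Q (fun ω => (B ω, C ω))
    - entropy Q (fun ω => (A ω, B ω, C ω)) - entropy Q C

/-- Total variation distance of two mass functions on a finite set. -/
def tvDist (P Q : Ω → ℝ) : ℝ :=
  (1 / 2) * ∑ ω, |P ω - Q ω|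

/-- The `n`-fold product (i.i.d.) distribution `P^{⊗ n}`. -/
def iid (P : Ω → ℝ) (n : ℕ) (z : Fin n → Ω) : ℝ :=
  ∏ i, P (z i)

end Information

section Model

variable (S : Type u) (X : Type v) (Y : Type w) (T : Type t)
variable [Fintype S] [Fintype X] [Fintype Y] [Fintype T]

/-- A code of block length `n` with common randomness in a set of `M` elements: a non-causal
stochastic encoder `P_{Xⁿ|Sⁿ C}` and a non-causal stochastic decoder `P_{Ŝⁿ|Yⁿ C}`.
The alphabet of `Ŝ` is `T`. -/
structure Code (n M : ℕ) where
  enc : (Fin n → S) → Fin M → (Fin n → X) → ℝ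
  enc_mem : ∀ s c, enc s c ∈ stdSimplex ℝ (Fin n → X)
  dec : (Fin n → Y) → Fin M → (Fin n → T) → ℝ
  dec_mem : ∀ y c, dec y c ∈ stdSimplex ℝ (Fin n → T)

variable {S X Y T}

/-- The joint distribution of `(Sⁿ, Xⁿ, Yⁿ, Ŝⁿ)` induced by a code, for the i.i.d. source `PS`, the
discrete memoryless channel `W` and common randomness uniform on `Fin M` and independent of the
source. -/
def Code.induced {n M : ℕ} (κ : Code S X Y T n M) (PS : S → ℝ) (W : X → Y → ℝ)
    (z : Fin n → S × X × Y × T) : ℝ :=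
  ∑ c : Fin M, (M : ℝ)⁻¹ *
    (∏ i, PS (z i).1) *
    κ.enc (fun i => (z i).1) c (fun i => (z i).2.1) *
    (∏ i, W (z i).2.1 (z i).2.2.1) *
    κ.dec (fun i => (z i).2.2.1) c (fun i => (z i).2.2.2)

/-- The number of integers in `[1, 2^{n R₀}]`. -/
def numBins (R₀ : ℝ) (n : ℕ) : ℕ :=
  ⌊(2 : ℝ) ^ ((n : ℝ) * R₀)⌋₊

/-- Achievability of the pair `(P, R₀)` for strong coordination. -/
def Achievable (PS : S → ℝ) (W : X → Y → ℝ) (P : S × X × Y × T → ℝ) (R₀ : ℝ) : Prop :=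
  P ∈ stdSimplex ℝ (S × X × Y × T) ∧ 0 ≤ R₀ ∧
    ∃ κ : ∀ n : ℕ, Code S X Y T n (numBins R₀ n),
      Filter.Tendsto (fun n => tvDist ((κ n).induced PS W) (iid P n)) Filter.atTop (nhds 0)

/-- The strong coordination region. -/
def region (T : Type t) [Fintype T] (PS : S → ℝ) (W : X → Y → ℝ) :
    Set ((S × X × Y × T → ℝ) × ℝ) :=
  {p | Achievable PS W p.1 p.2}

/-- `P_{SXYŜ} = P_S P_{X|S} P_{Y|X} P_{Ŝ|SXY}` with the given source and channel. -/
def TargetFactors (PS : S → ℝ) (W : X → Y → ℝ) (P : S × X × Y × T → ℝ) : Prop :=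
  ∃ (PX : S → X → ℝ) (PT : S → X → Y → T → ℝ),
    (∀ s, PX s ∈ stdSimplex ℝ X) ∧ (∀ s x y, PT s x y ∈ stdSimplex ℝ T) ∧
    ∀ s x y a, P (s, x, y, a) = PS s * PX s x * W x y * PT s x y a

/-- `P_{SXYUŜ} = P_S P_{U|S} P_{X|US} P_{Y|X} P_{Ŝ|UY}` with the given source and channel. -/
def AuxFactors {U : Type} [Fintype U] (PS : S → ℝ) (W : X → Y → ℝ)
    (Q : S × X × Y × U × T → ℝ) : Prop :=
  ∃ (PU : S → U → ℝ) (PX : U → S → X → ℝ) (PT : U → Y → T → ℝ),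
    (∀ s, PU s ∈ stdSimplex ℝ U) ∧ (∀ b s, PX b s ∈ stdSimplex ℝ X) ∧
    (∀ b y, PT b y ∈ stdSimplex ℝ T) ∧
    ∀ s x y b a, Q (s, x, y, b, a) = PS s * PU s b * PX b s x * W x y * PT b y a

/-- `P` is the `(S, X, Y, Ŝ)`-marginal of `Q`. -/
def IsMarginal {U : Type} [Fintype U] (P : S × X × Y × T → ℝ)
    (Q : S × X × Y × U × T → ℝ) : Prop :=
  ∀ s x y a, P (s, x, y, a) = ∑ b, Q (s, x, y, b, a)

section Coordinates

variable {U : Type}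

/-- The random variable `S`. -/
def rvS (ω : S × X × Y × U × T) : S := ω.1

/-- The random variable `X`. -/
def rvX (ω : S × X × Y × U × T) : X := ω.2.1

/-- The random variable `Y`. -/
def rvY (ω : S × X × Y × U × T) : Y := ω.2.2.1

/-- The random variable `U`. -/
def rvU (ω : S × X × Y × U × T) : U := ω.2.2.2.1

/-- The random variable `(S, X, Ŝ)`. -/
def rvSXT (ω : S × X × Y × U × T) : S × X × T := (ω.1, ω.2.1, ω.2.2.2.2)

end Coordinates

/-- The inner bound. -/
def innerBound (T : Type t) [Fintype T] (PS : S → ℝ) (W : X → Y → ℝ) :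
    Set ((S × X × Y × T → ℝ) × ℝ) :=
  {p | TargetFactors PS W p.1 ∧
    ∃ (U : Type) (_ : Fintype U) (Q : S × X × Y × U × T → ℝ),
      AuxFactors PS W Q ∧ IsMarginal p.1 Q ∧
      mutualInfo Q rvU rvS < mutualInfo Q rvU rvY ∧
      condMutualInfo Q rvU rvSXT rvY < p.2 ∧
      Fintype.card U ≤ Fintype.card S * Fintype.card X * Fintype.card Y * Fintype.card T + 1}

/-- The outer bound. -/
def outerBound (T : Type t) [Fintype T] (PS : S → ℝ) (W : X → Y → ℝ) :
    Set ((S × X × Y × T → ℝ) × ℝ) :=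
  {p | TargetFactors PS W p.1 ∧
    ∃ (U : Type) (_ : Fintype U) (Q : S × X × Y × U × T → ℝ),
      AuxFactors PS W Q ∧ IsMarginal p.1 Q ∧
      mutualInfo Q rvU rvS ≤ mutualInfo Q rvX rvY ∧
      condMutualInfo Q rvU rvSXT rvY ≤ p.2 ∧
      Fintype.card U ≤ Fintype.card S * Fintype.card X * Fintype.card Y * Fintype.card T + 1}

end Model

end StrongCoordination

end

set_option linter.unusedSectionVars false

noncomputable section

namespace StrongCoordination

open scoped Classical
open Real (negMulLog log)

/-! ### Laws of random variables on a finite space. -/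

section Law

variable {Ω α β γ : Type*} [Fintype Ω] [Fintype α] [Fintype β] [Fintype γ]

/-! Inner bound. Draw codewords `φ (c, m)` i.i.d. from the law of `U`, where `c` is the common
randomness and `m` an index of rate `ρ` to be conveyed over the channel. The encoder draws `m` from
its posterior given the source and `c` (likelihood encoder), then draws the input from `P_{X|US}`.
The decoder recovers `m` by a threshold test on the information density and draws the reconstruction
from `P_{Ŝ|UY}`. Three errors arise (`exists_code_of_codebook`). The source must look like the
output of a uniform codeword of the slice of `c`, which needs `ρ > I(U;S)`. The index must be
decodable, which needs `ρ < I(U;Y)`. The whole quadruple must look like the output of a uniform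
codeword of the full codebook, which needs `R₀ + ρ > I(U;SXYŜ) = I(U;Y) + I(U;SXŜ|Y)`. The two
hypotheses of the inner bound say exactly that such a `ρ` exists. The first and third errors are
bounded by `soft_covering`, the second by `threshold_decoding`; the bounds are one-shot, and the law
of large numbers for the information density makes them vanish for blocks.

Outer bound. Take `U` to be a uniform time `k`, the common randomness `C`, and the outputs at all
times but `k`. Given `U`, the letters at time `k` have law `a(s,x) W(y|x) r(t|y)`
(`Code.exists_chain`), because the channel is memoryless without feedback and the decoder sees only
`Yⁿ` and `C`. Entropy inequalities (`Code.exists_single_letter`) give `I(U;S) ≤ I(X;Y)` for the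
time-averaged law, and bound `n I(U;SXŜ|Y)` by `log N` plus the gap between `n` times the entropy of
the averaged letter and the entropy of the block. That gap is `o(n)` when the block is close to
i.i.d. in total variation (`sum_negMulLog_sub_le`).

The alphabet of this `U` grows with `n`. A Carathéodory argument (`exists_small_support`) cuts it to
the required size, and compactness of the set of parameters with continuity of entropy passes to the
limit.

Entropies are handled in nats and divided by `log 2` at the end. -/

theorem law_eq_sum_ite (Q : Ω → ℝ) (A : Ω → α) (a : α) :
    law Q A a = ∑ ω, if A ω = a then Q ω else 0 := by
  rw [law, Finset.sum_filter]

theorem law_nonneg {Q : Ω → ℝ} (hQ : ∀ ω, 0 ≤ Q ω) (A : Ω → α) (a : α) : 0 ≤ law Q A a :=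
  Finset.sum_nonneg fun ω _ => hQ ω

theorem sum_law_mul (Q : Ω → ℝ) (A : Ω → α) (g : α → ℝ) :
    ∑ a, law Q A a * g a = ∑ ω, Q ω * g (A ω) := by
  simp only [law_eq_sum_ite, Finset.sum_mul, ite_mul, zero_mul]
  rw [Finset.sum_comm]
  simp

theorem sum_law (Q : Ω → ℝ) (A : Ω → α) : ∑ a, law Q A a = ∑ ω, Q ω := by
  simpa using sum_law_mul Q A (fun _ => 1)

theorem law_law (Q : Ω → ℝ) (F : Ω → α) (A : α → β) :
    law (law Q F) A = law Q (fun ω => A (F ω)) := by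
  funext b
  have := sum_law_mul Q F (fun a => if A a = b then 1 else 0)
  simpa [law_eq_sum_ite (law Q F), law_eq_sum_ite Q (fun ω => A (F ω))] using this

theorem law_id (Q : Ω → ℝ) : law Q (fun ω => ω) = Q := by
  funext a
  simp [law_eq_sum_ite]

theorem le_law {Q : Ω → ℝ} (hQ : ∀ ω, 0 ≤ Q ω) (A : Ω → α) (ω : Ω) : Q ω ≤ law Q A (A ω) := by
  rw [law]
  exact Finset.single_le_sum (f := Q) (fun i _ => hQ i) (by simp)

theorem law_mono {Q : Ω → ℝ} (hQ : ∀ ω, 0 ≤ Q ω) {A : Ω → α} {B : Ω → β} {a : α} {b : β}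
    (h : ∀ ω, A ω = a → B ω = b) : law Q A a ≤ law Q B b := by
  refine Finset.sum_le_sum_of_subset_of_nonneg ?_ fun i _ _ => hQ i
  intro ω
  simpa using h ω

theorem law_congr (Q : Ω → ℝ) {A : Ω → α} {B : Ω → β} {a : α} {b : β}
    (h : ∀ ω, A ω = a ↔ B ω = b) : law Q A a = law Q B b := by
  simp only [law_eq_sum_ite, h]

theorem sum_law_pair (Q : Ω → ℝ) (A : Ω → α) (B : Ω → β) (a : α) :
    ∑ b, law Q (fun ω => (A ω, B ω)) (a, b) = law Q A a := by
  simp only [law_eq_sum_ite, Prod.mk.injEq]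
  rw [Finset.sum_comm]
  refine Finset.sum_congr rfl fun ω _ => ?_
  by_cases h : A ω = a <;> simp [h]

theorem law_mem_stdSimplex {Q : Ω → ℝ} (hQ : Q ∈ stdSimplex ℝ Ω) (A : Ω → α) :
    law Q A ∈ stdSimplex ℝ α :=
  ⟨law_nonneg hQ.1 A, by rw [sum_law]; exact hQ.2⟩

end Law

/-! ### Shannon inequalities for finite random variables. -/

section Entropy

variable {Ω α β γ : Type*} [Fintype Ω] [Fintype α] [Fintype β] [Fintype γ]

/-- Shannon entropy in nats. -/
def ent (Q : Ω → ℝ) (A : Ω → α) : ℝ := ∑ a, negMulLog (law Q A a)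

theorem entropy_eq_ent_div (Q : Ω → ℝ) (A : Ω → α) : entropy Q A = ent Q A / log 2 := rfl

theorem ent_eq_neg_sum (Q : Ω → ℝ) (A : Ω → α) :
    ent Q A = -∑ ω, Q ω * log (law Q A (A ω)) := by
  rw [← sum_law_mul Q A (fun a => log (law Q A a)), ent, ← Finset.sum_neg_distrib]
  simp [negMulLog]

theorem ent_law (Q : Ω → ℝ) (F : Ω → α) (A : α → β) :
    ent (law Q F) A = ent Q (fun ω => A (F ω)) := by
  simp only [ent, law_law]

/-- Random variables that generate the same partition have the same entropy. -/
theorem ent_congr (Q : Ω → ℝ) {A : Ω → α} {B : Ω → β}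
    (h : ∀ ω ω', A ω = A ω' ↔ B ω = B ω') : ent Q A = ent Q B := by
  rw [ent_eq_neg_sum, ent_eq_neg_sum]
  congr 1
  refine Finset.sum_congr rfl fun ω _ => ?_
  rw [law_congr Q (fun ω' => h ω' ω)]

/-- Each fibre of `A` lies inside a fibre of `B`, so `law Q A (A ω) ≤ law Q B (B ω)`, and the
logarithm is monotone. -/
theorem ent_le_of_determines {Q : Ω → ℝ} (hQ : ∀ ω, 0 ≤ Q ω) {A : Ω → α} {B : Ω → β}
    (h : ∀ ω ω', A ω = A ω' → B ω = B ω') : ent Q B ≤ ent Q A := by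
  rw [ent_eq_neg_sum, ent_eq_neg_sum, neg_le_neg_iff]
  refine Finset.sum_le_sum fun ω _ => ?_
  rcases (hQ ω).eq_or_lt with h0 | h0
  · simp [← h0]
  · exact mul_le_mul_of_nonneg_left (Real.log_le_log (h0.trans_le (le_law hQ A ω))
      (law_mono hQ fun ω' => h ω' ω)) h0.le

theorem ent_nonneg {Q : Ω → ℝ} (hQ : Q ∈ stdSimplex ℝ Ω) (A : Ω → α) : 0 ≤ ent Q A :=
  Finset.sum_nonneg fun a _ => Real.negMulLog_nonneg (law_nonneg hQ.1 A a)
    (by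
      have := law_mem_stdSimplex hQ A
      rw [← this.2]
      exact Finset.single_le_sum (fun i _ => this.1 i) (Finset.mem_univ a))

theorem sum_negMulLog_le_log_card {p : α → ℝ} (hp : p ∈ stdSimplex ℝ α) :
    ∑ a, negMulLog (p a) ≤ log (Fintype.card α) := by
  have hne : Nonempty α := by
    by_contra h
    rw [not_nonempty_iff] at h
    simpa using hp.2
  have hN : (0 : ℝ) < Fintype.card α := by exact_mod_cast Fintype.card_pos
  -- Gibbs' inequality against the uniform law, pointwise: `log t ≤ t - 1` at `t = 1 / (card α * p
  -- a)`. The correction terms sum to zero.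
  have key : ∀ a, negMulLog (p a) ≤ p a * log (Fintype.card α) + ((Fintype.card α : ℝ)⁻¹ - p a) := by
    intro a
    rcases (hp.1 a).eq_or_lt with h0 | h0
    · simp [← h0]
    · have := Real.log_le_sub_one_of_pos (x := ((Fintype.card α : ℝ) * p a)⁻¹) (by positivity)
      rw [Real.log_inv, Real.log_mul hN.ne' h0.ne'] at this
      have h2 := mul_le_mul_of_nonneg_left this h0.le
      have h3 : p a * (((Fintype.card α : ℝ) * p a)⁻¹ - 1) = (Fintype.card α : ℝ)⁻¹ - p a := by
        field_simp
      rw [h3] at h2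
      unfold negMulLog
      linarith
  refine (Finset.sum_le_sum fun a _ => key a).trans ?_
  rw [Finset.sum_add_distrib, ← Finset.sum_mul, Finset.sum_sub_distrib, hp.2]
  simp [hN.ne']

theorem ent_le_log_card {Q : Ω → ℝ} (hQ : Q ∈ stdSimplex ℝ Ω) (A : Ω → α) :
    ent Q A ≤ log (Fintype.card α) :=
  sum_negMulLog_le_log_card (law_mem_stdSimplex hQ A)

/-- Strong subadditivity: conditional mutual information is nonnegative. -/
theorem ent_submodular {Q : Ω → ℝ} (hQ : ∀ ω, 0 ≤ Q ω) (A : Ω → α) (B : Ω → β) (C : Ω → γ) :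
    ent Q (fun ω => (A ω, B ω, C ω)) + ent Q C
      ≤ ent Q (fun ω => (A ω, C ω)) + ent Q (fun ω => (B ω, C ω)) := by
  set p := law Q (fun ω => (A ω, B ω, C ω)) with hp
  set pa := law Q (fun ω => (A ω, C ω)) with hpa
  set pb := law Q (fun ω => (B ω, C ω)) with hpb
  set pc := law Q C with hpc
  have p0 : ∀ z, 0 ≤ p z := law_nonneg hQ _
  have pa0 : ∀ z, 0 ≤ pa z := law_nonneg hQ _
  have pb0 : ∀ z, 0 ≤ pb z := law_nonneg hQ _
  have pc0 : ∀ z, 0 ≤ pc z := law_nonneg hQ _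
  -- `log t ≤ t - 1` for the ratio `t` of the conditionally independent law `pa pb / pc` to the true
  -- law `p`. The mean of `t` is at most the mass of `Q`, so the right side has nonpositive sum.
  have key : ∀ ω, Q ω * log (pa (A ω, C ω)) + Q ω * log (pb (B ω, C ω))
      - Q ω * log (p (A ω, B ω, C ω)) - Q ω * log (pc (C ω)) ≤
      Q ω * (pa (A ω, C ω) * pb (B ω, C ω) / pc (C ω) / p (A ω, B ω, C ω)) - Q ω := by
    intro ω
    rcases (hQ ω).eq_or_lt with h0 | h0
    · simp [← h0]
    · have h1 : 0 < p (A ω, B ω, C ω) := h0.trans_le (le_law hQ (fun ω => (A ω, B ω, C ω)) ω)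
      have h2 : 0 < pa (A ω, C ω) := h0.trans_le (le_law hQ (fun ω => (A ω, C ω)) ω)
      have h3 : 0 < pb (B ω, C ω) := h0.trans_le (le_law hQ (fun ω => (B ω, C ω)) ω)
      have h4 : 0 < pc (C ω) := h0.trans_le (le_law hQ C ω)
      have := Real.log_le_sub_one_of_pos
        (x := pa (A ω, C ω) * pb (B ω, C ω) / pc (C ω) / p (A ω, B ω, C ω)) (by positivity)
      rw [Real.log_div (by positivity) h1.ne', Real.log_div (by positivity) h4.ne',
        Real.log_mul h2.ne' h3.ne'] at this
      nlinarith [mul_le_mul_of_nonneg_left this h0.le]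
  have hsum := Finset.sum_le_sum fun ω (_ : ω ∈ Finset.univ) => key ω
  simp only [Finset.sum_sub_distrib, Finset.sum_add_distrib] at hsum
  have hbound : ∑ ω, Q ω * (pa (A ω, C ω) * pb (B ω, C ω) / pc (C ω) / p (A ω, B ω, C ω))
      ≤ ∑ ω, Q ω := by
    rw [← sum_law_mul Q (fun ω => (A ω, B ω, C ω))
      (fun z => pa (z.1, z.2.2) * pb (z.2.1, z.2.2) / pc z.2.2 / p z), ← hp]
    calc ∑ z, p z * (pa (z.1, z.2.2) * pb (z.2.1, z.2.2) / pc z.2.2 / p z)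
        ≤ ∑ z : α × β × γ, pa (z.1, z.2.2) * pb (z.2.1, z.2.2) / pc z.2.2 := by
          refine Finset.sum_le_sum fun z _ => ?_
          have h5 : 0 ≤ pa (z.1, z.2.2) * pb (z.2.1, z.2.2) / pc z.2.2 :=
            div_nonneg (mul_nonneg (pa0 _) (pb0 _)) (pc0 _)
          rcases (p0 z).eq_or_lt with h0 | h0
          · simpa [← h0] using h5
          · exact (mul_div_cancel₀ _ h0.ne').le
      _ = ∑ c, (∑ a, pa (a, c)) * (∑ b, pb (b, c)) / pc c := by
          simp only [Fintype.sum_prod_type, Finset.sum_mul_sum, Finset.sum_div]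
          conv_rhs => rw [Finset.sum_comm]
          refine Finset.sum_congr rfl fun a _ => ?_
          rw [Finset.sum_comm]
      _ = ∑ c, pc c * pc c / pc c := by
          refine Finset.sum_congr rfl fun c _ => ?_
          have e1 : ∑ a, pa (a, c) = pc c := by
            rw [hpc, ← sum_law_pair Q C A c]
            exact Finset.sum_congr rfl fun a _ => law_congr Q (by simp [and_comm])
          have e2 : ∑ b, pb (b, c) = pc c := by
            rw [hpc, ← sum_law_pair Q C B c]
            exact Finset.sum_congr rfl fun a _ => law_congr Q (by simp [and_comm])
          rw [e1, e2]
      _ = ∑ c, pc c := by simp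
      _ = ∑ ω, Q ω := sum_law Q C
  rw [ent_eq_neg_sum, ent_eq_neg_sum, ent_eq_neg_sum, ent_eq_neg_sum]
  simp only [← hp, ← hpa, ← hpb, ← hpc]
  linarith

theorem ent_pair_le {Q : Ω → ℝ} (hQ : Q ∈ stdSimplex ℝ Ω) (A : Ω → α) (B : Ω → β) :
    ent Q (fun ω => (A ω, B ω)) ≤ ent Q A + ent Q B := by
  have h := ent_submodular hQ.1 A B (fun _ => ())
  rw [ent_congr Q (A := fun ω => (A ω, B ω, ())) (B := fun ω => (A ω, B ω)) (by simp),
    ent_congr Q (A := fun ω => (A ω, ())) (B := A) (by simp),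
    ent_congr Q (A := fun ω => (B ω, ())) (B := B) (by simp)] at h
  linarith [ent_nonneg hQ (fun _ : Ω => ())]

/-- Conditional entropy of a vector is at most the sum of the conditional entropies. -/
theorem ent_vector_le {Q : Ω → ℝ} (hQ : ∀ ω, 0 ≤ Q ω) {ι : Type*} [Fintype ι] [DecidableEq ι]
    (A : Ω → ι → α) (B : Ω → β) :
    ent Q (fun ω => (A ω, B ω)) - ent Q B
      ≤ ∑ i, (ent Q (fun ω => (A ω i, B ω)) - ent Q B) := by
  -- Induction on the set of revealed coordinates. Hidden ones are set to `none`, so that all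
  -- partial vectors have the same type.
  have main : ∀ J : Finset ι,
      ent Q (fun ω => ((fun i => if i ∈ J then some (A ω i) else none : ι → Option α), B ω))
        - ent Q B ≤ ∑ i ∈ J, (ent Q (fun ω => (A ω i, B ω)) - ent Q B) := by
    intro J
    induction J using Finset.induction_on with
    | empty =>
      simp only [Finset.notMem_empty, if_false, Finset.sum_empty]
      rw [ent_congr Q (B := B) (by simp)]
      simp
    | insert j J hj ih =>
      rw [Finset.sum_insert hj]
      have h := ent_submodular hQ (fun ω => A ω j)
        (fun ω => (fun i => if i ∈ J then some (A ω i) else none : ι → Option α)) B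
      rw [ent_congr Q (A := fun ω => (A ω j,
        (fun i => if i ∈ J then some (A ω i) else none : ι → Option α), B ω))
        (B := fun ω => ((fun i => if i ∈ insert j J then some (A ω i) else none : ι → Option α),
          B ω)) ?_] at h
      · linarith
      · intro ω ω'
        simp only [Prod.mk.injEq, funext_iff]
        constructor
        · rintro ⟨h1, h2, h3⟩
          refine ⟨fun i => ?_, h3⟩
          by_cases hi : i = j
          · subst hi; simp [h1]
          · simpa [hi] using h2 i
        · rintro ⟨h1, h3⟩
          refine ⟨by simpa using h1 j, fun i => ?_, h3⟩
          by_cases hi : i ∈ J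
          · simpa [hi] using h1 i
          · simp [hi]
  have h := main Finset.univ
  rw [ent_congr Q (B := fun ω => (A ω, B ω)) (by simp [funext_iff])] at h
  exact h

theorem ent_vector_le_sum {Q : Ω → ℝ} (hQ : Q ∈ stdSimplex ℝ Ω) {ι : Type*} [Fintype ι] [DecidableEq ι]
    (A : Ω → ι → α) : ent Q A ≤ ∑ i, ent Q (fun ω => A ω i) := by
  have h := ent_vector_le hQ.1 A (fun _ => ())
  rw [ent_congr Q (A := fun ω => (A ω, ())) (B := A) (by simp)] at h
  have h0 : ent Q (fun _ : Ω => ()) = 0 :=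
    le_antisymm (by simpa using ent_le_log_card hQ (fun _ : Ω => ())) (ent_nonneg hQ _)
  have h1 : ∀ i, ent Q (fun ω => (A ω i, ())) = ent Q (fun ω => A ω i) := fun i =>
    ent_congr Q (by simp)
  simpa [h0, h1] using h

/-- The entropy of the input and output of a channel `V`. -/
theorem ent_channel {Q : Ω → ℝ} {A : Ω → α} {B : Ω → β} {V : α → β → ℝ}
    (hV : ∀ a, ∑ b, V a b = 1)
    (h : ∀ a b, law Q (fun ω => (A ω, B ω)) (a, b) = law Q A a * V a b) :
    ent Q (fun ω => (A ω, B ω)) = ent Q A + ∑ a, law Q A a * ∑ b, negMulLog (V a b) := by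
  simp only [ent, Fintype.sum_prod_type, h, Real.negMulLog_mul, Finset.sum_add_distrib,
    ← Finset.sum_mul, hV, one_mul, ← Finset.mul_sum]

end Entropy

/-! ### Sums against product distributions. -/

section Product

variable {ι : Type*} [Fintype ι] [DecidableEq ι] {α : Type*} [Fintype α]

theorem sum_prod_mul_eq (p : ι → α → ℝ) (hp : ∀ i, ∑ a, p i a = 1) (f : α → ℝ) (j : ι) :
    ∑ u : ι → α, (∏ i, p i (u i)) * f (u j) = ∑ a, p j a * f a := by
  have h := Finset.prod_univ_sum (fun _ : ι => (Finset.univ : Finset α))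
    (fun i a => p i a * if i = j then f a else 1)
  rw [Fintype.piFinset_univ] at h
  simp only [Finset.prod_mul_distrib, Finset.prod_ite_eq', Finset.mem_univ, if_true] at h
  rw [← h, Finset.prod_eq_single j]
  · simp
  · intro i _ hi
    simp [hi, hp]
  · simp

theorem sum_prod_mul_mul_eq (p : ι → α → ℝ) (hp : ∀ i, ∑ a, p i a = 1) (f g : α → ℝ) {j k : ι}
    (hjk : j ≠ k) :
    ∑ u : ι → α, (∏ i, p i (u i)) * (f (u j) * g (u k))
      = (∑ a, p j a * f a) * ∑ a, p k a * g a := by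
  have h := Finset.prod_univ_sum (fun _ : ι => (Finset.univ : Finset α))
    (fun i a => p i a * ((if i = j then f a else 1) * if i = k then g a else 1))
  rw [Fintype.piFinset_univ] at h
  simp only [Finset.prod_mul_distrib, Finset.prod_ite_eq', Finset.mem_univ, if_true] at h
  rw [← h, ← Finset.mul_prod_erase _ _ (Finset.mem_univ j),
    ← Finset.mul_prod_erase _ _ (Finset.mem_erase.2 ⟨hjk.symm, Finset.mem_univ k⟩),
    Finset.prod_eq_one]
  · simp [hjk, hjk.symm]
  · intro i hi
    simp only [Finset.mem_erase, Finset.mem_univ, and_true] at hi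
    simp [hi.1, hi.2, hp]

theorem sum_prod_eq_one (p : ι → α → ℝ) (hp : ∀ i, ∑ a, p i a = 1) :
    ∑ u : ι → α, ∏ i, p i (u i) = 1 := by
  have h := Finset.prod_univ_sum (fun _ : ι => (Finset.univ : Finset α)) p
  rw [Fintype.piFinset_univ] at h
  rw [← h]
  simp [hp]

theorem prod_mem_stdSimplex {p : ι → α → ℝ} (hp : ∀ i, p i ∈ stdSimplex ℝ α) :
    (fun u : ι → α => ∏ i, p i (u i)) ∈ stdSimplex ℝ (ι → α) :=
  ⟨fun _ => Finset.prod_nonneg fun i _ => (hp i).1 _, sum_prod_eq_one p fun i => (hp i).2⟩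

/-- Additivity of entropy over independent coordinates. The factors may differ, so that the lemma
also covers a memoryless channel at a fixed input word. -/
theorem sum_negMulLog_prod (p : ι → α → ℝ) (hp : ∀ i, ∑ a, p i a = 1) :
    ∑ u : ι → α, negMulLog (∏ i, p i (u i)) = ∑ i, ∑ a, negMulLog (p i a) := by
  have h : ∀ u : ι → α, negMulLog (∏ i, p i (u i))
      = ∑ j, (∏ i, p i (u i)) * (-log (p j (u j))) := by
    intro u
    by_cases h0 : ∏ i, p i (u i) = 0
    · simp [h0]
    · rw [negMulLog, Real.log_prod (fun i hi => (Finset.prod_ne_zero_iff.1 h0) i hi),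
        ← Finset.mul_sum, Finset.sum_neg_distrib]
      ring
  simp only [h]
  rw [Finset.sum_comm]
  refine Finset.sum_congr rfl fun j _ => ?_
  rw [sum_prod_mul_eq p hp (fun a => -log (p j a)) j]
  simp [negMulLog]

end Product

/-! ### Quantitative continuity of entropy in total variation. -/

section Continuity

variable {α : Type*} [Fintype α]

/-- This and `negMulLog_sub_le` bound the rise of `negMulLog` when its argument grows, respectively
shrinks, by a given amount. Applied atom by atom, they reduce the continuity of entropy to the
positive and negative parts of `q - p`. -/
theorem negMulLog_add_le {x y : ℝ} (hx : 0 ≤ x) (hy : 0 ≤ y) :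
    negMulLog (x + y) ≤ negMulLog x + negMulLog y := by
  rcases hx.eq_or_lt with h | h
  · simp [← h]
  rcases hy.eq_or_lt with h' | h'
  · simp [← h']
  unfold negMulLog
  have h1 := Real.log_le_log h (by linarith : x ≤ x + y)
  have h2 := Real.log_le_log h' (by linarith : y ≤ x + y)
  nlinarith

theorem negMulLog_sub_le {x y : ℝ} (hx : 0 ≤ x) (hxy : x ≤ y) (hy : y ≤ 1) :
    negMulLog x - negMulLog y ≤ y - x := by
  rcases hx.eq_or_lt with h | h
  · subst h
    have : y * log y ≤ 0 := Real.mul_log_nonpos hxy hy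
    simp [negMulLog]
    linarith
  · have hy0 : 0 < y := h.trans_le hxy
    have h1 := Real.log_le_sub_one_of_pos (x := y / x) (by positivity)
    rw [Real.log_div hy0.ne' h.ne'] at h1
    have h2 := mul_le_mul_of_nonneg_left h1 h.le
    have h3 : x * (y / x - 1) = y - x := by field_simp
    have h4 : (y - x) * log y ≤ 0 :=
      mul_nonpos_of_nonneg_of_nonpos (by linarith) (Real.log_nonpos hy0.le hy)
    unfold negMulLog
    nlinarith

theorem sum_posPart_sub_eq_tvDist {p q : α → ℝ} (h : ∑ a, p a = ∑ a, q a) :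
    ∑ a, max (q a - p a) 0 = tvDist p q := by
  have h1 : ∀ a, max (q a - p a) 0 = (1 / 2) * |p a - q a| + (1 / 2) * (q a - p a) := by
    intro a
    rcases le_total (q a) (p a) with h | h
    · rw [max_eq_right (by linarith), abs_of_nonneg (by linarith)]; ring
    · rw [max_eq_left (by linarith), abs_of_nonpos (by linarith)]; ring
  simp only [h1, Finset.sum_add_distrib, ← Finset.mul_sum, Finset.sum_sub_distrib, h, tvDist]
  ring

theorem tvDist_comm (p q : α → ℝ) : tvDist p q = tvDist q p := by
  simp only [tvDist, abs_sub_comm]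

theorem tvDist_nonneg (p q : α → ℝ) : 0 ≤ tvDist p q := by
  unfold tvDist
  positivity

/-- One-sided continuity of the entropy, uniform in the alphabet up to the logarithm of its
cardinality. -/
theorem sum_negMulLog_sub_le {p q : α → ℝ} (hp : p ∈ stdSimplex ℝ α) (hq : q ∈ stdSimplex ℝ α) :
    ∑ a, negMulLog (q a) - ∑ a, negMulLog (p a)
      ≤ tvDist p q * log (Fintype.card α) + negMulLog (tvDist p q) + tvDist p q := by
  set d := tvDist p q with hd
  have hp1 : ∀ a, p a ≤ 1 := fun a => by
    rw [← hp.2]; exact Finset.single_le_sum (fun i _ => hp.1 i) (Finset.mem_univ a)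
  have hsum1 : ∑ a, max (q a - p a) 0 = d := sum_posPart_sub_eq_tvDist (by rw [hp.2, hq.2])
  have hsum2 : ∑ a, max (p a - q a) 0 = d := by
    rw [sum_posPart_sub_eq_tvDist (by rw [hp.2, hq.2]), tvDist_comm]
  have key : ∀ a, negMulLog (q a) - negMulLog (p a)
      ≤ negMulLog (max (q a - p a) 0) + max (p a - q a) 0 := by
    intro a
    rcases le_total (q a) (p a) with h | h
    · rw [max_eq_right (by linarith), max_eq_left (by linarith)]
      simpa using negMulLog_sub_le (hq.1 a) h (hp1 a)
    · rw [max_eq_left (by linarith), max_eq_right (by linarith)]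
      have := negMulLog_add_le (hp.1 a) (sub_nonneg.2 h)
      rw [add_sub_cancel] at this
      linarith
  have h1 := Finset.sum_le_sum fun a (_ : a ∈ Finset.univ) => key a
  rw [Finset.sum_sub_distrib, Finset.sum_add_distrib, hsum2] at h1
  suffices h2 : ∑ a, negMulLog (max (q a - p a) 0) ≤ d * log (Fintype.card α) + negMulLog d by
    linarith
  rcases (tvDist_nonneg p q).eq_or_lt with h0 | h0
  · rw [← hd] at h0
    have : ∀ a, max (q a - p a) 0 = 0 := by
      intro a
      have := (Finset.sum_eq_zero_iff_of_nonneg (fun i _ => le_max_right (q i - p i) 0)).1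
        (hsum1.trans h0.symm) a (Finset.mem_univ a)
      exact this
    simp [this, ← h0]
  · rw [← hd] at h0
    -- The positive part of `q - p` has mass `d`. Normalised, its entropy is at most `log card`;
    -- undoing the scaling multiplies by `d` and adds `negMulLog d`.
    have hs : (fun a => max (q a - p a) 0 / d) ∈ stdSimplex ℝ α :=
      ⟨fun a => div_nonneg (le_max_right _ _) h0.le, by
        rw [← Finset.sum_div, hsum1, div_self h0.ne']⟩
    have h3 := sum_negMulLog_le_log_card hs
    have h4 : ∀ a, negMulLog (max (q a - p a) 0)
        = d * negMulLog (max (q a - p a) 0 / d) + (max (q a - p a) 0 / d) * negMulLog d := by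
      intro a
      conv_lhs => rw [← div_mul_cancel₀ (max (q a - p a) 0) h0.ne', Real.negMulLog_mul]
    simp only [h4, Finset.sum_add_distrib, ← Finset.mul_sum, ← Finset.sum_mul, ← Finset.sum_div,
      hsum1, div_self h0.ne', one_mul]
    gcongr

theorem tvDist_law_le {Ω : Type*} [Fintype Ω] (P Q : Ω → ℝ) (A : Ω → α) :
    tvDist (law P A) (law Q A) ≤ tvDist P Q := by
  unfold tvDist
  refine mul_le_mul_of_nonneg_left ?_ (by norm_num)
  calc ∑ a, |law P A a - law Q A a| ≤ ∑ a, law (fun ω => |P ω - Q ω|) A a := by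
        refine Finset.sum_le_sum fun a _ => ?_
        rw [law, law, law, ← Finset.sum_sub_distrib]
        exact Finset.abs_sum_le_sum_abs _ _
    _ = _ := sum_law _ _

end Continuity

/-! ### Second moments, Chebyshev, and the probabilistic method. -/

section Moments

variable {I J α : Type*} [Fintype I] [DecidableEq I] [Fintype J] [Fintype α]

theorem sum_mul_abs_le_sqrt {w x : α → ℝ} (hw : w ∈ stdSimplex ℝ α) :
    ∑ a, w a * |x a| ≤ √(∑ a, w a * x a ^ 2) := by
  apply Real.le_sqrt_of_sq_le
  have := Finset.sum_sq_le_sum_mul_sum_of_sq_le_mul Finset.univ (r := fun a => w a * |x a|)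
    (f := w) (g := fun a => w a * x a ^ 2) (fun i _ => hw.1 i)
    (fun i _ => mul_nonneg (hw.1 i) (sq_nonneg _)) (fun i _ => by rw [mul_pow, sq_abs]; exact le_of_eq (by ring))
  simpa [hw.2] using this

/-- The variance of a sum of independent identically distributed terms. -/
theorem sum_prod_mul_sq_sum {p : α → ℝ} (hp : ∑ a, p a = 1) (f : α → ℝ)
    (e : J → I) (he : Function.Injective e) :
    ∑ φ : I → α, (∏ i, p (φ i)) * (∑ j, (f (φ (e j)) - ∑ a, p a * f a)) ^ 2
      = Fintype.card J * ∑ a, p a * (f a - ∑ a, p a * f a) ^ 2 := by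
  set m := ∑ a, p a * f a with hm
  have h0 : ∑ a, p a * (f a - m) = 0 := by
    simp only [mul_sub, Finset.sum_sub_distrib, ← Finset.sum_mul, hp, ← hm]
    ring
  have h1 : ∀ j k : J, ∑ φ : I → α, (∏ i, p (φ i)) * ((f (φ (e j)) - m) * (f (φ (e k)) - m))
      = if j = k then ∑ a, p a * (f a - m) ^ 2 else 0 := by
    intro j k
    split_ifs with h
    · subst h
      have := sum_prod_mul_eq (fun _ : I => p) (fun _ => hp) (fun a => (f a - m) ^ 2) (e j)
      simpa [sq] using this
    · have := sum_prod_mul_mul_eq (fun _ : I => p) (fun _ => hp) (fun a => f a - m)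
        (fun a => f a - m) (j := e j) (k := e k) (fun h' => h (he h'))
      rw [this, h0]
      simp
  calc _ = ∑ j, ∑ k, ∑ φ : I → α,
        (∏ i, p (φ i)) * ((f (φ (e j)) - m) * (f (φ (e k)) - m)) := by
        simp only [sq (∑ j, _), Finset.sum_mul_sum]
        simp only [Finset.mul_sum]
        rw [Finset.sum_comm]
        refine Finset.sum_congr rfl fun j _ => ?_
        rw [Finset.sum_comm]
    _ = _ := by
        simp [h1]

/-- The probabilistic method: extracts one codebook from a bound on the average over random
codebooks. -/
theorem exists_le_of_sum_le {w x : α → ℝ} (hw : w ∈ stdSimplex ℝ α) {b : ℝ}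
    (h : ∑ a, w a * x a ≤ b) : ∃ a, x a ≤ b := by
  by_contra! hlt
  have hpos : ∃ a ∈ Finset.univ, 0 < w a := by
    by_contra! h0
    have := Finset.sum_nonpos h0
    rw [hw.2] at this
    linarith
  obtain ⟨a, _, ha⟩ := hpos
  have : ∑ a, w a * b < ∑ a, w a * x a :=
    Finset.sum_lt_sum (fun i _ => mul_le_mul_of_nonneg_left (hlt i).le (hw.1 i))
      ⟨a, Finset.mem_univ a, mul_lt_mul_of_pos_left (hlt a) ha⟩
  rw [← Finset.sum_mul, hw.2, one_mul] at this
  linarith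

/-- Chebyshev's inequality for the empirical mean of an i.i.d. sequence. -/
theorem sum_iid_deviation_le {p : α → ℝ} (hp : p ∈ stdSimplex ℝ α) (f : α → ℝ) {δ : ℝ}
    (hδ : 0 < δ) (n : ℕ) :
    ∑ z : Fin n → α, (if n * δ ≤ |∑ i, (f (z i) - ∑ a, p a * f a)| then iid p n z else 0)
      ≤ (∑ a, p a * (f a - ∑ a, p a * f a) ^ 2) / (n * δ ^ 2) + if n = 0 then 1 else 0 := by
  set m := ∑ a, p a * f a with hm
  have hiid : ∀ z : Fin n → α, 0 ≤ iid p n z := fun z => Finset.prod_nonneg fun i _ => hp.1 _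
  rcases Nat.eq_zero_or_pos n with h0 | h0
  -- At `n = 0` the event is certain while the Chebyshev quotient is `0`, a division by zero; the
  -- indicator in the bound makes up for it.
  · subst h0
    simp [iid]
  · have hn : (0 : ℝ) < n := by exact_mod_cast h0
    rw [if_neg h0.ne', add_zero, le_div_iff₀ (by positivity)]
    have h := sum_prod_mul_sq_sum hp.2 f (fun i : Fin n => i) Function.injective_id
    rw [← hm, Fintype.card_fin] at h
    have h2 : (∑ z : Fin n → α, (if n * δ ≤ |∑ i, (f (z i) - m)| then iid p n z else 0))
        * (n * δ) ^ 2 ≤ n * ∑ a, p a * (f a - m) ^ 2 := by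
      rw [← h, Finset.sum_mul]
      refine Finset.sum_le_sum fun z _ => ?_
      split_ifs with hz
      · refine mul_le_mul_of_nonneg_left ?_ (hiid z)
        rw [← sq_abs (∑ i, (f (z i) - m))]
        exact pow_le_pow_left₀ (by positivity) hz 2
      · rw [zero_mul]
        exact mul_nonneg (hiid z) (sq_nonneg _)
    have h3 : (∑ z : Fin n → α, (if n * δ ≤ |∑ i, (f (z i) - m)| then iid p n z else 0))
        * (n * δ ^ 2) * n ≤ (∑ a, p a * (f a - m) ^ 2) * n := by
      calc _ = (∑ z : Fin n → α, (if n * δ ≤ |∑ i, (f (z i) - m)| then iid p n z else 0))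
        * (n * δ) ^ 2 := by ring
        _ ≤ _ := h2
        _ = _ := by ring
    exact le_of_mul_le_mul_right h3 hn

theorem tendsto_sum_iid_deviation {p : α → ℝ} (hp : p ∈ stdSimplex ℝ α) (f : α → ℝ) {δ : ℝ}
    (hδ : 0 < δ) :
    Filter.Tendsto (fun n : ℕ => ∑ z : Fin n → α,
      (if n * δ ≤ |∑ i, (f (z i) - ∑ a, p a * f a)| then iid p n z else 0))
      Filter.atTop (nhds 0) := by
  have hlim : Filter.Tendsto (fun n : ℕ =>
      (∑ a, p a * (f a - ∑ a, p a * f a) ^ 2) / (n * δ ^ 2)) Filter.atTop (nhds 0) := by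
    refine Filter.Tendsto.div_atTop tendsto_const_nhds ?_
    exact Filter.Tendsto.atTop_mul_const (by positivity) tendsto_natCast_atTop_atTop
  refine squeeze_zero' (Filter.Eventually.of_forall fun n => ?_) ?_ hlim
  · refine Finset.sum_nonneg fun z _ => ?_
    split_ifs
    · exact Finset.prod_nonneg fun i _ => hp.1 _
    · exact le_rfl
  · filter_upwards [Filter.eventually_gt_atTop 0] with n hn
    simpa [hn.ne'] using sum_iid_deviation_le hp f hδ n

end Moments

/-! ### Information density of memoryless channels and its concentration. -/

section InformationDensity

variable {U Z : Type*} [Fintype U] [Fintype Z]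

/-- The output distribution of the channel `V` with input distribution `p`. -/
def output (p : U → ℝ) (V : U → Z → ℝ) (z : Z) : ℝ := ∑ u, p u * V u z

/-- The mean of the information density `log (V u z / output p V z)`, in nats. -/
def channelInfo (p : U → ℝ) (V : U → Z → ℝ) : ℝ :=
  ∑ x : U × Z, (p x.1 * V x.1 x.2) * log (V x.1 x.2 / output p V x.2)

theorem output_nonneg {p : U → ℝ} {V : U → Z → ℝ} (hp : ∀ u, 0 ≤ p u) (hV : ∀ u z, 0 ≤ V u z)
    (z : Z) : 0 ≤ output p V z :=
  Finset.sum_nonneg fun u _ => mul_nonneg (hp u) (hV u z)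

theorem output_mem_stdSimplex {p : U → ℝ} {V : U → Z → ℝ} (hp : p ∈ stdSimplex ℝ U)
    (hV : ∀ u, V u ∈ stdSimplex ℝ Z) : output p V ∈ stdSimplex ℝ Z := by
  refine ⟨output_nonneg hp.1 fun u => (hV u).1, ?_⟩
  simp only [output]
  rw [Finset.sum_comm]
  simp [← Finset.mul_sum, (hV _).2, hp.2]

theorem joint_mem_stdSimplex {p : U → ℝ} {V : U → Z → ℝ} (hp : p ∈ stdSimplex ℝ U)
    (hV : ∀ u, V u ∈ stdSimplex ℝ Z) :
    (fun x : U × Z => p x.1 * V x.1 x.2) ∈ stdSimplex ℝ (U × Z) := by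
  refine ⟨fun x => mul_nonneg (hp.1 _) ((hV _).1 _), ?_⟩
  simp [Fintype.sum_prod_type, ← Finset.mul_sum, (hV _).2, hp.2]

/-- The memoryless extension of a channel. -/
def memoryless (V : U → Z → ℝ) (n : ℕ) (u : Fin n → U) (z : Fin n → Z) : ℝ := ∏ i, V (u i) (z i)

theorem memoryless_mem_stdSimplex {V : U → Z → ℝ} (hV : ∀ u, V u ∈ stdSimplex ℝ Z) (n : ℕ)
    (u : Fin n → U) : memoryless V n u ∈ stdSimplex ℝ (Fin n → Z) :=
  prod_mem_stdSimplex (p := fun i => V (u i)) fun i => hV (u i)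

theorem iid_mem_stdSimplex {p : U → ℝ} (hp : p ∈ stdSimplex ℝ U) (n : ℕ) :
    iid p n ∈ stdSimplex ℝ (Fin n → U) :=
  prod_mem_stdSimplex (p := fun _ : Fin n => p) fun _ => hp

theorem output_iid_memoryless (p : U → ℝ) (V : U → Z → ℝ) (n : ℕ) :
    output (iid p n) (memoryless V n) = iid (output p V) n := by
  funext z
  have h := Finset.prod_univ_sum (fun _ : Fin n => (Finset.univ : Finset U))
    (fun i u => p u * V u (z i))
  rw [Fintype.piFinset_univ] at h
  simp only [output, iid, memoryless, h, Finset.prod_mul_distrib]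

theorem sum_arrow_prod {n : ℕ} (F : (Fin n → U) → (Fin n → Z) → ℝ) :
    ∑ x : Fin n → U × Z, F (fun i => (x i).1) (fun i => (x i).2) = ∑ u, ∑ z, F u z := by
  rw [← Fintype.sum_prod_type' F]
  exact Fintype.sum_equiv (Equiv.arrowProdEquivProdArrow (Fin n) (fun _ => U) (fun _ => Z)) _ _
    fun x => rfl

/-- On the support of the joint law the quotient inside the logarithm is a genuine positive number,
so the values of `log 0` and `x / 0` never enter. -/
theorem joint_pos {p : U → ℝ} {V : U → Z → ℝ} (hp : p ∈ stdSimplex ℝ U)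
    (hV : ∀ u, V u ∈ stdSimplex ℝ Z) {n : ℕ} {x : Fin n → U × Z}
    (hx : iid (fun x : U × Z => p x.1 * V x.1 x.2) n x ≠ 0) (i : Fin n) :
    0 < V (x i).1 (x i).2 ∧ 0 < output p V (x i).2 := by
  have h := (Finset.prod_ne_zero_iff.1 hx) i (Finset.mem_univ i)
  have h1 : 0 < p (x i).1 := (hp.1 _).lt_of_ne' (left_ne_zero_of_mul h)
  have h2 : 0 < V (x i).1 (x i).2 := ((hV _).1 _).lt_of_ne' (right_ne_zero_of_mul h)
  refine ⟨h2, (mul_pos h1 h2).trans_le ?_⟩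
  exact Finset.single_le_sum (f := fun u => p u * V u (x i).2)
    (fun u _ => mul_nonneg (hp.1 u) ((hV u).1 _)) (Finset.mem_univ _)

theorem sum_information_density {p : U → ℝ} {V : U → Z → ℝ} (hp : p ∈ stdSimplex ℝ U)
    (hV : ∀ u, V u ∈ stdSimplex ℝ Z) {n : ℕ} {x : Fin n → U × Z}
    (hx : iid (fun x : U × Z => p x.1 * V x.1 x.2) n x ≠ 0) :
    memoryless V n (fun i => (x i).1) (fun i => (x i).2)
      = Real.exp (∑ i, log (V (x i).1 (x i).2 / output p V (x i).2))
        * iid (output p V) n (fun i => (x i).2) := by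
  rw [Real.exp_sum, memoryless, iid, ← Finset.prod_mul_distrib]
  refine Finset.prod_congr rfl fun i _ => ?_
  obtain ⟨h1, h2⟩ := joint_pos hp hV hx i
  rw [Real.exp_log (by positivity), div_mul_cancel₀ _ h2.ne']

/-- The information density of `n` uses of the channel concentrates: if the event `E n` forces a
linear deviation of the information density from its mean, its probability vanishes. -/
theorem tendsto_information_density {p : U → ℝ} {V : U → Z → ℝ} (hp : p ∈ stdSimplex ℝ U)
    (hV : ∀ u, V u ∈ stdSimplex ℝ Z) {δ : ℝ} (hδ : 0 < δ)
    (E : ∀ n, (Fin n → U) → (Fin n → Z) → Prop)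
    (hE : ∀ n (x : Fin n → U × Z), iid (fun x : U × Z => p x.1 * V x.1 x.2) n x ≠ 0 →
      E n (fun i => (x i).1) (fun i => (x i).2) →
      n * δ ≤ |∑ i, log (V (x i).1 (x i).2 / output p V (x i).2) - n * channelInfo p V|) :
    Filter.Tendsto (fun n : ℕ => ∑ u, ∑ z,
      if E n u z then iid p n u * memoryless V n u z else 0) Filter.atTop (nhds 0) := by
  refine squeeze_zero (fun n => ?_) (fun n => ?_) (tendsto_sum_iid_deviation
    (joint_mem_stdSimplex hp hV) (fun x => log (V x.1 x.2 / output p V x.2)) hδ)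
  · refine Finset.sum_nonneg fun u _ => Finset.sum_nonneg fun z _ => ?_
    split_ifs
    · exact mul_nonneg ((iid_mem_stdSimplex hp n).1 u) ((memoryless_mem_stdSimplex hV n u).1 z)
    · exact le_rfl
  · rw [← sum_arrow_prod (fun u z => if E n u z then iid p n u * memoryless V n u z else 0)]
    refine Finset.sum_le_sum fun x _ => ?_
    have hx : iid p n (fun i => (x i).1) * memoryless V n (fun i => (x i).1) (fun i => (x i).2)
        = iid (fun x : U × Z => p x.1 * V x.1 x.2) n x := by
      simp [iid, memoryless, Finset.prod_mul_distrib]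
    rw [hx]
    have h0 := (iid_mem_stdSimplex (joint_mem_stdSimplex hp hV) n).1 x
    by_cases hx0 : iid (fun x : U × Z => p x.1 * V x.1 x.2) n x = 0
    · simp [hx0]
    by_cases hEx : E n (fun i => (x i).1) (fun i => (x i).2)
    · have := hE n x hx0 hEx
      rw [if_pos hEx, if_pos]
      simpa [Finset.sum_sub_distrib, channelInfo] using this
    · rw [if_neg hEx]
      split_ifs
      · exact h0
      · exact le_rfl

/-- Upper tail, the atypical event of soft covering. The lower tail in
`tendsto_information_density_le` is the event that the transmitted codeword fails the decoding test.
-/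
theorem tendsto_information_density_gt {p : U → ℝ} {V : U → Z → ℝ} (hp : p ∈ stdSimplex ℝ U)
    (hV : ∀ u, V u ∈ stdSimplex ℝ Z) {r : ℝ} (hr : channelInfo p V < r) :
    Filter.Tendsto (fun n : ℕ => ∑ u, ∑ z,
      if Real.exp (n * r) * output (iid p n) (memoryless V n) z < memoryless V n u z
        then iid p n u * memoryless V n u z else 0) Filter.atTop (nhds 0) := by
  refine tendsto_information_density hp hV (sub_pos.2 hr)
    (fun n u z => Real.exp (n * r) * output (iid p n) (memoryless V n) z < memoryless V n u z) ?_
  intro n x hx hE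
  rw [output_iid_memoryless, sum_information_density hp hV hx] at hE
  have hpos : 0 < iid (output p V) n (fun i => (x i).2) :=
    Finset.prod_pos fun i _ => (joint_pos hp hV hx i).2
  have := Real.exp_lt_exp.1 (lt_of_mul_lt_mul_right hE hpos.le)
  refine le_trans ?_ (le_abs_self _)
  linarith

theorem tendsto_information_density_le {p : U → ℝ} {V : U → Z → ℝ} (hp : p ∈ stdSimplex ℝ U)
    (hV : ∀ u, V u ∈ stdSimplex ℝ Z) {r : ℝ} (hr : r < channelInfo p V) :
    Filter.Tendsto (fun n : ℕ => ∑ u, ∑ z,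
      if memoryless V n u z ≤ Real.exp (n * r) * output (iid p n) (memoryless V n) z
        then iid p n u * memoryless V n u z else 0) Filter.atTop (nhds 0) := by
  refine tendsto_information_density hp hV (sub_pos.2 hr)
    (fun n u z => memoryless V n u z ≤ Real.exp (n * r) * output (iid p n) (memoryless V n) z) ?_
  intro n x hx hE
  rw [output_iid_memoryless, sum_information_density hp hV hx] at hE
  have hpos : 0 < iid (output p V) n (fun i => (x i).2) :=
    Finset.prod_pos fun i _ => (joint_pos hp hV hx i).2
  have := Real.exp_le_exp.1 (le_of_mul_le_mul_right hE hpos)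
  refine le_trans ?_ (neg_le_abs _)
  linarith

end InformationDensity

/-! ### Soft covering and threshold decoding for a random codebook. -/

section RandomCodebook

variable {U Z : Type*} [Fintype U] [Fintype Z]

/-- Soft covering: the output of the channel `V` driven by a uniformly chosen codeword of a random
codebook approximates the output of `V` driven by the codeword distribution. -/
theorem soft_covering {I J : Type*} [Fintype I] [DecidableEq I] [Fintype J] [Nonempty J]
    {p : U → ℝ} (hp : p ∈ stdSimplex ℝ U) {V : U → Z → ℝ}
    (hV : ∀ u, V u ∈ stdSimplex ℝ Z) (e : J → I) (he : Function.Injective e) {B : ℝ}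
    (hB : 0 ≤ B) :
    ∑ φ : I → U, (∏ i, p (φ i)) *
        ∑ z, |(Fintype.card J : ℝ)⁻¹ * ∑ j, V (φ (e j)) z - output p V z|
      ≤ √(B / Fintype.card J)
        + 2 * ∑ u, ∑ z, if B * output p V z < V u z then p u * V u z else 0 := by
  have hJ : (0 : ℝ) < Fintype.card J := by exact_mod_cast Fintype.card_pos
  set N : ℝ := (Fintype.card J : ℝ) with hN
  have hw : (fun φ : I → U => ∏ i, p (φ i)) ∈ stdSimplex ℝ (I → U) :=
    prod_mem_stdSimplex (p := fun _ => p) fun _ => hp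
  have hz : ∀ z, ∑ φ : I → U, (∏ i, p (φ i)) * |N⁻¹ * ∑ j, V (φ (e j)) z - output p V z|
      ≤ √(B / N) * output p V z
        + 2 * ∑ u, if B * output p V z < V u z then p u * V u z else 0 := by
    intro z
    set o := output p V z with ho
    have ho0 : 0 ≤ o := output_nonneg hp.1 (fun u => (hV u).1) z
    -- Truncation: `g` is bounded by `B * o` and is treated in mean square, whereas the large values
    -- `h` are treated in mean. They are counted once in the codebook average and once in `o`,
    -- whence the factor 2 in the bound.
    set g : U → ℝ := fun u => if B * o < V u z then 0 else V u z with hg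
    set h : U → ℝ := fun u => if B * o < V u z then V u z else 0 with hh
    have hgh : ∀ u, V u z = g u + h u := by
      intro u
      simp only [hg, hh]
      split_ifs <;> simp
    have hg0 : ∀ u, 0 ≤ g u := by
      intro u
      simp only [hg]
      split_ifs
      · exact le_rfl
      · exact (hV u).1 z
    have hh0 : ∀ u, 0 ≤ h u := by
      intro u
      simp only [hh]
      split_ifs
      · exact (hV u).1 z
      · exact le_rfl
    have hgV : ∀ u, g u ≤ V u z := fun u => by linarith [hgh u, hh0 u]
    have hgB : ∀ u, g u ≤ B * o := by
      intro u
      simp only [hg]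
      split_ifs with h1
      · positivity
      · exact not_lt.1 h1
    set mg := ∑ u, p u * g u with hmg
    set mh := ∑ u, p u * h u with hmh
    have hmh0 : 0 ≤ mh := Finset.sum_nonneg fun u _ => mul_nonneg (hp.1 u) (hh0 u)
    have hosum : o = mg + mh := by
      rw [ho, output, hmg, hmh, ← Finset.sum_add_distrib]
      exact Finset.sum_congr rfl fun u _ => by rw [hgh u]; ring
    -- The second moment is at most the supremum `B * o` times the mean, which is at most `o`.
    have hvar : ∑ u, p u * (g u - mg) ^ 2 ≤ B * o ^ 2 := by
      have e1 : ∑ u, p u * (g u - mg) ^ 2 = ∑ u, p u * g u ^ 2 - mg ^ 2 := by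
        have : ∀ u, p u * (g u - mg) ^ 2 = p u * g u ^ 2 - 2 * mg * (p u * g u) + mg ^ 2 * p u :=
          fun u => by ring
        simp only [this, Finset.sum_add_distrib, Finset.sum_sub_distrib, ← Finset.mul_sum, hp.2,
          ← hmg]
        ring
      have e2 : ∑ u, p u * g u ^ 2 ≤ ∑ u, (B * o) * (p u * V u z) := by
        refine Finset.sum_le_sum fun u _ => ?_
        have := mul_le_mul (hgB u) (hgV u) (hg0 u) (by positivity)
        nlinarith [mul_le_mul_of_nonneg_left this (hp.1 u)]
      rw [← Finset.mul_sum] at e2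
      have e3 : ∑ u, p u * V u z = o := rfl
      rw [e3] at e2
      nlinarith [sq_nonneg mg]
    have hpt : ∀ φ : I → U, |N⁻¹ * ∑ j, V (φ (e j)) z - o|
        ≤ |N⁻¹ * ∑ j, (g (φ (e j)) - mg)| + (N⁻¹ * ∑ j, h (φ (e j)) + mh) := by
      intro φ
      have e1 : N⁻¹ * ∑ j, V (φ (e j)) z - o
          = N⁻¹ * ∑ j, (g (φ (e j)) - mg) + (N⁻¹ * ∑ j, h (φ (e j)) - mh) := by
        simp only [hgh, Finset.sum_add_distrib, Finset.sum_sub_distrib, Finset.sum_const,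
          Finset.card_univ, nsmul_eq_mul, ← hN, hosum]
        field_simp
        ring
      have e2 : 0 ≤ N⁻¹ * ∑ j, h (φ (e j)) :=
        mul_nonneg (by positivity) (Finset.sum_nonneg fun j _ => hh0 _)
      rw [e1]
      refine (abs_add_le _ _).trans (add_le_add le_rfl ?_)
      rw [abs_le]
      constructor <;> linarith
    -- The standard deviation is proportional to `o = output p V z`, whose sum over `z` is one, so
    -- the size of the output alphabet does not enter.
    have hE1 : ∑ φ : I → U, (∏ i, p (φ i)) * |N⁻¹ * ∑ j, (g (φ (e j)) - mg)| ≤ √(B / N) * o := by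
      refine (sum_mul_abs_le_sqrt hw).trans ?_
      have e1 : ∑ φ : I → U, (∏ i, p (φ i)) * (N⁻¹ * ∑ j, (g (φ (e j)) - mg)) ^ 2
          = N⁻¹ * ∑ u, p u * (g u - mg) ^ 2 := by
        have := sum_prod_mul_sq_sum hp.2 g e he
        rw [← hmg, ← hN] at this
        calc _ = N⁻¹ ^ 2 * ∑ φ : I → U, (∏ i, p (φ i)) * (∑ j, (g (φ (e j)) - mg)) ^ 2 := by
              rw [Finset.mul_sum]
              exact Finset.sum_congr rfl fun φ _ => by ring
          _ = _ := by rw [this]; field_simp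
      rw [e1]
      calc √(N⁻¹ * ∑ u, p u * (g u - mg) ^ 2) ≤ √(B / N * o ^ 2) := by
            apply Real.sqrt_le_sqrt
            calc N⁻¹ * ∑ u, p u * (g u - mg) ^ 2 ≤ N⁻¹ * (B * o ^ 2) := by gcongr
              _ = B / N * o ^ 2 := by field_simp
        _ = √(B / N) * o := by rw [Real.sqrt_mul (by positivity), Real.sqrt_sq ho0]
    have hE2 : ∑ φ : I → U, (∏ i, p (φ i)) * (N⁻¹ * ∑ j, h (φ (e j))) = mh := by
      have : ∀ j, ∑ φ : I → U, (∏ i, p (φ i)) * h (φ (e j)) = mh := fun j =>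
        sum_prod_mul_eq (fun _ => p) (fun _ => hp.2) h (e j)
      calc _ = N⁻¹ * ∑ j, ∑ φ : I → U, (∏ i, p (φ i)) * h (φ (e j)) := by
            rw [Finset.sum_comm, Finset.mul_sum]
            refine Finset.sum_congr rfl fun φ _ => ?_
            rw [← Finset.mul_sum]
            ring
        _ = mh := by
            simp only [this, Finset.sum_const, Finset.card_univ, nsmul_eq_mul, ← hN]
            field_simp
    have hmh' : ∑ u, (if B * o < V u z then p u * V u z else 0) = mh := by
      refine Finset.sum_congr rfl fun u _ => ?_
      simp only [hh]
      split_ifs <;> simp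
    rw [hmh']
    calc _ ≤ ∑ φ : I → U, (∏ i, p (φ i)) *
          (|N⁻¹ * ∑ j, (g (φ (e j)) - mg)| + (N⁻¹ * ∑ j, h (φ (e j)) + mh)) :=
          Finset.sum_le_sum fun φ _ => mul_le_mul_of_nonneg_left (hpt φ) (hw.1 φ)
      _ = ∑ φ : I → U, (∏ i, p (φ i)) * |N⁻¹ * ∑ j, (g (φ (e j)) - mg)|
          + (mh + (∑ φ : I → U, ∏ i, p (φ i)) * mh) := by
          simp only [mul_add, Finset.sum_add_distrib, hE2, Finset.sum_mul]
      _ ≤ √(B / N) * o + 2 * mh := by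
          rw [hw.2]
          linarith
  calc _ = ∑ z, ∑ φ : I → U, (∏ i, p (φ i)) * |N⁻¹ * ∑ j, V (φ (e j)) z - output p V z| := by
        simp only [Finset.mul_sum]
        rw [Finset.sum_comm]
    _ ≤ ∑ z, (√(B / N) * output p V z
        + 2 * ∑ u, if B * output p V z < V u z then p u * V u z else 0) :=
        Finset.sum_le_sum fun z _ => hz z
    _ = _ := by
        rw [Finset.sum_add_distrib, ← Finset.mul_sum, (output_mem_stdSimplex hp hV).2, mul_one,
          ← Finset.mul_sum, Finset.sum_comm]

/-- The decoder that selects a message whose codeword passes the test `G` with the channel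
output. -/
def testDecoder {C M : Type*} [Nonempty M] (G : U → Z → Prop) (φ : C × M → U) (y : Z) (c : C) : M :=
  if h : ∃ m, G (φ (c, m)) y then h.choose else Classical.arbitrary M

/-- The events of the union bound. The decoder knows `c`, so only the codewords of the same slice
compete. -/
theorem testDecoder_ne {C M : Type*} [Nonempty M] {G : U → Z → Prop} {φ : C × M → U} {y : Z}
    {i : C × M} (h : testDecoder G φ y i.1 ≠ i.2) :
    ¬ G (φ i) y ∨ ∃ m, m ≠ i.2 ∧ G (φ (i.1, m)) y := by
  by_cases hG : G (φ i) y
  · right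
    have hex : ∃ m, G (φ (i.1, m)) y := ⟨i.2, hG⟩
    refine ⟨testDecoder G φ y i.1, h, ?_⟩
    rw [testDecoder, dif_pos hex]
    exact hex.choose_spec
  · exact Or.inl hG

/-- The average error probability of a random codebook under threshold decoding. -/
theorem threshold_decoding {C M : Type*} [Fintype C] [DecidableEq C] [Fintype M] [DecidableEq M]
    [Nonempty C] [Nonempty M] {p : U → ℝ} (hp : p ∈ stdSimplex ℝ U) {V : U → Z → ℝ}
    (hV : ∀ u, V u ∈ stdSimplex ℝ Z) {B : ℝ} (hB : 0 < B) :
    ∑ φ : C × M → U, (∏ i, p (φ i)) * ((Fintype.card (C × M) : ℝ)⁻¹ * ∑ i : C × M, ∑ y,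
        if testDecoder (fun u y => B * output p V y < V u y) φ y i.1 ≠ i.2
          then V (φ i) y else 0)
      ≤ (∑ u, ∑ y, if V u y ≤ B * output p V y then p u * V u y else 0) + Fintype.card M / B := by
  set G : U → Z → Prop := fun u y => B * output p V y < V u y with hG
  set A := ∑ u, ∑ y, if V u y ≤ B * output p V y then p u * V u y else 0 with hA
  have hN : (0 : ℝ) < Fintype.card (C × M) := by exact_mod_cast Fintype.card_pos
  have hw : (fun φ : C × M → U => ∏ i, p (φ i)) ∈ stdSimplex ℝ (C × M → U) :=
    prod_mem_stdSimplex (p := fun _ => p) fun _ => hp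
  have hpt : ∀ (φ : C × M → U) (i : C × M) (y : Z),
      (if testDecoder G φ y i.1 ≠ i.2 then V (φ i) y else 0)
        ≤ (if G (φ i) y then 0 else V (φ i) y)
          + ∑ m, if m ≠ i.2 then V (φ i) y * (if G (φ (i.1, m)) y then 1 else 0) else 0 := by
    intro φ i y
    have hV0 := (hV (φ i)).1 y
    have h0 : ∀ m, 0 ≤ if m ≠ i.2 then V (φ i) y * (if G (φ (i.1, m)) y then (1 : ℝ) else 0)
        else 0 := by
      intro m
      split_ifs <;> simp [hV0]
    have h1 : 0 ≤ if G (φ i) y then 0 else V (φ i) y := by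
      split_ifs <;> simp [hV0]
    by_cases hd : testDecoder G φ y i.1 ≠ i.2
    · rw [if_pos hd]
      rcases testDecoder_ne hd with h | ⟨m, hm, h⟩
      · rw [if_neg h]
        linarith [Finset.sum_nonneg fun m (_ : m ∈ Finset.univ) => h0 m]
      · have := Finset.single_le_sum (fun m _ => h0 m) (Finset.mem_univ m)
        rw [if_pos hm, if_pos h, mul_one] at this
        linarith
    · rw [if_neg hd]
      exact add_nonneg h1 (Finset.sum_nonneg fun m _ => h0 m)
  have hi : ∀ i : C × M, ∑ φ : C × M → U, (∏ i, p (φ i)) * ∑ y,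
      (if testDecoder G φ y i.1 ≠ i.2 then V (φ i) y else 0) ≤ A + Fintype.card M / B := by
    intro i
    have e1 : ∀ y, ∑ φ : C × M → U, (∏ i, p (φ i)) * (if G (φ i) y then 0 else V (φ i) y)
        = ∑ u, if V u y ≤ B * output p V y then p u * V u y else 0 := by
      intro y
      rw [sum_prod_mul_eq (fun _ => p) (fun _ => hp.2) (fun u => if G u y then 0 else V u y) i]
      refine Finset.sum_congr rfl fun u _ => ?_
      by_cases h : G u y
      · rw [if_pos h, if_neg (not_le.2 h), mul_zero]
      · rw [if_neg h, if_pos (not_lt.1 h)]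
    -- A wrong codeword is independent of the transmitted one, hence of the output. By change of
    -- measure, `B * output ≤ V` on the test event, so passing the test costs a factor `1 / B`.
    have e2 : ∀ m y, ∑ φ : C × M → U, (∏ i, p (φ i)) *
        (if m ≠ i.2 then V (φ i) y * (if G (φ (i.1, m)) y then 1 else 0) else 0)
        ≤ output p V y / B := by
      intro m y
      have ho := output_nonneg hp.1 (fun u => (hV u).1) y
      by_cases hm : m ≠ i.2
      · simp only [if_pos hm]
        rw [sum_prod_mul_mul_eq (fun _ => p) (fun _ => hp.2) (fun u => V u y)
          (fun u => if G u y then 1 else 0) (j := i) (k := (i.1, m))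
          (fun h => hm (by rw [h]))]
        change output p V y * _ ≤ _
        rw [le_div_iff₀ hB, mul_assoc, Finset.sum_mul, Finset.mul_sum]
        refine Finset.sum_le_sum fun u _ => ?_
        by_cases h : G u y
        · simp only [if_pos h, mul_one]
          have := mul_le_mul_of_nonneg_left h.le (hp.1 u)
          linarith
        · simp only [if_neg h, mul_zero, zero_mul]
          exact mul_nonneg (hp.1 u) ((hV u).1 y)
      · simp only [if_neg hm, mul_zero, Finset.sum_const_zero]
        positivity
    calc _ ≤ ∑ φ : C × M → U, (∏ i, p (φ i)) * ∑ y, ((if G (φ i) y then 0 else V (φ i) y)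
          + ∑ m, if m ≠ i.2 then V (φ i) y * (if G (φ (i.1, m)) y then 1 else 0) else 0) :=
          Finset.sum_le_sum fun φ _ => mul_le_mul_of_nonneg_left
            (Finset.sum_le_sum fun y _ => hpt φ i y) (hw.1 φ)
      _ = ∑ y, ∑ φ : C × M → U, (∏ i, p (φ i)) * (if G (φ i) y then 0 else V (φ i) y)
          + ∑ m, ∑ y, ∑ φ : C × M → U, (∏ i, p (φ i)) *
        (if m ≠ i.2 then V (φ i) y * (if G (φ (i.1, m)) y then 1 else 0) else 0) := by
          simp only [Finset.mul_sum, mul_add, Finset.sum_add_distrib]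
          congr 1
          · rw [Finset.sum_comm]
          · rw [Finset.sum_comm]
            conv_rhs => rw [Finset.sum_comm]
            exact Finset.sum_congr rfl fun y _ => Finset.sum_comm
      _ ≤ A + ∑ m : M, ∑ y, output p V y / B := by
          refine add_le_add (le_of_eq ?_)
            (Finset.sum_le_sum fun m _ => Finset.sum_le_sum fun y _ => e2 m y)
          simp only [e1]
          rw [hA, Finset.sum_comm]
      _ = A + Fintype.card M / B := by
          rw [← Finset.sum_div, (output_mem_stdSimplex hp hV).2]
          simp [div_eq_mul_inv]
  calc _ = (Fintype.card (C × M) : ℝ)⁻¹ * ∑ i : C × M, ∑ φ : C × M → U, (∏ i, p (φ i)) * ∑ y,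
      (if testDecoder G φ y i.1 ≠ i.2 then V (φ i) y else 0) := by
        rw [Finset.sum_comm, Finset.mul_sum]
        refine Finset.sum_congr rfl fun φ _ => ?_
        rw [← Finset.mul_sum]
        ring
    _ ≤ (Fintype.card (C × M) : ℝ)⁻¹ * ∑ i : C × M, (A + Fintype.card M / B) := by
        gcongr with i
        exact hi i
    _ = _ := by
        simp only [Finset.sum_const, Finset.card_univ, nsmul_eq_mul]
        field_simp

end RandomCodebook

/-! ### The likelihood encoder and one-shot achievability. -/

section OneShot

variable {S X Y T U Z C M : Type*} [Fintype S] [Fintype X] [Fintype Y] [Fintype T] [Fintype U]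
  [Fintype Z] [Fintype C] [Fintype M] [Nonempty C] [Nonempty M]

/-- Supplies conditional distributions: when the conditioning event has mass zero, any point of the
simplex will do. -/
theorem exists_normalization {q : M → ℝ} (hq : ∀ m, 0 ≤ q m) :
    ∃ e ∈ stdSimplex ℝ M, ∀ m, q m = (∑ m, q m) * e m := by
  rcases (Finset.sum_nonneg fun m (_ : m ∈ Finset.univ) => hq m).eq_or_lt with h | h
  · refine ⟨Pi.single (Classical.arbitrary M) 1, single_mem_stdSimplex ℝ _, fun m => ?_⟩
    rw [← h, zero_mul]
    exact (Finset.sum_eq_zero_iff_of_nonneg fun m _ => hq m).1 h.symm m (Finset.mem_univ m)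
  · refine ⟨fun m => q m / ∑ m, q m, ⟨fun m => div_nonneg (hq m) h.le, ?_⟩, fun m => ?_⟩
    · rw [← Finset.sum_div, div_self h.ne']
    · rw [mul_div_cancel₀ _ h.ne']

theorem sum_abs_sub_le_two {a b : T → ℝ} (ha : a ∈ stdSimplex ℝ T) (hb : b ∈ stdSimplex ℝ T) :
    ∑ t, |a t - b t| ≤ 2 := by
  calc ∑ t, |a t - b t| ≤ ∑ t, (a t + b t) := Finset.sum_le_sum fun t _ => by
        rw [abs_le]
        constructor <;> linarith [ha.1 t, hb.1 t]
    _ = 2 := by rw [Finset.sum_add_distrib, ha.2, hb.2]; norm_num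

/-- The likelihood encoder and a decoder that recovers the codeword: the error of the resulting
code is controlled by the resolvability of the source, the decoding error, and the resolvability of
the target. -/
theorem exists_code_of_codebook {ps : U → S → ℝ} (hps : ∀ u, ps u ∈ stdSimplex ℝ S)
    {px : U → S → X → ℝ} (hpx : ∀ u s, px u s ∈ stdSimplex ℝ X)
    {W : X → Y → ℝ} (hW : ∀ x, W x ∈ stdSimplex ℝ Y)
    {pt : U → Y → T → ℝ} (hpt : ∀ u y, pt u y ∈ stdSimplex ℝ T)
    (PS : S → ℝ) (P : S × X × Y × T → ℝ) (φ : C × M → U) (d : Y → C → M) :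
    ∃ (enc : S → C → X → ℝ) (dec : Y → C → T → ℝ),
      (∀ s c, enc s c ∈ stdSimplex ℝ X) ∧ (∀ y c, dec y c ∈ stdSimplex ℝ T) ∧
      ∑ z : S × X × Y × T, |∑ c, (Fintype.card C : ℝ)⁻¹ * PS z.1 * enc z.1 c z.2.1 *
          W z.2.1 z.2.2.1 * dec z.2.2.1 c z.2.2.2 - P z|
        ≤ (Fintype.card C : ℝ)⁻¹ *
            ∑ c, ∑ s, |(Fintype.card M : ℝ)⁻¹ * ∑ m, ps (φ (c, m)) s - PS s|
          + 2 * ((Fintype.card (C × M) : ℝ)⁻¹ * ∑ i : C × M, ∑ y,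
              if d y i.1 ≠ i.2 then ∑ s, ∑ x, ps (φ i) s * px (φ i) s x * W x y else 0)
          + ∑ z : S × X × Y × T, |(Fintype.card (C × M) : ℝ)⁻¹ * ∑ i : C × M,
              ps (φ i) z.1 * px (φ i) z.1 z.2.1 * W z.2.1 z.2.2.1 * pt (φ i) z.2.2.1 z.2.2.2
              - P z| := by
  have hC : (0 : ℝ) < Fintype.card C := by exact_mod_cast Fintype.card_pos
  have hM : (0 : ℝ) < Fintype.card M := by exact_mod_cast Fintype.card_pos
  set NC : ℝ := (Fintype.card C : ℝ) with hNC
  set NM : ℝ := (Fintype.card M : ℝ) with hNM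
  have hCM : (Fintype.card (C × M) : ℝ) = NC * NM := by
    rw [Fintype.card_prod, Nat.cast_mul]
  rw [hCM]
  have hex : ∀ s c, ∃ e ∈ stdSimplex ℝ M, ∀ m, ps (φ (c, m)) s = (∑ m, ps (φ (c, m)) s) * e m :=
    fun s c => exists_normalization fun m => (hps _).1 s
  -- `e s c` is the posterior of the index given source `s` and randomness `c`, for a uniform prior
  -- on the indices.
  choose e he hpe using hex
  refine ⟨fun s c x => ∑ m, e s c m * px (φ (c, m)) s x, fun y c => pt (φ (c, d y c)) y, ?_,
    fun y c => hpt _ _, ?_⟩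
  · intro s c
    refine ⟨fun x => Finset.sum_nonneg fun m _ => mul_nonneg ((he s c).1 m) ((hpx _ _).1 x), ?_⟩
    rw [Finset.sum_comm]
    simp [← Finset.mul_sum, (hpx _ _).2, (he s c).2]
  set D : S → C → ℝ := fun s c => NM⁻¹ * ∑ m, ps (φ (c, m)) s with hD
  have hsw : ∀ F : S × X × Y × T → C → M → ℝ,
      ∑ z, ∑ c, ∑ m, F z c m = ∑ c, ∑ m, ∑ s, ∑ x, ∑ y, ∑ t, F (s, x, y, t) c m := by
    intro F
    rw [Finset.sum_comm]
    refine Finset.sum_congr rfl fun c _ => ?_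
    rw [Finset.sum_comm]
    refine Finset.sum_congr rfl fun m _ => ?_
    simp only [Fintype.sum_prod_type]
  -- `T1` is the law of the code. `T2` replaces the true source by the source `D` that the slice of
  -- `c` generates. `T3` moreover uses the true index in place of the decoded one. The three terms
  -- of the bound are the distances along `T1`, `T2`, `T3`, `P`.
  set T1 : S × X × Y × T → ℝ := fun z => ∑ c, ∑ m, NC⁻¹ * PS z.1 * (e z.1 c m *
    px (φ (c, m)) z.1 z.2.1) * W z.2.1 z.2.2.1 * pt (φ (c, d z.2.2.1 c)) z.2.2.1 z.2.2.2 with hT1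
  set T2 : S × X × Y × T → ℝ := fun z => ∑ c, ∑ m, NC⁻¹ * D z.1 c * (e z.1 c m *
    px (φ (c, m)) z.1 z.2.1) * W z.2.1 z.2.2.1 * pt (φ (c, d z.2.2.1 c)) z.2.2.1 z.2.2.2 with hT2
  set T3 : S × X × Y × T → ℝ := fun z => ∑ c, ∑ m, NC⁻¹ * NM⁻¹ * (ps (φ (c, m)) z.1 *
    px (φ (c, m)) z.1 z.2.1 * W z.2.1 z.2.2.1 * pt (φ (c, m)) z.2.2.1 z.2.2.2) with hT3
  have h1 : ∀ z : S × X × Y × T, ∑ c, NC⁻¹ * PS z.1 * (∑ m, e z.1 c m * px (φ (c, m)) z.1 z.2.1) *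
      W z.2.1 z.2.2.1 * pt (φ (c, d z.2.2.1 c)) z.2.2.1 z.2.2.2 = T1 z := by
    intro z
    simp only [hT1, Finset.mul_sum, Finset.sum_mul]
  have h3 : ∀ z : S × X × Y × T, (NC * NM)⁻¹ * ∑ i : C × M,
      ps (φ i) z.1 * px (φ i) z.1 z.2.1 * W z.2.1 z.2.2.1 * pt (φ i) z.2.2.1 z.2.2.2 = T3 z := by
    intro z
    simp only [hT3, Fintype.sum_prod_type, Finset.mul_sum, mul_inv]
  simp only [h1, h3]
  have b12 : ∑ z, |T1 z - T2 z| ≤ NC⁻¹ * ∑ c, ∑ s, |D s c - PS s| := by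
    have hpt' : ∀ z, |T1 z - T2 z| ≤ ∑ c, ∑ m, NC⁻¹ * |D z.1 c - PS z.1| * (e z.1 c m *
        px (φ (c, m)) z.1 z.2.1) * W z.2.1 z.2.2.1 *
        pt (φ (c, d z.2.2.1 c)) z.2.2.1 z.2.2.2 := by
      intro z
      simp only [hT1, hT2, ← Finset.sum_sub_distrib]
      refine (Finset.abs_sum_le_sum_abs _ _).trans (Finset.sum_le_sum fun c _ => ?_)
      refine (Finset.abs_sum_le_sum_abs _ _).trans (Finset.sum_le_sum fun m _ => ?_)
      have k1 := (he z.1 c).1 m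
      have k2 := (hpx (φ (c, m)) z.1).1 z.2.1
      have k3 := (hW z.2.1).1 z.2.2.1
      have k4 := (hpt (φ (c, d z.2.2.1 c)) z.2.2.1).1 z.2.2.2
      rw [← sub_mul, ← sub_mul, ← sub_mul, ← mul_sub, abs_mul, abs_mul, abs_mul, abs_mul,
        abs_of_nonneg k4, abs_of_nonneg k3, abs_of_nonneg (mul_nonneg k1 k2),
        abs_of_nonneg (inv_nonneg.2 hC.le), abs_sub_comm]
    refine (Finset.sum_le_sum fun z _ => hpt' z).trans (le_of_eq ?_)
    rw [hsw (fun z c m => NC⁻¹ * |D z.1 c - PS z.1| * (e z.1 c m *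
        px (φ (c, m)) z.1 z.2.1) * W z.2.1 z.2.2.1 *
        pt (φ (c, d z.2.2.1 c)) z.2.2.1 z.2.2.2)]
    simp only [← Finset.mul_sum, (hpt _ _).2, mul_one, (hW _).2, (hpx _ _).2]
    rw [Finset.mul_sum]
    refine Finset.sum_congr rfl fun c _ => ?_
    rw [Finset.sum_comm]
    simp only [← Finset.mul_sum, (he _ _).2, mul_one]
  have b23 : ∑ z, |T2 z - T3 z| ≤ 2 * ((NC * NM)⁻¹ * ∑ i : C × M, ∑ y,
      if d y i.1 ≠ i.2 then ∑ s, ∑ x, ps (φ i) s * px (φ i) s x * W x y else 0) := by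
    -- Bayes: `D * e` equals `ps / NM`, so `T2` and `T3` differ only in the codeword that drives the
    -- reconstruction, and agree where the index is decoded correctly.
    have hT2' : ∀ z, T2 z = ∑ c, ∑ m, NC⁻¹ * NM⁻¹ * (ps (φ (c, m)) z.1 *
        px (φ (c, m)) z.1 z.2.1 * W z.2.1 z.2.2.1 *
        pt (φ (c, d z.2.2.1 c)) z.2.2.1 z.2.2.2) := by
      intro z
      refine Finset.sum_congr rfl fun c _ => Finset.sum_congr rfl fun m _ => ?_
      rw [hpe z.1 c m]
      simp only [hD]
      ring
    have hpt' : ∀ z, |T2 z - T3 z| ≤ ∑ c, ∑ m, NC⁻¹ * NM⁻¹ * (ps (φ (c, m)) z.1 *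
        px (φ (c, m)) z.1 z.2.1 * W z.2.1 z.2.2.1) *
        |pt (φ (c, d z.2.2.1 c)) z.2.2.1 z.2.2.2 - pt (φ (c, m)) z.2.2.1 z.2.2.2| := by
      intro z
      simp only [hT2', hT3, ← Finset.sum_sub_distrib]
      refine (Finset.abs_sum_le_sum_abs _ _).trans (Finset.sum_le_sum fun c _ => ?_)
      refine (Finset.abs_sum_le_sum_abs _ _).trans (Finset.sum_le_sum fun m _ => ?_)
      have k1 := (hps (φ (c, m))).1 z.1
      have k2 := (hpx (φ (c, m)) z.1).1 z.2.1
      have k3 := (hW z.2.1).1 z.2.2.1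
      rw [← mul_sub, ← mul_sub, ← mul_assoc, abs_mul, abs_of_nonneg (by positivity)]
    refine (Finset.sum_le_sum fun z _ => hpt' z).trans ?_
    rw [hsw (fun z c m => NC⁻¹ * NM⁻¹ * (ps (φ (c, m)) z.1 *
        px (φ (c, m)) z.1 z.2.1 * W z.2.1 z.2.2.1) *
        |pt (φ (c, d z.2.2.1 c)) z.2.2.1 z.2.2.2 - pt (φ (c, m)) z.2.2.1 z.2.2.2|)]
    rw [Fintype.sum_prod_type, Finset.mul_sum, Finset.mul_sum]
    refine Finset.sum_le_sum fun c _ => ?_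
    rw [Finset.mul_sum, Finset.mul_sum]
    refine Finset.sum_le_sum fun m _ => ?_
    calc _ ≤ ∑ s, ∑ x, ∑ y, NC⁻¹ * NM⁻¹ * (ps (φ (c, m)) s * px (φ (c, m)) s x * W x y) *
          (if d y c ≠ m then 2 else 0) := by
          refine Finset.sum_le_sum fun s _ => Finset.sum_le_sum fun x _ =>
            Finset.sum_le_sum fun y _ => ?_
          dsimp only
          rw [← Finset.mul_sum]
          have k1 := (hps (φ (c, m))).1 s
          have k2 := (hpx (φ (c, m)) s).1 x
          have k3 := (hW x).1 y
          refine mul_le_mul_of_nonneg_left ?_ (by positivity)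
          split_ifs with h
          · exact sum_abs_sub_le_two (hpt _ _) (hpt _ _)
          · rw [not_not] at h
            simp [h]
      _ = ∑ y, ∑ s, ∑ x, NC⁻¹ * NM⁻¹ * (ps (φ (c, m)) s * px (φ (c, m)) s x * W x y) *
          (if d y c ≠ m then 2 else 0) := by
          rw [Finset.sum_comm]
          conv_rhs => rw [Finset.sum_comm]
          rw [Finset.sum_comm]
          exact Finset.sum_congr rfl fun s _ => Finset.sum_comm
      _ = _ := by
          rw [Finset.mul_sum, Finset.mul_sum]
          refine Finset.sum_congr rfl fun y _ => ?_
          simp only [← Finset.sum_mul, ← Finset.mul_sum]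
          split_ifs
          · rw [mul_inv]; ring
          · simp
  calc ∑ z, |T1 z - P z| ≤ ∑ z, (|T1 z - T2 z| + |T2 z - T3 z| + |T3 z - P z|) := by
        refine Finset.sum_le_sum fun z _ => ?_
        have k1 := abs_sub_le (T1 z) (T2 z) (P z)
        have k2 := abs_sub_le (T2 z) (T3 z) (P z)
        linarith
    _ ≤ _ := by
        rw [Finset.sum_add_distrib, Finset.sum_add_distrib]
        linarith

/-- One-shot achievability of coordination over a noisy channel. -/
theorem exists_code_oneshot {p : U → ℝ} (hp : p ∈ stdSimplex ℝ U)
    {ps : U → S → ℝ} (hps : ∀ u, ps u ∈ stdSimplex ℝ S)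
    {px : U → S → X → ℝ} (hpx : ∀ u s, px u s ∈ stdSimplex ℝ X)
    {W : X → Y → ℝ} (hW : ∀ x, W x ∈ stdSimplex ℝ Y)
    {pt : U → Y → T → ℝ} (hpt : ∀ u y, pt u y ∈ stdSimplex ℝ T)
    {Vy : U → Y → ℝ} (hVy : ∀ u y, Vy u y = ∑ s, ∑ x, ps u s * px u s x * W x y)
    (ez : Z ≃ S × X × Y × T) {V : U → Z → ℝ}
    (hV : ∀ u z, V u z = ps u (ez z).1 * px u (ez z).1 (ez z).2.1 * W (ez z).2.1 (ez z).2.2.1 *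
      pt u (ez z).2.2.1 (ez z).2.2.2)
    {B₁ B₂ B₃ : ℝ} (hB₁ : 0 ≤ B₁) (hB₂ : 0 < B₂) (hB₃ : 0 ≤ B₃) :
    ∃ (enc : S → C → X → ℝ) (dec : Y → C → T → ℝ),
      (∀ s c, enc s c ∈ stdSimplex ℝ X) ∧ (∀ y c, dec y c ∈ stdSimplex ℝ T) ∧
      ∑ z : Z, |∑ c, (Fintype.card C : ℝ)⁻¹ * output p ps (ez z).1 * enc (ez z).1 c (ez z).2.1 *
          W (ez z).2.1 (ez z).2.2.1 * dec (ez z).2.2.1 c (ez z).2.2.2 - output p V z|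
        ≤ (√(B₁ / Fintype.card M)
            + 2 * ∑ u, ∑ s, if B₁ * output p ps s < ps u s then p u * ps u s else 0)
          + 2 * ((∑ u, ∑ y, if Vy u y ≤ B₂ * output p Vy y then p u * Vy u y else 0)
              + Fintype.card M / B₂)
          + (√(B₃ / Fintype.card (C × M))
            + 2 * ∑ u, ∑ z, if B₃ * output p V z < V u z then p u * V u z else 0) := by
  have hVym : ∀ u, Vy u ∈ stdSimplex ℝ Y := by
    intro u
    refine ⟨fun y => ?_, ?_⟩
    · rw [hVy]
      exact Finset.sum_nonneg fun s _ => Finset.sum_nonneg fun x _ =>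
        mul_nonneg (mul_nonneg ((hps u).1 s) ((hpx u s).1 x)) ((hW x).1 y)
    · simp only [hVy]
      rw [Finset.sum_comm]
      have : ∀ s, ∑ y, ∑ x, ps u s * px u s x * W x y = ps u s := by
        intro s
        rw [Finset.sum_comm]
        simp only [← Finset.mul_sum, (hW _).2, mul_one, (hpx _ _).2]
      simp only [this, (hps u).2]
  have hVm : ∀ u, V u ∈ stdSimplex ℝ Z := by
    intro u
    refine ⟨fun z => ?_, ?_⟩
    · rw [hV]
      exact mul_nonneg (mul_nonneg (mul_nonneg ((hps u).1 _) ((hpx u _).1 _)) ((hW _).1 _))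
        ((hpt u _).1 _)
    · simp only [hV]
      rw [Equiv.sum_comp ez (fun z => ps u z.1 * px u z.1 z.2.1 * W z.2.1 z.2.2.1 *
        pt u z.2.2.1 z.2.2.2)]
      simp only [Fintype.sum_prod_type, ← Finset.mul_sum, (hpt _ _).2, (hW _).2, (hpx _ _).2,
        (hps _).2, mul_one]
  have hw : (fun φ : C × M → U => ∏ i, p (φ i)) ∈ stdSimplex ℝ (C × M → U) :=
    prod_mem_stdSimplex (p := fun _ => p) fun _ => hp
  set G : U → Y → Prop := fun u y => B₂ * output p Vy y < Vy u y with hG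
  have hC : (0 : ℝ) < Fintype.card C := by exact_mod_cast Fintype.card_pos
  set E1 : (C × M → U) → ℝ := fun φ => (Fintype.card C : ℝ)⁻¹ *
    ∑ c, ∑ s, |(Fintype.card M : ℝ)⁻¹ * ∑ m, ps (φ (c, m)) s - output p ps s| with hE1
  set E2 : (C × M → U) → ℝ := fun φ => (Fintype.card (C × M) : ℝ)⁻¹ * ∑ i : C × M, ∑ y,
    if testDecoder G φ y i.1 ≠ i.2 then Vy (φ i) y else 0 with hE2
  set E3 : (C × M → U) → ℝ := fun φ => ∑ z, |(Fintype.card (C × M) : ℝ)⁻¹ *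
    ∑ i : C × M, V (φ i) z - output p V z| with hE3
  have b1 : ∑ φ : C × M → U, (∏ i, p (φ i)) * E1 φ ≤ √(B₁ / Fintype.card M)
      + 2 * ∑ u, ∑ s, if B₁ * output p ps s < ps u s then p u * ps u s else 0 := by
    -- The source has to be covered by each slice `{c} × M` separately, since it is independent of
    -- the common randomness; the target, in `b3`, is covered by the whole codebook.
    have hc := fun c : C => soft_covering hp hps (fun m : M => (c, m))
      (fun a b h => (Prod.mk.inj h).2) hB₁
    calc _ = (Fintype.card C : ℝ)⁻¹ * ∑ c, ∑ φ : C × M → U, (∏ i, p (φ i)) *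
          ∑ s, |(Fintype.card M : ℝ)⁻¹ * ∑ m, ps (φ (c, m)) s - output p ps s| := by
          rw [Finset.sum_comm, Finset.mul_sum]
          refine Finset.sum_congr rfl fun φ _ => ?_
          rw [← Finset.mul_sum, hE1]
          ring
      _ ≤ (Fintype.card C : ℝ)⁻¹ * ∑ c : C, (√(B₁ / Fintype.card M)
          + 2 * ∑ u, ∑ s, if B₁ * output p ps s < ps u s then p u * ps u s else 0) := by
          gcongr with c
          exact hc c
      _ = _ := by
          simp only [Finset.sum_const, Finset.card_univ, nsmul_eq_mul]
          field_simp
  have b2 := threshold_decoding (C := C) (M := M) hp hVym hB₂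
  have b3 := soft_covering hp hVm (fun i : C × M => i) Function.injective_id hB₃
  -- The three errors are averaged together, so that a single codebook serves for all of them.
  obtain ⟨φ, hφ⟩ := exists_le_of_sum_le hw (x := fun φ => E1 φ + 2 * E2 φ + E3 φ)
    (b := (√(B₁ / Fintype.card M)
            + 2 * ∑ u, ∑ s, if B₁ * output p ps s < ps u s then p u * ps u s else 0)
          + 2 * ((∑ u, ∑ y, if Vy u y ≤ B₂ * output p Vy y then p u * Vy u y else 0)
              + Fintype.card M / B₂)
          + (√(B₃ / Fintype.card (C × M))
            + 2 * ∑ u, ∑ z, if B₃ * output p V z < V u z then p u * V u z else 0)) (by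
    have : ∀ φ : C × M → U, (∏ i, p (φ i)) * (E1 φ + 2 * E2 φ + E3 φ)
        = (∏ i, p (φ i)) * E1 φ + 2 * ((∏ i, p (φ i)) * E2 φ) + (∏ i, p (φ i)) * E3 φ :=
      fun φ => by ring
    simp only [this, Finset.sum_add_distrib, ← Finset.mul_sum]
    exact add_le_add (add_le_add b1 (mul_le_mul_of_nonneg_left b2 (by norm_num))) b3)
  obtain ⟨enc, dec, henc, hdec, hle⟩ := exists_code_of_codebook hps hpx hW hpt (output p ps)
    (fun z => output p V (ez.symm z)) φ (testDecoder G φ)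
  refine ⟨enc, dec, henc, hdec, le_trans ?_ (hle.trans (le_trans (le_of_eq ?_) hφ))⟩
  · rw [← Equiv.sum_comp ez]
    simp
  · simp only [hE1, hE2, hE3, hVy]
    congr 1
    rw [← Equiv.sum_comp ez]
    simp [hV]

end OneShot

/-! ### The inner bound. -/

section Inner

/-- Passage from the entropy form of mutual information to the mean information density, which is
the form in which the law of large numbers is applied. -/
theorem mutualInfo_eq_channelInfo {Ω U Z : Type*} [Fintype Ω] [Fintype U] [Fintype Z]
    {Q : Ω → ℝ} {A : Ω → U} {B : Ω → Z} {p : U → ℝ} {V : U → Z → ℝ}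
    (hp : p ∈ stdSimplex ℝ U) (hV : ∀ u, V u ∈ stdSimplex ℝ Z)
    (h : ∀ u z, law Q (fun ω => (A ω, B ω)) (u, z) = p u * V u z) :
    mutualInfo Q A B = channelInfo p V / log 2 := by
  have hA : ∀ u, law Q A u = p u := fun u => by
    rw [← sum_law_pair Q A B u]
    simp only [h, ← Finset.mul_sum, (hV u).2, mul_one]
  have hB : ∀ z, law Q B z = output p V z := fun z => by
    rw [← sum_law_pair Q B A z, output]
    refine Finset.sum_congr rfl fun u _ => ?_
    rw [← h]
    exact law_congr Q fun ω => by simp [and_comm]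
  have h1 := ent_channel (Q := Q) (A := A) (B := B) (V := V) (fun a => (hV a).2)
    (fun a b => by rw [h, hA])
  have h2 : ent Q B = -∑ u, ∑ z, p u * V u z * log (output p V z) := by
    rw [ent, Finset.sum_comm, ← Finset.sum_neg_distrib]
    refine Finset.sum_congr rfl fun z _ => ?_
    rw [hB, negMulLog, ← Finset.sum_mul, neg_mul]
    rfl
  have h3 : channelInfo p V = ∑ u, ∑ z, p u * V u z * log (V u z)
      - ∑ u, ∑ z, p u * V u z * log (output p V z) := by
    rw [channelInfo, Fintype.sum_prod_type, ← Finset.sum_sub_distrib]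
    refine Finset.sum_congr rfl fun u _ => ?_
    rw [← Finset.sum_sub_distrib]
    refine Finset.sum_congr rfl fun z _ => ?_
    dsimp only
    by_cases h0 : p u * V u z = 0
    · simp [h0]
    · have k1 : 0 < p u := (hp.1 u).lt_of_ne' (left_ne_zero_of_mul h0)
      have k2 : 0 < V u z := ((hV u).1 z).lt_of_ne' (right_ne_zero_of_mul h0)
      have k3 : 0 < output p V z := (mul_pos k1 k2).trans_le
        (Finset.single_le_sum (f := fun u => p u * V u z)
          (fun u _ => mul_nonneg (hp.1 u) ((hV u).1 _)) (Finset.mem_univ _))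
      rw [Real.log_div k2.ne' k3.ne', mul_sub]
  have h4 : ∑ a, law Q A a * ∑ b, negMulLog (V a b) = -∑ u, ∑ z, p u * V u z * log (V u z) := by
    rw [← Finset.sum_neg_distrib]
    refine Finset.sum_congr rfl fun u _ => ?_
    rw [hA, Finset.mul_sum, ← Finset.sum_neg_distrib]
    exact Finset.sum_congr rfl fun z _ => by rw [negMulLog]; ring
  simp only [mutualInfo, entropy_eq_ent_div]
  rw [h1, h2, h3, h4]
  ring

theorem mutualInfo_nonneg {Ω α β : Type*} [Fintype Ω] [Fintype α] [Fintype β] {Q : Ω → ℝ}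
    (hQ : Q ∈ stdSimplex ℝ Ω) (A : Ω → α) (B : Ω → β) : 0 ≤ mutualInfo Q A B := by
  simp only [mutualInfo, entropy_eq_ent_div, ← add_div, ← sub_div]
  exact div_nonneg (by linarith [ent_pair_le hQ A B]) (Real.log_nonneg (by norm_num))

theorem condMutualInfo_nonneg {Ω α β γ : Type*} [Fintype Ω] [Fintype α] [Fintype β] [Fintype γ]
    {Q : Ω → ℝ} (hQ : Q ∈ stdSimplex ℝ Ω) (A : Ω → α) (B : Ω → β) (C : Ω → γ) :
    0 ≤ condMutualInfo Q A B C := by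
  simp only [condMutualInfo, entropy_eq_ent_div, ← add_div, ← sub_div]
  exact div_nonneg (by linarith [ent_submodular hQ.1 A B C]) (Real.log_nonneg (by norm_num))

section Mix

variable {S X Y T U β : Type*} [Fintype S] [Fintype X] [Fintype Y] [Fintype T] [Fintype U]
  [Fintype β]

/-- The joint distribution of `(S, X, Y, U, Ŝ)` given by the distribution `p` of `U` and the
conditional distribution `V` of `(S, X, Y, Ŝ)` given `U`. -/
def mix (p : U → ℝ) (V : U → S × X × Y × T → ℝ) (ω : S × X × Y × U × T) : ℝ :=
  p ω.2.2.2.1 * V ω.2.2.2.1 (ω.1, ω.2.1, ω.2.2.1, ω.2.2.2.2)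

/-- The random variable `(S, X, Y, Ŝ)`. -/
def forgetAux (ω : S × X × Y × U × T) : S × X × Y × T := (ω.1, ω.2.1, ω.2.2.1, ω.2.2.2.2)

theorem law_mix_pair (p : U → ℝ) (V : U → S × X × Y × T → ℝ) (F : S × X × Y × T → β) (u : U)
    (b : β) :
    law (mix p V) (fun ω => (ω.2.2.2.1, F (forgetAux ω))) (u, b) = p u * law (V u) F b := by
  simp only [law_eq_sum_ite, Fintype.sum_prod_type, Finset.mul_sum, mix, forgetAux, Prod.mk.injEq]
  refine Finset.sum_congr rfl fun s _ => Finset.sum_congr rfl fun x _ =>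
    Finset.sum_congr rfl fun y _ => ?_
  rw [Finset.sum_eq_single u (fun u' _ h => by simp [h]) (by simp)]
  simp

theorem law_output {Z : Type*} [Fintype Z] (p : U → ℝ) (V : U → Z → ℝ) (F : Z → β) (b : β) :
    law (output p V) F b = ∑ u, p u * law (V u) F b := by
  simp only [law_eq_sum_ite, output, Finset.mul_sum]
  rw [Finset.sum_comm]
  refine Finset.sum_congr rfl fun z _ => ?_
  split_ifs <;> simp

theorem law_mix (p : U → ℝ) (V : U → S × X × Y × T → ℝ) (F : S × X × Y × T → β) (b : β) :
    law (mix p V) (fun ω => F (forgetAux ω)) b = law (output p V) F b := by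
  rw [← sum_law_pair _ _ (fun ω => ω.2.2.2.1) b]
  have : ∀ u, law (mix p V) (fun ω => (F (forgetAux ω), ω.2.2.2.1)) (b, u)
      = p u * law (V u) F b := fun u => by
    rw [← law_mix_pair]
    exact law_congr _ fun ω => by simp [and_comm]
  simp only [this, law_output]

theorem mix_mem_stdSimplex {p : U → ℝ} (hp : p ∈ stdSimplex ℝ U) {V : U → S × X × Y × T → ℝ}
    (hV : ∀ u, V u ∈ stdSimplex ℝ (S × X × Y × T)) :
    mix p V ∈ stdSimplex ℝ (S × X × Y × U × T) := by
  refine ⟨fun ω => mul_nonneg (hp.1 _) ((hV _).1 _), ?_⟩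
  rw [← sum_law _ (fun ω => (ω.2.2.2.1, forgetAux ω)), Fintype.sum_prod_type]
  have := fun u z => law_mix_pair p V (fun z => z) u z
  simp only [this, law_id, ← Finset.mul_sum, (hV _).2, mul_one, hp.2]

end Mix

/-- Rounding down a real number that is at least one loses at most a factor 2, which is harmless on
the exponential scale. -/
theorem half_exp_le_numBins {R₀ : ℝ} (hR : 0 ≤ R₀) (n : ℕ) :
    Real.exp (n * (R₀ * log 2)) / 2 ≤ numBins R₀ n ∧ 0 < numBins R₀ n := by
  have h1 : (2 : ℝ) ^ ((n : ℝ) * R₀) = Real.exp (n * (R₀ * log 2)) := by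
    rw [Real.rpow_def_of_pos (by norm_num)]
    ring_nf
  have h2 : 1 ≤ Real.exp (n * (R₀ * log 2)) :=
    Real.one_le_exp (mul_nonneg (Nat.cast_nonneg n) (mul_nonneg hR (Real.log_nonneg (by norm_num))))
  have h3 : 0 < numBins R₀ n := by
    rw [numBins, Nat.floor_pos, h1]
    exact h2
  refine ⟨?_, h3⟩
  have h4 := Nat.lt_floor_add_one ((2 : ℝ) ^ ((n : ℝ) * R₀))
  have h5 : (1 : ℝ) ≤ numBins R₀ n := by exact_mod_cast h3
  rw [h1] at h4
  rw [numBins] at h5 ⊢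
  rw [h1] at h5 ⊢
  linarith

variable {S X Y T U : Type*} [Fintype S] [Fintype X] [Fintype Y] [Fintype T] [Fintype U]

/-- Separating the components of a block of quadruples. -/
def blockEquiv (S X Y T : Type*) (n : ℕ) :
    (Fin n → S × X × Y × T) ≃ (Fin n → S) × (Fin n → X) × (Fin n → Y) × (Fin n → T) where
  toFun z := (fun i => (z i).1, fun i => (z i).2.1, fun i => (z i).2.2.1, fun i => (z i).2.2.2)
  invFun w i := (w.1 i, w.2.1 i, w.2.2.1 i, w.2.2.2 i)
  left_inv _ := rfl
  right_inv _ := rfl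

/-- Achievability for blocks of length `n`, with an explicit error bound. -/
theorem exists_block_code {p : U → ℝ} (hp : p ∈ stdSimplex ℝ U)
    {ps : U → S → ℝ} (hps : ∀ u, ps u ∈ stdSimplex ℝ S)
    {px : U → S → X → ℝ} (hpx : ∀ u s, px u s ∈ stdSimplex ℝ X)
    {W : X → Y → ℝ} (hW : ∀ x, W x ∈ stdSimplex ℝ Y)
    {pt : U → Y → T → ℝ} (hpt : ∀ u y, pt u y ∈ stdSimplex ℝ T)
    {Vy : U → Y → ℝ} (hVy : ∀ u y, Vy u y = ∑ s, ∑ x, ps u s * px u s x * W x y)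
    {V : U → S × X × Y × T → ℝ}
    (hV : ∀ u z, V u z = ps u z.1 * px u z.1 z.2.1 * W z.2.1 z.2.2.1 * pt u z.2.2.1 z.2.2.2)
    (n N M : ℕ) (hN : 0 < N) (hM : 0 < M)
    {B₁ B₂ B₃ : ℝ} (hB₁ : 0 ≤ B₁) (hB₂ : 0 < B₂) (hB₃ : 0 ≤ B₃) :
    ∃ κ : Code S X Y T n N,
      tvDist (κ.induced (output p ps) W) (iid (output p V) n)
        ≤ (√(B₁ / M)
            + 2 * ∑ u, ∑ s, if B₁ * output (iid p n) (memoryless ps n) s < memoryless ps n u s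
              then iid p n u * memoryless ps n u s else 0)
          + 2 * ((∑ u, ∑ y, if memoryless Vy n u y ≤ B₂ * output (iid p n) (memoryless Vy n) y
              then iid p n u * memoryless Vy n u y else 0) + M / B₂)
          + (√(B₃ / (N * M))
            + 2 * ∑ u, ∑ z, if B₃ * output (iid p n) (memoryless V n) z < memoryless V n u z
              then iid p n u * memoryless V n u z else 0) := by
  have : Nonempty (Fin N) := ⟨⟨0, hN⟩⟩
  have : Nonempty (Fin M) := ⟨⟨0, hM⟩⟩
  obtain ⟨enc, dec, henc, hdec, hle⟩ := exists_code_oneshot (C := Fin N) (M := Fin M)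
    (iid_mem_stdSimplex hp n) (memoryless_mem_stdSimplex hps n)
    (px := fun u s x => ∏ i, px (u i) (s i) (x i))
    (fun u s => prod_mem_stdSimplex (p := fun i => px (u i) (s i)) fun i => hpx _ _)
    (memoryless_mem_stdSimplex hW n)
    (pt := fun u y t => ∏ i, pt (u i) (y i) (t i))
    (fun u y => prod_mem_stdSimplex (p := fun i => pt (u i) (y i)) fun i => hpt _ _)
    (Vy := memoryless Vy n)
    (by
      intro u y
      rw [← sum_arrow_prod (fun s x => memoryless ps n u s * (∏ i, px (u i) (s i) (x i)) *
        memoryless W n x y)]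
      have h := Finset.prod_univ_sum (fun _ : Fin n => (Finset.univ : Finset (S × X)))
        (fun i w => ps (u i) w.1 * px (u i) w.1 w.2 * W w.2 (y i))
      rw [Fintype.piFinset_univ] at h
      simp only [memoryless, hVy]
      simp only [Fintype.sum_prod_type] at h
      rw [h]
      simp only [Finset.prod_mul_distrib])
    (blockEquiv S X Y T n) (V := memoryless V n)
    (by
      intro u z
      simp only [memoryless, hV, Finset.prod_mul_distrib, blockEquiv, Equiv.coe_fn_mk])
    hB₁ hB₂ hB₃
  refine ⟨⟨enc, henc, dec, hdec⟩, ?_⟩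
  simp only [Fintype.card_prod, Fintype.card_fin, Nat.cast_mul] at hle
  refine le_trans ?_ hle
  rw [tvDist, output_iid_memoryless p V n, output_iid_memoryless p ps n]
  have h0 : 0 ≤ ∑ z, |Code.induced ⟨enc, henc, dec, hdec⟩ (output p ps) W z
      - iid (output p V) n z| := Finset.sum_nonneg fun z _ => abs_nonneg _
  calc _ ≤ ∑ z, |Code.induced ⟨enc, henc, dec, hdec⟩ (output p ps) W z
      - iid (output p V) n z| := by linarith
    _ = _ := rfl

theorem tendsto_exp_nat_mul_neg {a : ℝ} (ha : a < 0) :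
    Filter.Tendsto (fun n : ℕ => Real.exp (n * a)) Filter.atTop (nhds 0) := by
  refine Real.tendsto_exp_atBot.comp ?_
  exact Filter.Tendsto.atTop_mul_const_of_neg ha tendsto_natCast_atTop_atTop

/-- Achievability in terms of the test channels from the auxiliary variable. -/
theorem achievable_of_channelInfo {p : U → ℝ} (hp : p ∈ stdSimplex ℝ U)
    {ps : U → S → ℝ} (hps : ∀ u, ps u ∈ stdSimplex ℝ S)
    {px : U → S → X → ℝ} (hpx : ∀ u s, px u s ∈ stdSimplex ℝ X)
    {W : X → Y → ℝ} (hW : ∀ x, W x ∈ stdSimplex ℝ Y)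
    {pt : U → Y → T → ℝ} (hpt : ∀ u y, pt u y ∈ stdSimplex ℝ T)
    {Vy : U → Y → ℝ} (hVym : ∀ u, Vy u ∈ stdSimplex ℝ Y)
    (hVy : ∀ u y, Vy u y = ∑ s, ∑ x, ps u s * px u s x * W x y)
    {V : U → S × X × Y × T → ℝ} (hVm : ∀ u, V u ∈ stdSimplex ℝ (S × X × Y × T))
    (hV : ∀ u z, V u z = ps u z.1 * px u z.1 z.2.1 * W z.2.1 z.2.2.1 * pt u z.2.2.1 z.2.2.2)
    {R₀ : ℝ} (hR₀ : 0 ≤ R₀) (h0 : 0 ≤ channelInfo p ps)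
    (h1 : channelInfo p ps < channelInfo p Vy)
    (h2 : channelInfo p V < channelInfo p Vy + R₀ * log 2) :
    Achievable (output p ps) W (output p V) R₀ := by
  refine ⟨output_mem_stdSimplex hp hVm, hR₀, ?_⟩
  -- `ρ` is the rate of the transmitted index, in nats: above `I(U;S)` and above `I(U;SXYŜ) - R₀ log
  -- 2`, below `I(U;Y)`. The exponents `r₁`, `r₂`, `r₃` of the thresholds lie strictly inside these
  -- three gaps.
  obtain ⟨ρ, hρ1, hρ2⟩ := exists_between (max_lt h1 (by linarith :
    channelInfo p V - R₀ * log 2 < channelInfo p Vy))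
  obtain ⟨r₁, hr₁, hr₁'⟩ := exists_between ((le_max_left _ _).trans_lt hρ1)
  obtain ⟨r₂, hr₂, hr₂'⟩ := exists_between hρ2
  obtain ⟨r₃, hr₃, hr₃'⟩ := exists_between (by linarith [(le_max_right _ _).trans_lt hρ1] :
    channelInfo p V < ρ + R₀ * log 2)
  have hρ0 : 0 < ρ := by linarith
  set M : ℕ → ℕ := fun n => ⌈Real.exp (n * ρ)⌉₊ with hMdef
  have hM0 : ∀ n : ℕ, 0 < M n := fun n => Nat.ceil_pos.2 (Real.exp_pos _)
  have hM1 : ∀ n : ℕ, Real.exp (n * ρ) ≤ M n := fun n => Nat.le_ceil _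
  have hM2 : ∀ n : ℕ, (M n : ℝ) ≤ 2 * Real.exp (n * ρ) := fun n : ℕ => by
    have k1 := Nat.ceil_lt_add_one (Real.exp_pos (n * ρ)).le
    have k2 : 1 ≤ Real.exp (n * ρ) := Real.one_le_exp (by positivity)
    linarith
  have hN := half_exp_le_numBins hR₀
  have hcode := fun n => exists_block_code hp hps hpx hW hpt hVy hV n (numBins R₀ n) (M n)
    (hN n).2 (hM0 n) (Real.exp_pos (n * r₁)).le (Real.exp_pos (n * r₂)) (Real.exp_pos (n * r₃)).le
  choose κ hκ using hcode
  refine ⟨κ, squeeze_zero (fun n => tvDist_nonneg _ _) hκ ?_⟩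
  have t1 := tendsto_information_density_gt hp hps hr₁
  have t2 := tendsto_information_density_le hp hVym hr₂'
  have t3 := tendsto_information_density_gt hp hVm hr₃
  have s1 : Filter.Tendsto (fun n : ℕ => √(Real.exp (n * r₁) / M n)) Filter.atTop (nhds 0) := by
    rw [← Real.sqrt_zero]
    refine (Real.continuous_sqrt.tendsto 0).comp ?_
    refine squeeze_zero (fun n => by positivity) (fun n => ?_)
      (tendsto_exp_nat_mul_neg (a := r₁ - ρ) (by linarith))
    rw [mul_sub, Real.exp_sub]
    have := hM1 n
    gcongr
  have s2 : Filter.Tendsto (fun n : ℕ => M n / Real.exp (n * r₂)) Filter.atTop (nhds 0) := by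
    have := (tendsto_exp_nat_mul_neg (a := ρ - r₂) (by linarith)).const_mul 2
    rw [mul_zero] at this
    refine squeeze_zero (fun n => by positivity) (fun n => ?_) this
    rw [mul_sub, Real.exp_sub, ← mul_div_assoc]
    have := hM2 n
    gcongr
  have s3 : Filter.Tendsto (fun n : ℕ => √(Real.exp (n * r₃) / (numBins R₀ n * M n)))
      Filter.atTop (nhds 0) := by
    rw [← Real.sqrt_zero]
    refine (Real.continuous_sqrt.tendsto 0).comp ?_
    have := (tendsto_exp_nat_mul_neg (a := r₃ - (ρ + R₀ * log 2)) (by linarith)).const_mul 2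
    rw [mul_zero] at this
    refine squeeze_zero (fun n => by positivity) (fun n => ?_) this
    have k1 := mul_le_mul (hN n).1 (hM1 n) (Real.exp_pos _).le (Nat.cast_nonneg _)
    calc Real.exp (n * r₃) / (numBins R₀ n * M n)
        ≤ Real.exp (n * r₃) / (Real.exp (n * (R₀ * log 2)) / 2 * Real.exp (n * ρ)) := by
          gcongr
      _ = 2 * Real.exp (n * (r₃ - (ρ + R₀ * log 2))) := by
          rw [mul_sub, Real.exp_sub, mul_add, Real.exp_add]
          field_simp
  have := ((s1.add (t1.const_mul 2)).add ((t2.add s2).const_mul 2)).add (s3.add (t3.const_mul 2))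
  simpa using this

/-- Bayes turns `P_S P_{U|S}` into the law `p` of `U` and a test channel `ps` from `U` to the
source, as random coding requires. -/
theorem innerBound_subset_region {S X Y T : Type*} [Fintype S] [Fintype X] [Fintype Y] [Fintype T]
    {PS : S → ℝ} (hPS : PS ∈ stdSimplex ℝ S) {W : X → Y → ℝ} (hW : ∀ x, W x ∈ stdSimplex ℝ Y) :
    innerBound T PS W ⊆ region T PS W := by
  rintro ⟨P, R₀⟩ ⟨-, U, _, Q, ⟨PU, px, pt, hPU, hpx, hpt, hQ⟩, hmarg, hI1, hI2, -⟩
  have hSne : Nonempty S := by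
    by_contra h
    rw [not_nonempty_iff] at h
    simpa using hPS.2
  set p : U → ℝ := fun u => ∑ s, PS s * PU s u with hpdef
  have hp : p ∈ stdSimplex ℝ U := by
    refine ⟨fun u => Finset.sum_nonneg fun s _ => mul_nonneg (hPS.1 s) ((hPU s).1 u), ?_⟩
    simp only [hpdef]
    rw [Finset.sum_comm]
    simp only [← Finset.mul_sum, (hPU _).2, mul_one, hPS.2]
  have hex : ∀ u, ∃ e ∈ stdSimplex ℝ S, ∀ s, PS s * PU s u = p u * e s := fun u =>
    exists_normalization fun s => mul_nonneg (hPS.1 s) ((hPU s).1 u)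
  choose ps hps hpps using hex
  set V : U → S × X × Y × T → ℝ := fun u z =>
    ps u z.1 * px u z.1 z.2.1 * W z.2.1 z.2.2.1 * pt u z.2.2.1 z.2.2.2 with hV
  set Vy : U → Y → ℝ := fun u y => ∑ s, ∑ x, ps u s * px u s x * W x y with hVy
  have hQV : ∀ s x y u a, Q (s, x, y, u, a) = p u * V u (s, x, y, a) := by
    intro s x y u a
    rw [hQ, hpps]
    simp only [hV]
    ring
  have hVm : ∀ u, V u ∈ stdSimplex ℝ (S × X × Y × T) := by
    intro u
    refine ⟨fun z => mul_nonneg (mul_nonneg (mul_nonneg ((hps u).1 _) ((hpx u _).1 _))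
      ((hW _).1 _)) ((hpt u _).1 _), ?_⟩
    simp only [hV, Fintype.sum_prod_type, ← Finset.mul_sum, (hpt _ _).2, (hW _).2, (hpx _ _).2,
        (hps _).2, mul_one]
  have hVy' : ∀ u y, Vy u y = law (V u) (fun z => z.2.2.1) y := by
    intro u y
    simp only [law_eq_sum_ite, Fintype.sum_prod_type, hV, hVy]
    refine Finset.sum_congr rfl fun s _ => Finset.sum_congr rfl fun x _ => ?_
    rw [Finset.sum_eq_single y (fun y' _ h => by simp [h]) (by simp)]
    simp only [if_true, ← Finset.mul_sum, (hpt _ _).2, mul_one]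
  have hps' : ∀ u s, ps u s = law (V u) (fun z => z.1) s := by
    intro u s
    simp only [law_eq_sum_ite, Fintype.sum_prod_type, hV]
    rw [Finset.sum_eq_single s (fun y' _ h => by simp [h]) (by simp)]
    simp only [if_true, ← Finset.mul_sum, (hpt _ _).2, (hW _).2, (hpx _ _).2, mul_one]
  have hVym : ∀ u, Vy u ∈ stdSimplex ℝ Y := fun u => by
    rw [funext (hVy' u)]
    exact law_mem_stdSimplex (hVm u) _
  obtain rfl : Q = mix p V := funext fun ⟨s, x, y, u, a⟩ => hQV s x y u a
  have hlog : 0 < log 2 := Real.log_pos (by norm_num)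
  have hQm := mix_mem_stdSimplex hp hVm
  have i1 : mutualInfo (mix p V) rvU rvS = channelInfo p ps / log 2 :=
    mutualInfo_eq_channelInfo hp hps fun u s => by
      rw [hps']
      exact law_mix_pair p V (fun z => z.1) u s
  have i2 : mutualInfo (mix p V) rvU rvY = channelInfo p Vy / log 2 :=
    mutualInfo_eq_channelInfo hp hVym fun u y => by
      rw [hVy']
      exact law_mix_pair p V (fun z => z.2.2.1) u y
  have i3 : mutualInfo (mix p V) rvU forgetAux = channelInfo p V / log 2 :=
    mutualInfo_eq_channelInfo hp hVm fun u z => by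
      have := law_mix_pair p V (fun z => z) u z
      rwa [law_id] at this
  -- Chain rule `I(U;SXYŜ) = I(U;SXŜ|Y) + I(U;Y)`. It turns the hypothesis on `R₀` into the covering
  -- condition for the quadruple.
  have i4 : mutualInfo (mix p V) rvU forgetAux
      = condMutualInfo (mix p V) rvU rvSXT rvY + mutualInfo (mix p V) rvU rvY := by
    simp only [mutualInfo, condMutualInfo, entropy_eq_ent_div]
    rw [ent_congr _ (A := fun ω => (rvSXT ω, rvY ω)) (B := forgetAux)
        (by simp only [rvSXT, rvY, forgetAux, Prod.mk.injEq]; tauto),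
      ent_congr _ (A := fun ω => (rvU ω, rvSXT ω, rvY ω)) (B := fun ω => (rvU ω, forgetAux ω))
        (by simp only [rvSXT, rvY, forgetAux, Prod.mk.injEq]; tauto)]
    ring
  have hR₀ : 0 ≤ R₀ := (condMutualInfo_nonneg hQm _ _ _).trans hI2.le
  have hach := achievable_of_channelInfo hp hps hpx hW hpt hVym (fun _ _ => rfl) hVm
    (fun _ _ => rfl) hR₀
    (by
      have := mutualInfo_nonneg hQm rvU rvS
      rw [i1] at this
      simpa [hlog] using (div_nonneg_iff.1 this).resolve_right (fun h => by linarith [h.2]) |>.1)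
    (by
      rw [i1, i2] at hI1
      exact (div_lt_div_iff_of_pos_right hlog).1 hI1)
    (by
      have h5 : channelInfo p V / log 2 < R₀ + channelInfo p Vy / log 2 := by
        rw [← i3, i4, i2]
        linarith
      have := (mul_lt_mul_iff_of_pos_right hlog).2 h5
      rw [add_mul, div_mul_cancel₀ _ hlog.ne', div_mul_cancel₀ _ hlog.ne'] at this
      linarith)
  have o1 : output p ps = PS := by
    funext s
    simp only [output, ← hpps, ← Finset.mul_sum, (hPU s).2, mul_one]
  have o2 : output p V = P := by
    funext ⟨s, x, y, a⟩
    exact (hmarg s x y a).symm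
  rw [o1, o2] at hach
  exact hach

end Inner

/-! ### Carathéodory reduction of the auxiliary alphabet. -/

section SupportReduction

variable {ι κ : Type*} [Fintype ι] [Fintype κ]

/-- A nonnegative weight can be moved to one with at most `card κ` atoms, without changing its
`card κ` moments `L` and without decreasing the objective `h`. -/
theorem exists_small_support (L : ι → κ → ℝ) (c : κ → ℝ) (hc : ∀ i, ∑ k, c k * L i k = 1)
    (h w : ι → ℝ) (hw : ∀ i, 0 ≤ w i) :
    ∃ w' : ι → ℝ, (∀ i, 0 ≤ w' i) ∧ (∀ k, ∑ i, w' i * L i k = ∑ i, w i * L i k) ∧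
      ∑ i, w i * h i ≤ ∑ i, w' i * h i ∧
      (Finset.univ.filter fun i => w' i ≠ 0).card ≤ Fintype.card κ := by
  induction hm : (Finset.univ.filter fun i => w i ≠ 0).card using Nat.strong_induction_on
    generalizing w with
  | _ m ih =>
  set s := Finset.univ.filter fun i => w i ≠ 0 with hs
  by_cases hcard : s.card ≤ Fintype.card κ
  · exact ⟨w, hw, fun _ => rfl, le_rfl, hcard⟩
  have hdep : ¬ LinearIndependent ℝ (fun i : s => L i) := by
    intro hli
    have := hli.fintype_card_le_finrank
    rw [Module.finrank_fintype_fun_eq_card, Fintype.card_coe] at this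
    exact hcard this
  obtain ⟨g, hg, ⟨i₁, hi₁⟩, hg1⟩ := Fintype.not_linearIndependent_iff.1 hdep
  -- A linear dependency among the moment vectors is a direction that preserves all moments; its
  -- sign is chosen so that the objective does not decrease.
  have hv : ∃ v : ι → ℝ, (∀ i, i ∉ s → v i = 0) ∧ (∀ k, ∑ i, v i * L i k = 0) ∧ (∃ i, v i ≠ 0) ∧
      0 ≤ ∑ i, v i * h i := by
    set v : ι → ℝ := fun i => if hi : i ∈ s then g ⟨i, hi⟩ else 0 with hvdef
    have hv0 : ∀ i, i ∉ s → v i = 0 := fun i hi => by simp [hvdef, hi]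
    have hvL : ∀ k, ∑ i, v i * L i k = 0 := by
      intro k
      have hk := congrFun hg k
      simp only [Finset.sum_apply, Pi.smul_apply, smul_eq_mul, Pi.zero_apply] at hk
      rw [← Finset.sum_subset (Finset.subset_univ s) (fun i _ hi => by rw [hv0 i hi, zero_mul]),
        ← Finset.sum_coe_sort s, ← hk]
      exact Finset.sum_congr rfl fun i _ => by simp [hvdef]
    have hvne : v i₁ ≠ 0 := by simpa [hvdef, hi₁] using hg1
    rcases le_total 0 (∑ i, v i * h i) with h0 | h0
    · exact ⟨v, hv0, hvL, ⟨i₁, hvne⟩, h0⟩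
    · refine ⟨fun i => -v i, fun i hi => by simp [hv0 i hi], fun k => ?_, ⟨i₁, by simpa using hvne⟩,
        ?_⟩
      · simpa using hvL k
      · simpa using h0
  obtain ⟨v, hv0, hvL, ⟨i₂, hi₂⟩, hvh⟩ := hv
  -- By `hc` the total mass is a combination of the moments, so `v` has sum zero. Being nonzero, it
  -- has a negative entry.
  have hvsum : ∑ i, v i = 0 := by
    calc ∑ i, v i = ∑ i, ∑ k, c k * (v i * L i k) := by
          refine Finset.sum_congr rfl fun i _ => ?_
          have : ∑ k, c k * (v i * L i k) = v i * ∑ k, c k * L i k := by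
            rw [Finset.mul_sum]
            exact Finset.sum_congr rfl fun k _ => by ring
          rw [this, hc, mul_one]
      _ = 0 := by
          rw [Finset.sum_comm]
          simp only [← Finset.mul_sum, hvL, mul_zero, Finset.sum_const_zero]
  have hneg : (Finset.univ.filter fun i => v i < 0).Nonempty := by
    by_contra hne
    rw [Finset.not_nonempty_iff_eq_empty, Finset.filter_eq_empty_iff] at hne
    have hnn : ∀ i ∈ Finset.univ, 0 ≤ v i := fun i hi => not_lt.1 (hne hi)
    exact hi₂ ((Finset.sum_eq_zero_iff_of_nonneg hnn).1 hvsum i₂ (Finset.mem_univ _))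
  -- The largest step along `v` that keeps the weights nonnegative; it removes the atom `i₀`.
  obtain ⟨i₀, hi₀, hmin⟩ := Finset.exists_min_image _ (fun i => w i / (-v i)) hneg
  rw [Finset.mem_filter] at hi₀
  have hvi₀ : 0 < -v i₀ := by linarith [hi₀.2]
  set t := w i₀ / (-v i₀) with ht
  have ht0 : 0 ≤ t := div_nonneg (hw _) hvi₀.le
  have hw' : ∀ i, 0 ≤ w i + t * v i := by
    intro i
    rcases lt_or_ge (v i) 0 with hi | hi
    · have := hmin i (by simpa using hi)
      rw [le_div_iff₀ (by linarith)] at this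
      linarith
    · exact add_nonneg (hw i) (mul_nonneg ht0 hi)
  have hi₀s : i₀ ∈ s := by
    by_contra hcon
    rw [hv0 i₀ hcon] at hvi₀
    simp at hvi₀
  have hlt : (Finset.univ.filter fun i => w i + t * v i ≠ 0).card < m := by
    rw [← hm]
    refine Finset.card_lt_card ⟨?_, ?_⟩
    · intro i hi
      rw [Finset.mem_filter] at hi
      by_contra hcon
      have h1 := hv0 i hcon
      simp only [hs, Finset.mem_filter, Finset.mem_univ, true_and, not_not] at hcon
      exact hi.2 (by rw [h1, hcon]; ring)
    · intro hsub
      have := hsub hi₀s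
      rw [Finset.mem_filter] at this
      apply this.2
      have h1 : t * (-v i₀) = w i₀ := div_mul_cancel₀ _ hvi₀.ne'
      linarith
  obtain ⟨w', k1, k2, k3, k4⟩ := ih _ hlt (fun i => w i + t * v i) hw' rfl
  refine ⟨w', k1, fun k => ?_, le_trans ?_ k3, k4⟩
  · rw [k2]
    simp only [add_mul, Finset.sum_add_distrib, mul_assoc, ← Finset.mul_sum, hvL, mul_zero,
      add_zero]
  · simp only [add_mul, Finset.sum_add_distrib, mul_assoc, ← Finset.mul_sum]
    linarith [mul_nonneg ht0 hvh]

/-- A mixture of distributions on `Z` can be replaced by one with `card Z + 1` components, with the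
same mean of `h₂` and no smaller mean of `h₁`. -/
theorem exists_small_mixture {U Z : Type*} [Fintype U] [Fintype Z] {w : U → ℝ}
    (hw : w ∈ stdSimplex ℝ U) {V : U → Z → ℝ} (hV : ∀ u, ∑ z, V u z = 1) (h₁ h₂ : U → ℝ) :
    ∃ (w' : Fin (Fintype.card Z + 1) → ℝ) (e : Fin (Fintype.card Z + 1) → U),
      w' ∈ stdSimplex ℝ (Fin (Fintype.card Z + 1)) ∧
      output w' (fun j => V (e j)) = output w V ∧
      ∑ j, w' j * h₂ (e j) = ∑ u, w u * h₂ u ∧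
      ∑ u, w u * h₁ u ≤ ∑ j, w' j * h₁ (e j) := by
  have hU : Nonempty U := by
    by_contra h
    rw [not_nonempty_iff] at h
    simpa using hw.2
  -- The moments are the `card Z` probabilities and, at `none`, the mean of `h₂`. Total mass needs
  -- no moment of its own, because the probabilities of each component sum to one; this gives the
  -- bound `card Z + 1`.
  obtain ⟨w₁, k1, k2, k3, k4⟩ := exists_small_support
    (fun (u : U) (o : Option Z) => o.elim (h₂ u) (V u)) (fun o => o.elim 0 fun _ => 1)
    (fun u => by simp [Fintype.sum_option, hV]) h₁ w hw.1
  set s := Finset.univ.filter fun u => w₁ u ≠ 0 with hs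
  have hle : Fintype.card s ≤ Fintype.card (Fin (Fintype.card Z + 1)) := by
    rw [Fintype.card_coe, Fintype.card_fin]
    exact k4.trans (by rw [Fintype.card_option])
  obtain ⟨g⟩ := Function.Embedding.nonempty_of_card_le hle
  -- Indices outside the range of `g` get weight zero, so the default value is immaterial.
  set e : Fin (Fintype.card Z + 1) → U := fun j =>
    if h : ∃ u : s, g u = j then h.choose else Classical.arbitrary U with he
  have heg : ∀ u : s, e (g u) = u := by
    intro u
    have hex : ∃ u' : s, g u' = g u := ⟨u, rfl⟩
    have : e (g u) = hex.choose := by simp only [he, dif_pos hex]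
    rw [this, g.injective hex.choose_spec]
  have hsum : ∀ f : U → ℝ, ∑ j, law (fun u : s => w₁ u) g j * f (e j) = ∑ u, w₁ u * f u := by
    intro f
    rw [sum_law_mul (fun u : s => w₁ u) g (fun j => f (e j))]
    simp only [heg]
    rw [Finset.sum_coe_sort s (fun u => w₁ u * f u)]
    refine Finset.sum_subset (Finset.subset_univ s) fun u _ hu => ?_
    simp only [hs, Finset.mem_filter, Finset.mem_univ, true_and, not_not] at hu
    rw [hu, zero_mul]
  have hz : ∀ z, ∑ u, w₁ u * V u z = ∑ u, w u * V u z := fun z => k2 (some z)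
  refine ⟨law (fun u : s => w₁ u) g, e, ⟨law_nonneg (Q := fun u : s => w₁ u) (fun u => k1 u) g, ?_⟩, ?_, ?_, ?_⟩
  · have h1 := hsum (fun _ => 1)
    simp only [mul_one] at h1
    rw [h1, ← hw.2]
    have : ∀ w : U → ℝ, ∑ u, w u = ∑ z, ∑ u, w u * V u z := fun w => by
      rw [Finset.sum_comm]
      simp only [← Finset.mul_sum, hV, mul_one]
    rw [this w₁, this w]
    exact Finset.sum_congr rfl fun z _ => hz z
  · funext z
    exact (hsum (fun u => V u z)).trans (hz z)
  · exact (hsum h₂).trans (k2 none)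
  · rw [hsum h₁]
    exact k3

end SupportReduction

/-! ### Information quantities of a mixture, and chains given the auxiliary variable. -/

section MixtureInformation

variable {S X Y T U β : Type*} [Fintype S] [Fintype X] [Fintype Y] [Fintype T] [Fintype U]
  [Fintype β]

theorem ent_mix (p : U → ℝ) (V : U → S × X × Y × T → ℝ) (F : S × X × Y × T → β) :
    ent (mix p V) (fun ω => F (forgetAux ω)) = ent (output p V) F := by
  simp only [ent, law_mix]

/-- Chain rule for the entropy. It makes every information involving `U` a function of the output
law minus a mean over `p`, hence affine in the weights at a fixed output law, as support reduction
needs. -/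
theorem ent_mix_pair {p : U → ℝ} {V : U → S × X × Y × T → ℝ}
    (hV : ∀ u, V u ∈ stdSimplex ℝ (S × X × Y × T)) (F : S × X × Y × T → β) :
    ent (mix p V) (fun ω => (ω.2.2.2.1, F (forgetAux ω)))
      = ent (mix p V) (fun ω => ω.2.2.2.1) + ∑ u, p u * ent (V u) F := by
  have hA : ∀ u, law (mix p V) (fun ω => ω.2.2.2.1) u = p u := fun u => by
    rw [← sum_law_pair _ _ (fun ω => F (forgetAux ω)) u]
    simp only [law_mix_pair, ← Finset.mul_sum, (law_mem_stdSimplex (hV u) F).2, mul_one]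
  rw [ent_channel (V := fun u => law (V u) F) (fun u => (law_mem_stdSimplex (hV u) F).2)
    (fun u b => by rw [law_mix_pair, hA])]
  simp only [hA, ent]

/-- `I(U;S)` in nats, for the mixture of the distributions `V u` with weights `p`. -/
def sourceInfo (p : U → ℝ) (V : U → S × X × Y × T → ℝ) : ℝ :=
  ent (output p V) (fun z => z.1) - ∑ u, p u * ent (V u) (fun z => z.1)

/-- `I(U;SXŜ|Y)` in nats, for the mixture of the distributions `V u` with weights `p`. -/
def outputCondInfo (p : U → ℝ) (V : U → S × X × Y × T → ℝ) : ℝ :=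
  ent (output p V) (fun z => z) - ent (output p V) (fun z => z.2.2.1)
    - ∑ u, p u * (ent (V u) (fun z => z) - ent (V u) (fun z => z.2.2.1))

/-- `I(X;Y)` in nats. -/
def inputOutputInfo (P : S × X × Y × T → ℝ) : ℝ :=
  ent P (fun z => z.2.1) + ent P (fun z => z.2.2.1) - ent P (fun z => (z.2.1, z.2.2.1))

theorem mutualInfo_mix_source {U : Type} [Fintype U] {p : U → ℝ} {V : U → S × X × Y × T → ℝ}
    (hV : ∀ u, V u ∈ stdSimplex ℝ (S × X × Y × T)) :
    mutualInfo (mix p V) rvU rvS = sourceInfo p V / log 2 := by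
  have h1 := ent_mix_pair (p := p) hV (fun z => z.1)
  have h2 := ent_mix p V (fun z => z.1)
  simp only [forgetAux] at h1 h2
  simp only [mutualInfo, entropy_eq_ent_div, rvU, rvS, sourceInfo]
  change _ / _ + ent (mix p V) (fun ω => ω.1) / _ - _ = _
  rw [h1, h2]
  change ent (mix p V) (fun ω => ω.2.2.2.1) / _ + _ - _ = _
  ring

theorem mutualInfo_mix_inputOutput {U : Type} [Fintype U] (p : U → ℝ)
    (V : U → S × X × Y × T → ℝ) :
    mutualInfo (mix p V) rvX rvY = inputOutputInfo (output p V) / log 2 := by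
  simp only [mutualInfo, entropy_eq_ent_div, inputOutputInfo]
  rw [← ent_mix, ← ent_mix, ← ent_mix, sub_div, add_div]
  rfl

theorem condMutualInfo_mix {U : Type} [Fintype U] {p : U → ℝ} {V : U → S × X × Y × T → ℝ}
    (hV : ∀ u, V u ∈ stdSimplex ℝ (S × X × Y × T)) :
    condMutualInfo (mix p V) rvU rvSXT rvY = outputCondInfo p V / log 2 := by
  have h1 : ent (mix p V) (fun ω => (rvU ω, rvY ω)) = _ :=
    ent_mix_pair (p := p) hV (fun z => z.2.2.1)
  have h2 : ent (mix p V) rvY = _ := ent_mix p V (fun z => z.2.2.1)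
  have h3 := ent_mix_pair (p := p) hV (fun z => z)
  have h4 := ent_mix p V (fun z => z)
  simp only [condMutualInfo, entropy_eq_ent_div, outputCondInfo]
  rw [ent_congr _ (A := fun ω => (rvSXT ω, rvY ω)) (B := fun ω => forgetAux ω)
      (by simp only [rvSXT, rvY, forgetAux, Prod.mk.injEq]; tauto),
    ent_congr _ (A := fun ω => (rvU ω, rvSXT ω, rvY ω))
      (B := fun ω => (ω.2.2.2.1, forgetAux ω))
      (by simp only [rvU, rvSXT, rvY, forgetAux, Prod.mk.injEq]; tauto), h1, h2, h3, h4]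
  simp only [mul_sub, Finset.sum_sub_distrib]
  ring

/-- The distribution `a(s, x) W(y|x) r(t|y)`. -/
def chain (W : X → Y → ℝ) (a : S × X → ℝ) (r : Y → T → ℝ) (z : S × X × Y × T) : ℝ :=
  a (z.1, z.2.1) * W z.2.1 z.2.2.1 * r z.2.2.1 z.2.2.2

theorem chain_mem_stdSimplex {W : X → Y → ℝ} (hW : ∀ x, W x ∈ stdSimplex ℝ Y) {a : S × X → ℝ}
    (ha : a ∈ stdSimplex ℝ (S × X)) {r : Y → T → ℝ} (hr : ∀ y, r y ∈ stdSimplex ℝ T) :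
    chain W a r ∈ stdSimplex ℝ (S × X × Y × T) := by
  refine ⟨fun z => mul_nonneg (mul_nonneg (ha.1 _) ((hW _).1 _)) ((hr _).1 _), ?_⟩
  simp only [chain, Fintype.sum_prod_type, ← Finset.mul_sum, (hr _).2, (hW _).2, mul_one]
  rw [← ha.2, Fintype.sum_prod_type]

theorem law_chain_source {W : X → Y → ℝ} (hW : ∀ x, W x ∈ stdSimplex ℝ Y) (a : S × X → ℝ)
    {r : Y → T → ℝ} (hr : ∀ y, r y ∈ stdSimplex ℝ T) (s : S) :
    law (chain W a r) (fun z => z.1) s = ∑ x, a (s, x) := by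
  simp only [law_eq_sum_ite, Fintype.sum_prod_type, chain]
  rw [Finset.sum_eq_single s (fun y' _ h => by simp [h]) (by simp)]
  simp only [if_true, ← Finset.mul_sum, (hr _).2, (hW _).2, mul_one]

theorem law_chain_inputOutput (W : X → Y → ℝ) (a : S × X → ℝ)
    {r : Y → T → ℝ} (hr : ∀ y, r y ∈ stdSimplex ℝ T) (x : X) (y : Y) :
    law (chain W a r) (fun z => (z.2.1, z.2.2.1)) (x, y) = (∑ s, a (s, x)) * W x y := by
  simp only [law_eq_sum_ite, Fintype.sum_prod_type, chain, Prod.mk.injEq]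
  rw [Finset.sum_mul]
  refine Finset.sum_congr rfl fun s _ => ?_
  rw [Finset.sum_eq_single x (fun y' _ h => by simp [h]) (by simp),
    Finset.sum_eq_single y (fun y' _ h => by simp [h]) (by simp)]
  simp only [and_self, if_true, ← Finset.mul_sum, (hr _).2, mul_one]

/-- Bayes in the direction opposite to the inner bound: `P_{U|S}` and `P_{X|US}` are recovered by
normalising the joint weights of `U`, `S` and `X`. -/
theorem auxFactors_of_chain [Nonempty X] {U : Type} [Fintype U] [Nonempty U] {PS : S → ℝ}
    {W : X → Y → ℝ} (hW : ∀ x, W x ∈ stdSimplex ℝ Y)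
    {w : U → ℝ} (hw : w ∈ stdSimplex ℝ U) {a : U → S × X → ℝ}
    (ha : ∀ u, a u ∈ stdSimplex ℝ (S × X)) {r : U → Y → T → ℝ}
    (hr : ∀ u y, r u y ∈ stdSimplex ℝ T)
    (hS : law (output w fun u => chain W (a u) (r u)) (fun z => z.1) = PS) :
    AuxFactors PS W (mix w fun u => chain W (a u) (r u)) := by
  have hS' : ∀ s, ∑ u, w u * ∑ x, a u (s, x) = PS s := by
    intro s
    rw [← hS, law_output]
    exact Finset.sum_congr rfl fun u _ => by rw [law_chain_source hW (a u) (hr u) s]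
  have h1 : ∀ s, ∃ e ∈ stdSimplex ℝ U, ∀ u, w u * ∑ x, a u (s, x)
      = (∑ u, w u * ∑ x, a u (s, x)) * e u := fun s =>
    exists_normalization fun u =>
      mul_nonneg (hw.1 u) (Finset.sum_nonneg fun x _ => (ha u).1 (s, x))
  have h2 : ∀ u s, ∃ e ∈ stdSimplex ℝ X, ∀ x, a u (s, x) = (∑ x, a u (s, x)) * e x := fun u s =>
    exists_normalization fun x => (ha u).1 (s, x)
  choose PU hPU hPU' using h1
  choose px hpx hpx' using h2
  refine ⟨PU, px, r, hPU, hpx, hr, fun s x y u t => ?_⟩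
  rw [← hS' s, ← hPU' s u]
  simp only [mix, chain]
  rw [hpx' u s x]
  ring

/-- Summing the numerator of `P_{Ŝ|SXY}` over the reconstruction removes `y`, so its normalising
constant is exactly `P_{X|S}`. -/
theorem targetFactors_of_auxFactors [Nonempty T] {U : Type} [Fintype U] {PS : S → ℝ}
    {W : X → Y → ℝ} {P : S × X × Y × T → ℝ} {Q : S × X × Y × U × T → ℝ}
    (hQ : AuxFactors PS W Q) (hP : IsMarginal P Q) : TargetFactors PS W P := by
  obtain ⟨PU, px, pt, hPU, hpx, hpt, hQ⟩ := hQ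
  have h1 : ∀ s x y, ∃ e ∈ stdSimplex ℝ T, ∀ t, ∑ u, PU s u * px u s x * pt u y t
      = (∑ t, ∑ u, PU s u * px u s x * pt u y t) * e t := fun s x y =>
    exists_normalization fun t => Finset.sum_nonneg fun u _ =>
      mul_nonneg (mul_nonneg ((hPU s).1 u) ((hpx u s).1 x)) ((hpt u y).1 t)
  choose PT hPT hPT' using h1
  refine ⟨fun s x => ∑ u, PU s u * px u s x, PT, fun s => ⟨fun x => Finset.sum_nonneg fun u _ =>
    mul_nonneg ((hPU s).1 u) ((hpx u s).1 x), ?_⟩, hPT, fun s x y t => ?_⟩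
  · rw [Finset.sum_comm]
    simp only [← Finset.mul_sum, (hpx _ _).2, mul_one, (hPU s).2]
  · have h2 : ∑ t, ∑ u, PU s u * px u s x * pt u y t = ∑ u, PU s u * px u s x := by
      rw [Finset.sum_comm]
      simp only [← Finset.mul_sum, (hpt _ _).2, mul_one]
    have h3 := hPT' s x y t
    rw [h2] at h3
    calc P (s, x, y, t) = PS s * W x y * ∑ u, PU s u * px u s x * pt u y t := by
          rw [hP, Finset.mul_sum]
          exact Finset.sum_congr rfl fun u _ => by rw [hQ]; ring
      _ = _ := by rw [h3]; ring

end MixtureInformation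

/-! ### The single-letter converse for one block. -/

section SingleLetter

variable {S X Y T : Type*} [Fintype S] [Fintype X] [Fintype Y] [Fintype T]

/-- The sample space of a block: common randomness, source, input, output, reconstruction. -/
abbrev Block (S X Y T : Type*) (n N : ℕ) : Type _ :=
  Fin N × (Fin n → S) × (Fin n → X) × (Fin n → Y) × (Fin n → T)

variable {n N : ℕ}

/-- The joint distribution of the common randomness and of the block, induced by a code. -/
def Code.joint (κ : Code S X Y T n N) (PS : S → ℝ) (W : X → Y → ℝ) (ω : Block S X Y T n N) : ℝ :=
  (N : ℝ)⁻¹ * iid PS n ω.2.1 * κ.enc ω.2.1 ω.1 ω.2.2.1 * memoryless W n ω.2.2.1 ω.2.2.2.1 *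
    κ.dec ω.2.2.2.1 ω.1 ω.2.2.2.2

/-- The block of quadruples. -/
def blockZ (ω : Block S X Y T n N) (i : Fin n) : S × X × Y × T :=
  (ω.2.1 i, ω.2.2.1 i, ω.2.2.2.1 i, ω.2.2.2.2 i)

/-- The common randomness and the outputs at all times but `k`, where the output is replaced by
`y₀`. -/
def auxVar (y₀ : Y) (k : Fin n) (ω : Block S X Y T n N) : Fin N × (Fin n → Y) :=
  (ω.1, Function.update ω.2.2.2.1 k y₀)

/-- The average of the one-letter marginals. -/
def avgMarginal {Z : Type*} [Fintype Z] (P : (Fin n → Z) → ℝ) (z : Z) : ℝ :=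
  (n : ℝ)⁻¹ * ∑ k, law P (fun x => x k) z

variable (κ : Code S X Y T n N) {PS : S → ℝ} {W : X → Y → ℝ}

theorem Code.joint_mem_stdSimplex (hN : 0 < N) (hPS : PS ∈ stdSimplex ℝ S)
    (hW : ∀ x, W x ∈ stdSimplex ℝ Y) : κ.joint PS W ∈ stdSimplex ℝ (Block S X Y T n N) := by
  have h1 := iid_mem_stdSimplex hPS n
  have h2 := memoryless_mem_stdSimplex hW n
  refine ⟨fun ω => mul_nonneg (mul_nonneg (mul_nonneg (mul_nonneg (by positivity) (h1.1 _))
    ((κ.enc_mem _ _).1 _)) ((h2 _).1 _)) ((κ.dec_mem _ _).1 _), ?_⟩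
  simp only [Code.joint, Fintype.sum_prod_type, ← Finset.mul_sum, (κ.dec_mem _ _).2, (h2 _).2,
    (κ.enc_mem _ _).2, h1.2, mul_one]
  simp [hN.ne']

theorem Code.law_joint_blockZ : law (κ.joint PS W) blockZ = κ.induced PS W := by
  funext z
  rw [law_eq_sum_ite, Fintype.sum_prod_type, Code.induced]
  refine Finset.sum_congr rfl fun c _ => ?_
  rw [Finset.sum_eq_single (blockEquiv S X Y T n z)]
  · exact if_pos rfl
  · intro w _ hw
    rw [if_neg]
    intro h
    exact hw (by rw [← h]; rfl)
  · simp

theorem Code.law_joint_randomness_source (hW : ∀ x, W x ∈ stdSimplex ℝ Y) (c : Fin N)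
    (s : Fin n → S) :
    law (κ.joint PS W) (fun ω => (ω.1, ω.2.1)) (c, s) = (N : ℝ)⁻¹ * iid PS n s := by
  simp only [law_eq_sum_ite, Fintype.sum_prod_type, Prod.mk.injEq]
  rw [Finset.sum_eq_single c (fun _ _ h => by simp [h]) (by simp),
    Finset.sum_eq_single s (fun _ _ h => by simp [h]) (by simp)]
  simp only [and_self, if_true, Code.joint, ← Finset.mul_sum, (κ.dec_mem _ _).2,
    (memoryless_mem_stdSimplex hW n _).2, (κ.enc_mem _ _).2, mul_one]

theorem Code.law_joint_randomness (hPS : PS ∈ stdSimplex ℝ S) (hW : ∀ x, W x ∈ stdSimplex ℝ Y)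
    (c : Fin N) : law (κ.joint PS W) (fun ω => ω.1) c = (N : ℝ)⁻¹ := by
  rw [← sum_law_pair _ _ (fun ω => ω.2.1) c]
  simp only [κ.law_joint_randomness_source hW, ← Finset.mul_sum, (iid_mem_stdSimplex hPS n).2,
    mul_one]

theorem Code.law_joint_source (hN : 0 < N) (hW : ∀ x, W x ∈ stdSimplex ℝ Y) :
    law (κ.joint PS W) (fun ω => ω.2.1) = iid PS n := by
  funext s
  rw [← sum_law_pair _ _ (fun ω => ω.1) s]
  have : ∀ c, law (κ.joint PS W) (fun ω => (ω.2.1, ω.1)) (s, c) = (N : ℝ)⁻¹ * iid PS n s :=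
    fun c => by
      rw [← κ.law_joint_randomness_source hW c s]
      exact law_congr _ fun ω => by simp [and_comm]
  simp only [this, Finset.sum_const, Finset.card_univ, Fintype.card_fin, nsmul_eq_mul]
  field_simp

theorem Code.law_joint_input_output (c : Fin N) (s : Fin n → S) (x : Fin n → X) (y : Fin n → Y) :
    law (κ.joint PS W) (fun ω => ((ω.2.2.1, ω.2.1, ω.1), ω.2.2.2.1)) ((x, s, c), y)
      = (N : ℝ)⁻¹ * iid PS n s * κ.enc s c x * memoryless W n x y := by
  simp only [law_eq_sum_ite, Fintype.sum_prod_type, Prod.mk.injEq]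
  rw [Finset.sum_eq_single c (fun _ _ h => by simp [h]) (by simp),
    Finset.sum_eq_single s (fun _ _ h => by simp [h]) (by simp),
    Finset.sum_eq_single x (fun _ _ h => by simp [h]) (by simp),
    Finset.sum_eq_single y (fun _ _ h => by simp [h]) (by simp)]
  simp only [and_self, if_true, Code.joint, ← Finset.mul_sum, (κ.dec_mem _ _).2, mul_one]

theorem Code.law_joint_channel (hW : ∀ x, W x ∈ stdSimplex ℝ Y)
    (a : (Fin n → X) × (Fin n → S) × Fin N) (y : Fin n → Y) :
    law (κ.joint PS W) (fun ω => ((ω.2.2.1, ω.2.1, ω.1), ω.2.2.2.1)) (a, y)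
      = law (κ.joint PS W) (fun ω => (ω.2.2.1, ω.2.1, ω.1)) a * memoryless W n a.1 y := by
  obtain ⟨x, s, c⟩ := a
  rw [← sum_law_pair _ _ (fun ω => ω.2.2.2.1) (x, s, c)]
  simp only [κ.law_joint_input_output, ← Finset.mul_sum, (memoryless_mem_stdSimplex hW n _).2,
    mul_one]

/-- Given the common randomness and the other outputs, the letters at time `k` form a chain. -/
theorem Code.exists_chain [Nonempty S] [Nonempty X] [Nonempty T] (hN : 0 < N)
    (hPS : PS ∈ stdSimplex ℝ S) (hW : ∀ x, W x ∈ stdSimplex ℝ Y) (y₀ : Y) (k : Fin n)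
    (v : Fin N × (Fin n → Y)) :
    ∃ (a : S × X → ℝ) (r : Y → T → ℝ), a ∈ stdSimplex ℝ (S × X) ∧ (∀ y, r y ∈ stdSimplex ℝ T) ∧
      ∀ z, law (κ.joint PS W) (fun ω => (auxVar y₀ k ω, blockZ ω k)) (v, z)
        = law (κ.joint PS W) (auxVar y₀ k) v * chain W a r z := by
  obtain ⟨c, y'⟩ := v
  -- Once `C` and the other outputs are fixed, the decoder depends on the block only through the
  -- output at time `k`.
  set r : Y → T → ℝ := fun y => law (κ.dec (Function.update y' k y) c) (fun t => t k) with hr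
  have hrm : ∀ y, r y ∈ stdSimplex ℝ T := fun y => law_mem_stdSimplex (κ.dec_mem _ _) _
  have key : ∃ A : S × X → ℝ, (∀ q, 0 ≤ A q) ∧ ∀ z,
      law (κ.joint PS W) (fun ω => (auxVar y₀ k ω, blockZ ω k)) ((c, y'), z) = chain W A r z := by
    -- `auxVar` always carries `y₀` at time `k`; any other value has probability zero.
    by_cases hy : y' k = y₀
    -- The weight of `(s k, x k)` collects the source, the encoder, and the channel at all times but
    -- `k`; the channel at time `k` is the factor `W` of the chain.
    · refine ⟨fun q => ∑ s : Fin n → S, ∑ x : Fin n → X, if s k = q.1 ∧ x k = q.2 then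
        (N : ℝ)⁻¹ * iid PS n s * κ.enc s c x * ∏ i ∈ Finset.univ.erase k, W (x i) (y' i) else 0,
        fun q => Finset.sum_nonneg fun s _ => Finset.sum_nonneg fun x _ => ?_, ?_⟩
      · split_ifs
        · exact mul_nonneg (mul_nonneg (mul_nonneg (by positivity)
            ((iid_mem_stdSimplex hPS n).1 _)) ((κ.enc_mem _ _).1 _))
            (Finset.prod_nonneg fun i _ => (hW _).1 _)
        · exact le_rfl
      · rintro ⟨s₁, x₁, y₁, t₁⟩
        simp only [law_eq_sum_ite _ _ ((c, y'), (s₁, x₁, y₁, t₁)), Fintype.sum_prod_type, auxVar,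
          blockZ, Prod.mk.injEq]
        rw [Finset.sum_eq_single c (fun _ _ h => by simp [h]) (by simp)]
        simp only [chain, Finset.sum_mul]
        refine Finset.sum_congr rfl fun s _ => Finset.sum_congr rfl fun x _ => ?_
        have hcond : ∀ y : Fin n → Y, (Function.update y k y₀ = y' ∧ y k = y₁)
            ↔ y = Function.update y' k y₁ := by
          intro y
          constructor
          · rintro ⟨h1, h2⟩
            rw [← h1, ← h2]
            simp
          · rintro rfl
            refine ⟨?_, by simp⟩
            rw [Function.update_idem, ← hy, Function.update_eq_self]
        rw [Finset.sum_eq_single (Function.update y' k y₁)]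
        · by_cases hsx : s k = s₁ ∧ x k = x₁
          · have hprod : memoryless W n x (Function.update y' k y₁)
                = (∏ i ∈ Finset.univ.erase k, W (x i) (y' i)) * W x₁ y₁ := by
              rw [memoryless, ← Finset.prod_erase_mul _ _ (Finset.mem_univ k)]
              congr 1
              · refine Finset.prod_congr rfl fun i hi => ?_
                rw [Function.update_of_ne (Finset.ne_of_mem_erase hi)]
              · rw [Function.update_self, hsx.2]
            simp only [hsx, and_self, if_true, true_and, Function.update_self,
              ((hcond (Function.update y' k y₁)).2 rfl).1]
            simp only [Code.joint, hprod, hr, law_eq_sum_ite, Finset.mul_sum]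
            refine Finset.sum_congr rfl fun t _ => ?_
            split_ifs
            · ring
            · simp
          · rw [if_neg hsx, zero_mul, zero_mul]
            refine Finset.sum_eq_zero fun t _ => if_neg ?_
            tauto
        · intro y _ hne
          refine Finset.sum_eq_zero fun t _ => if_neg ?_
          rintro ⟨⟨-, h1⟩, -, -, h2, -⟩
          exact hne ((hcond y).1 ⟨h1, h2⟩)
        · simp
    · refine ⟨fun _ => 0, fun _ => le_rfl, fun z => ?_⟩
      rw [law_eq_sum_ite, Finset.sum_eq_zero]
      · simp [chain]
      · intro ω _
        rw [if_neg]
        intro h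
        simp only [auxVar, Prod.mk.injEq] at h
        apply hy
        rw [← h.1.2]
        simp
  obtain ⟨A, hA, hAz⟩ := key
  obtain ⟨a, ha, haA⟩ := exists_normalization hA
  refine ⟨a, r, ha, hrm, fun z => ?_⟩
  have hsum : law (κ.joint PS W) (auxVar y₀ k) (c, y') = ∑ q, A q := by
    rw [← sum_law_pair _ _ (fun ω => blockZ ω k) (c, y')]
    simp only [hAz, chain, Fintype.sum_prod_type, ← Finset.mul_sum, (hrm _).2, (hW _).2, mul_one]
  rw [hAz, hsum]
  simp only [chain]
  rw [haA]
  ring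

theorem Code.induced_mem_stdSimplex (hN : 0 < N) (hPS : PS ∈ stdSimplex ℝ S)
    (hW : ∀ x, W x ∈ stdSimplex ℝ Y) :
    κ.induced PS W ∈ stdSimplex ℝ (Fin n → S × X × Y × T) := by
  rw [← κ.law_joint_blockZ]
  exact law_mem_stdSimplex (κ.joint_mem_stdSimplex hN hPS hW) _

theorem law_iid_apply {Z : Type*} [Fintype Z] {p : Z → ℝ} (hp : ∑ z, p z = 1) (k : Fin n) :
    law (iid p n) (fun x => x k) = p := by
  funext z
  have h := sum_prod_mul_eq (fun _ : Fin n => p) (fun _ => hp) (fun z' => if z' = z then 1 else 0) k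
  simp only [mul_ite, mul_one, mul_zero, Finset.sum_ite_eq', Finset.mem_univ, if_true] at h
  rw [law_eq_sum_ite, ← h]
  rfl

theorem law_avgMarginal {Z β : Type*} [Fintype Z] [Fintype β] (P : (Fin n → Z) → ℝ) (F : Z → β)
    (b : β) :
    law (avgMarginal P) F b = ∑ k : Fin n, (n : ℝ)⁻¹ * law P (fun x => F (x k)) b := by
  have h := law_output (fun _ : Fin n => (n : ℝ)⁻¹) (fun k => law P (fun x => x k)) F b
  simp only [law_law] at h
  rw [← h]
  congr 1
  funext z
  rw [avgMarginal, output, Finset.mul_sum]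

/-- Jensen's inequality, by concavity of `negMulLog`. -/
theorem sum_ent_le_ent_avgMarginal {Z β : Type*} [Fintype Z] [Fintype β] (hn : 0 < n)
    {P : (Fin n → Z) → ℝ} (hP : ∀ z, 0 ≤ P z) (F : Z → β) :
    ∑ k, ent P (fun x => F (x k)) ≤ n * ent (avgMarginal P) F := by
  have hn' : (0 : ℝ) < n := by exact_mod_cast hn
  have hJ : ∀ b, ∑ k : Fin n, (n : ℝ)⁻¹ * negMulLog (law P (fun x => F (x k)) b)
      ≤ negMulLog (law (avgMarginal P) F b) := by
    intro b
    rw [law_avgMarginal]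
    have := Real.concaveOn_negMulLog.le_map_sum (t := Finset.univ) (w := fun _ : Fin n => (n : ℝ)⁻¹)
      (p := fun k => law P (fun x => F (x k)) b) (fun _ _ => by positivity)
      (by simp [hn'.ne']) (fun k _ => law_nonneg hP _ _)
    simpa using this
  have h2 := Finset.sum_le_sum fun b (_ : b ∈ Finset.univ) => hJ b
  rw [Finset.sum_comm] at h2
  simp only [← Finset.mul_sum] at h2
  have h3 := mul_le_mul_of_nonneg_left h2 hn'.le
  rw [← mul_assoc, mul_inv_cancel₀ hn'.ne', one_mul] at h3
  exact h3

/-- The mean conditional entropy of a function of the output of a channel. -/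
theorem sum_law_mul_ent {Ω α β γ : Type*} [Fintype Ω] [Fintype α] [Fintype β] [Fintype γ]
    {Q : Ω → ℝ} {A : Ω → α} {B : Ω → β} {V : α → β → ℝ} (hV : ∀ a, V a ∈ stdSimplex ℝ β)
    (h : ∀ a b, law Q (fun ω => (A ω, B ω)) (a, b) = law Q A a * V a b) (F : β → γ) :
    ∑ a, law Q A a * ent (V a) F = ent Q (fun ω => (A ω, F (B ω))) - ent Q A := by
  have h1 : ∀ a c, law Q (fun ω => (A ω, F (B ω))) (a, c) = law Q A a * law (V a) F c := by
    intro a c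
    have e1 := law_law Q (fun ω => (A ω, B ω)) (fun w : α × β => (w.1, F w.2))
    rw [← congrFun e1 (a, c)]
    rw [law_eq_sum_ite]
    simp only [Fintype.sum_prod_type, h, Prod.mk.injEq]
    rw [Finset.sum_eq_single a (fun _ _ h => by simp [h]) (by simp), law_eq_sum_ite (V a),
      Finset.mul_sum]
    simp
  rw [ent_channel (V := fun a => law (V a) F) (fun a => (law_mem_stdSimplex (hV a) F).2) h1]
  simp [ent]

/-- The masked output word and the letter at time `k` together carry the same information as the
whole word. -/
theorem update_eq_update_and_iff {y y' : Fin n → Y} {y₀ : Y} {k : Fin n} :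
    (Function.update y k y₀ = Function.update y' k y₀ ∧ y k = y' k) ↔ y = y' := by
  constructor
  · rintro ⟨h1, h2⟩
    have h3 := congrArg (fun f => Function.update f k (y k)) h1
    simp only [Function.update_idem, Function.update_eq_self] at h3
    rw [h3, h2, Function.update_eq_self]
  · rintro rfl
    exact ⟨rfl, rfl⟩

/-- The single-letter converse: the auxiliary variable consists of a uniform time, the common
randomness and the channel outputs at the other times. -/
theorem Code.exists_single_letter [Nonempty S] [Nonempty X] [Nonempty Y] [Nonempty T]
    (hn : 0 < n) (hN : 0 < N) (hPS : PS ∈ stdSimplex ℝ S) (hW : ∀ x, W x ∈ stdSimplex ℝ Y) :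
    ∃ (w : Fin n × Fin N × (Fin n → Y) → ℝ) (a : Fin n × Fin N × (Fin n → Y) → S × X → ℝ)
      (r : Fin n × Fin N × (Fin n → Y) → Y → T → ℝ),
      w ∈ stdSimplex ℝ (Fin n × Fin N × (Fin n → Y)) ∧ (∀ u, a u ∈ stdSimplex ℝ (S × X)) ∧
      (∀ u y, r u y ∈ stdSimplex ℝ T) ∧
      output w (fun u => chain W (a u) (r u)) = avgMarginal (κ.induced PS W) ∧
      law (avgMarginal (κ.induced PS W)) (fun z => z.1) = PS ∧
      sourceInfo w (fun u => chain W (a u) (r u))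
        ≤ inputOutputInfo (avgMarginal (κ.induced PS W)) ∧
      n * outputCondInfo w (fun u => chain W (a u) (r u))
        ≤ log N + n * ent (avgMarginal (κ.induced PS W)) (fun z => z)
          - ∑ z, negMulLog (κ.induced PS W z) := by
  have hn' : (0 : ℝ) < n := by exact_mod_cast hn
  have hN' : (0 : ℝ) < N := by exact_mod_cast hN
  obtain ⟨y₀⟩ := ‹Nonempty Y›
  set Q := κ.joint PS W with hQdef
  have hQ : Q ∈ stdSimplex ℝ (Block S X Y T n N) := κ.joint_mem_stdSimplex hN hPS hW
  choose a r ha hr hchain using fun (k : Fin n) (v : Fin N × (Fin n → Y)) =>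
    κ.exists_chain hN hPS hW y₀ k v
  rw [← hQdef] at hchain
  set w : Fin n × Fin N × (Fin n → Y) → ℝ := fun u => (n : ℝ)⁻¹ * law Q (auxVar y₀ u.1) u.2 with hw
  set V : Fin n × Fin N × (Fin n → Y) → S × X × Y × T → ℝ :=
    fun u => chain W (a u.1 u.2) (r u.1 u.2) with hV
  have hVm : ∀ u, V u ∈ stdSimplex ℝ (S × X × Y × T) := fun u =>
    chain_mem_stdSimplex hW (ha _ _) (hr _ _)
  set P := avgMarginal (κ.induced PS W) with hP
  have hind : κ.induced PS W = law Q blockZ := (κ.law_joint_blockZ).symm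
  have hindm := κ.induced_mem_stdSimplex hN hPS hW
  have hwm : w ∈ stdSimplex ℝ (Fin n × Fin N × (Fin n → Y)) := by
    refine ⟨fun u => mul_nonneg (by positivity) (law_nonneg hQ.1 _ _), ?_⟩
    rw [Fintype.sum_prod_type]
    simp only [hw, ← Finset.mul_sum, sum_law, hQ.2]
    simp [hn'.ne']
  have hPz : ∀ z, P z = ∑ k : Fin n, (n : ℝ)⁻¹ * law Q (fun ω => blockZ ω k) z := by
    intro z
    rw [hP, avgMarginal, Finset.mul_sum, hind]
    simp only [law_law]
  have hout : output w V = P := by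
    funext z
    rw [hPz, output, Fintype.sum_prod_type]
    refine Finset.sum_congr rfl fun k _ => ?_
    rw [← sum_law_pair Q (fun ω => blockZ ω k) (auxVar y₀ k) z, Finset.mul_sum]
    refine Finset.sum_congr rfl fun v _ => ?_
    rw [law_congr Q (B := fun ω => (auxVar y₀ k ω, blockZ ω k)) (b := (v, z))
      (fun ω => by simp [and_comm]), hchain, hw, hV]
    ring
  have hPS' : law P (fun z => z.1) = PS := by
    funext s
    have hk : ∀ k : Fin n, law Q (fun ω => (blockZ ω k).1) s = PS s := by
      intro k
      have h1 := congrFun (law_law Q (fun ω => ω.2.1) (fun s : Fin n → S => s k)) s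
      rw [hQdef, κ.law_joint_source hN hW, law_iid_apply hPS.2] at h1
      exact h1.symm
    rw [hP, law_avgMarginal, hind]
    simp only [law_law, hk]
    simp [hn'.ne']
  have hE1 : ∑ u, w u * ent (V u) (fun z => z.1) = (n : ℝ)⁻¹ * ∑ k, (ent Q (fun ω =>
      (auxVar y₀ k ω, (blockZ ω k).1)) - ent Q (auxVar y₀ k)) := by
    rw [Fintype.sum_prod_type, Finset.mul_sum]
    refine Finset.sum_congr rfl fun k _ => ?_
    rw [← sum_law_mul_ent (V := fun v => V (k, v)) (fun v => hVm _) (hchain k), Finset.mul_sum]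
    simp only [hw, mul_assoc]
  have hE2 : ∑ u, w u * ent (V u) (fun z => z) = (n : ℝ)⁻¹ * ∑ k, (ent Q (fun ω =>
      (auxVar y₀ k ω, blockZ ω k)) - ent Q (auxVar y₀ k)) := by
    rw [Fintype.sum_prod_type, Finset.mul_sum]
    refine Finset.sum_congr rfl fun k _ => ?_
    rw [← sum_law_mul_ent (V := fun v => V (k, v)) (fun v => hVm _) (hchain k) (fun z => z),
      Finset.mul_sum]
    simp only [hw, mul_assoc]
  have hE3 : ∑ u, w u * ent (V u) (fun z => z.2.2.1) = (n : ℝ)⁻¹ * ∑ k, (ent Q (fun ω =>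
      (auxVar y₀ k ω, (blockZ ω k).2.2.1)) - ent Q (auxVar y₀ k)) := by
    rw [Fintype.sum_prod_type, Finset.mul_sum]
    refine Finset.sum_congr rfl fun k _ => ?_
    rw [← sum_law_mul_ent (V := fun v => V (k, v)) (fun v => hVm _) (hchain k)
      (fun z => z.2.2.1), Finset.mul_sum]
    simp only [hw, mul_assoc]
  set CY : Block S X Y T n N → Fin N × (Fin n → Y) := fun ω => (ω.1, ω.2.2.2.1) with hCY
  have hc1 : ∀ k, ent Q (fun ω => (auxVar y₀ k ω, (blockZ ω k).2.2.1)) = ent Q CY := by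
    intro k
    refine ent_congr Q fun ω ω' => ?_
    simp only [auxVar, blockZ, hCY, Prod.mk.injEq, and_assoc, update_eq_update_and_iff]
  have hc2 : ∀ k, ent Q (fun ω => (auxVar y₀ k ω, blockZ ω k))
      = ent Q (fun ω => (blockZ ω k, CY ω)) := by
    intro k
    refine ent_congr Q fun ω ω' => ?_
    simp only [auxVar, blockZ, hCY, Prod.mk.injEq]
    rw [← update_eq_update_and_iff (y := ω.2.2.2.1) (y' := ω'.2.2.2.1) (y₀ := y₀) (k := k)]
    tauto
  -- Conditioning on the output at time `k` in addition to `auxVar` does not increase the entropy of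
  -- the source letter.
  have hc3 : ∀ k, ent Q (fun ω => ((blockZ ω k).1, CY ω)) - ent Q CY
      ≤ ent Q (fun ω => (auxVar y₀ k ω, (blockZ ω k).1)) - ent Q (auxVar y₀ k) := by
    intro k
    have h1 := ent_submodular hQ.1 (fun ω => (blockZ ω k).1) (fun ω => ω.2.2.2.1) (auxVar y₀ k)
    rw [ent_congr Q (A := fun ω => ((blockZ ω k).1, ω.2.2.2.1, auxVar y₀ k ω))
        (B := fun ω => ((blockZ ω k).1, CY ω)) ?_,
      ent_congr Q (A := fun ω => ((blockZ ω k).1, auxVar y₀ k ω))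
        (B := fun ω => (auxVar y₀ k ω, (blockZ ω k).1)) ?_,
      ent_congr Q (A := fun ω => (ω.2.2.2.1, auxVar y₀ k ω)) (B := CY) ?_] at h1
    · linarith
    all_goals
      intro ω ω'
      simp only [auxVar, hCY, Prod.mk.injEq]
    · constructor
      · tauto
      · rintro ⟨h1, h2⟩
        rw [h1, h2]
        simp
    · tauto
    · constructor
      · tauto
      · rintro ⟨h1, h2, h3⟩
        rw [h2, h3]
        exact ⟨h1, rfl, rfl, rfl⟩
  have hCent : ent Q (fun ω => ω.1) = log N := by
    simp only [ent, hQdef, κ.law_joint_randomness hPS hW, Finset.sum_const, Finset.card_univ,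
      Fintype.card_fin, nsmul_eq_mul, negMulLog, Real.log_inv]
    field_simp
  have hCYle : ent Q CY ≤ log N + n * ent P (fun z => z.2.2.1) := by
    have h1 := ent_pair_le hQ (fun ω => ω.1) (fun ω => ω.2.2.2.1)
    have h2 := ent_vector_le_sum hQ (fun ω => ω.2.2.2.1)
    have h3 := sum_ent_le_ent_avgMarginal hn hindm.1 (fun z => z.2.2.1)
    rw [← hP, hind] at h3
    simp only [ent_law] at h3
    rw [hCent] at h1
    calc ent Q CY ≤ _ := h1
      _ ≤ log N + n * ent P (fun z => z.2.2.1) := by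
        have := h2.trans h3
        linarith
  refine ⟨w, fun u => a u.1 u.2, fun u => r u.1 u.2, hwm, fun u => ha _ _, fun u => hr _ _, hout,
    hPS', ?_, ?_⟩
  · have hch : ∀ x y, law P (fun z => (z.2.1, z.2.2.1)) (x, y)
        = law P (fun z => z.2.1) x * W x y := by
      have h1 : ∀ x y, law P (fun z => (z.2.1, z.2.2.1)) (x, y)
          = (∑ u, w u * ∑ s, a u.1 u.2 (s, x)) * W x y := by
        intro x y
        rw [← hout, law_output, Finset.sum_mul]
        refine Finset.sum_congr rfl fun u _ => ?_
        have h0 : law (V u) (fun z => (z.2.1, z.2.2.1)) (x, y) = (∑ s, a u.1 u.2 (s, x)) * W x y :=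
          law_chain_inputOutput W _ (hr u.1 u.2) x y
        rw [h0]
        ring
      intro x y
      rw [← sum_law_pair P (fun z => z.2.1) (fun z => z.2.2.1) x]
      simp only [h1, ← Finset.mul_sum, (hW x).2, mul_one]
    have hPch := ent_channel (fun x => (hW x).2) hch
    -- `H(Yⁿ|XⁿSⁿC) = n H(Y|X)`, with `H(Y|X)` taken for the averaged law: it is linear in the law
    -- of the input.
    have hWn : ent Q (fun ω => ((ω.2.2.1, ω.2.1, ω.1), ω.2.2.2.1))
        = ent Q (fun ω => (ω.2.2.1, ω.2.1, ω.1))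
          + n * ∑ x, law P (fun z => z.2.1) x * ∑ y, negMulLog (W x y) := by
      rw [ent_channel (V := fun a => memoryless W n a.1)
        (fun a => (memoryless_mem_stdSimplex hW n _).2) (κ.law_joint_channel hW)]
      congr 1
      have h1 : ∀ x : Fin n → X, ∑ y, negMulLog (memoryless W n x y)
          = ∑ i, ∑ y, negMulLog (W (x i) y) := fun x =>
        sum_negMulLog_prod (fun i => W (x i)) fun i => (hW _).2
      simp only [h1]
      rw [sum_law_mul Q (fun ω => (ω.2.2.1, ω.2.1, ω.1))
        (fun a => ∑ i, ∑ y, negMulLog (W (a.1 i) y))]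
      have h2 : ∀ i : Fin n, ∑ ω, Q ω * ∑ y, negMulLog (W (ω.2.2.1 i) y)
          = ∑ x, law Q (fun ω => (blockZ ω i).2.1) x * ∑ y, negMulLog (W x y) := fun i =>
        (sum_law_mul Q (fun ω => (blockZ ω i).2.1) (fun x => ∑ y, negMulLog (W x y))).symm
      calc ∑ ω, Q ω * ∑ i, ∑ y, negMulLog (W (ω.2.2.1 i) y)
          = ∑ i, ∑ ω, Q ω * ∑ y, negMulLog (W (ω.2.2.1 i) y) := by
            rw [Finset.sum_comm]
            exact Finset.sum_congr rfl fun ω _ => Finset.mul_sum _ _ _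
        _ = ∑ x, (∑ i, law Q (fun ω => (blockZ ω i).2.1) x) * ∑ y, negMulLog (W x y) := by
            simp only [h2]
            rw [Finset.sum_comm]
            exact Finset.sum_congr rfl fun x _ => (Finset.sum_mul _ _ _).symm
        _ = _ := by
            rw [Finset.mul_sum]
            refine Finset.sum_congr rfl fun x _ => ?_
            rw [hP, law_avgMarginal, hind]
            simp only [law_law, ← Finset.mul_sum]
            field_simp
    have hCS : ent Q (fun ω => (ω.1, ω.2.1)) = log N + n * ent P (fun z => z.1) := by
      rw [ent_channel (V := fun _ => iid PS n) (fun _ => (iid_mem_stdSimplex hPS n).2)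
        (fun c s => by
          rw [hQdef, κ.law_joint_randomness_source hW, κ.law_joint_randomness hPS hW]), hCent]
      congr 1
      rw [← Finset.sum_mul, sum_law, hQ.2, one_mul]
      have h1 := sum_negMulLog_prod (fun _ : Fin n => PS) (fun _ => hPS.2)
      simp only [Finset.sum_const, Finset.card_univ, Fintype.card_fin, nsmul_eq_mul] at h1
      rw [ent, hPS']
      exact h1
    have hvec := ent_vector_le hQ.1 (fun ω => ω.2.1) CY
    have hvec' := hvec.trans (Finset.sum_le_sum fun k _ => hc3 k)
    -- `H(Yⁿ|SⁿC) ≥ H(Yⁿ|XⁿSⁿC) = n H(Y|X)`. With `hvec'` and `hCYle` this gives `n I(U;S) ≤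
    -- I(Sⁿ;CYⁿ) ≤ n H(Y) - n H(Y|X)`; the terms `log N` cancel.
    have hsub := ent_submodular hQ.1 (fun ω => ω.2.2.2.1) (fun ω => ω.2.2.1)
      (fun ω => (ω.2.1, ω.1))
    rw [ent_congr Q (A := fun ω => (ω.2.2.2.1, ω.2.2.1, ω.2.1, ω.1))
        (B := fun ω => ((ω.2.2.1, ω.2.1, ω.1), ω.2.2.2.1))
        (by intro ω ω'; simp only [Prod.mk.injEq]; tauto),
      ent_congr Q (A := fun ω => (ω.2.1, ω.1)) (B := fun ω => (ω.1, ω.2.1))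
        (by intro ω ω'; simp only [Prod.mk.injEq]; tauto),
      ent_congr Q (A := fun ω => (ω.2.2.2.1, ω.2.1, ω.1)) (B := fun ω => (ω.2.1, CY ω))
        (by intro ω ω'; simp only [hCY, Prod.mk.injEq]; tauto), hWn, hCS] at hsub
    rw [sourceInfo, inputOutputInfo, hout, hE1, hPch]
    refine le_of_mul_le_mul_left ?_ hn'
    rw [mul_sub, ← mul_assoc, mul_inv_cancel₀ hn'.ne', one_mul]
    nlinarith
  -- With `Z` the quadruple, `∑ H(Z_k|CYⁿ) ≥ H(Zⁿ|CYⁿ) ≥ H(Zⁿ) - H(CYⁿ)`. The bound `hCYle` on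
  -- `H(CYⁿ)` then contributes `log N`, and its `n H(Y)` cancels.
  · have hvec := ent_vector_le hQ.1 blockZ CY
    have hmono : ent Q blockZ ≤ ent Q (fun ω => (blockZ ω, CY ω)) :=
      ent_le_of_determines hQ.1 fun ω ω' h => (Prod.mk.inj h).1
    have hZ : ∑ z, negMulLog (κ.induced PS W z) = ent Q blockZ := by rw [hind]; rfl
    rw [outputCondInfo, hout, hZ]
    simp only [mul_sub, Finset.sum_sub_distrib (f := fun u => w u * _)]
    rw [hE2, hE3, ← mul_assoc, ← mul_assoc, mul_inv_cancel₀ hn'.ne', one_mul, one_mul]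
    simp only [hc1, hc2, Finset.sum_sub_distrib] at hvec ⊢
    linarith

end SingleLetter

/-! ### The outer bound: continuity, compactness and the limit. -/

section Outer

theorem continuous_law {Ω α : Type*} [Fintype Ω] (A : Ω → α) (a : α) :
    Continuous fun Q : Ω → ℝ => law Q A a := by
  unfold law
  fun_prop

theorem continuous_ent {Ω α : Type*} [Fintype Ω] [Fintype α] (A : Ω → α) :
    Continuous fun Q : Ω → ℝ => ent Q A := by
  unfold ent
  exact continuous_finsetSum _ fun a _ => Real.continuous_negMulLog.comp (continuous_law A a)

/-- Total variation does not grow under marginalisation, so every one-letter marginal, and then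
their average, is close to `p`. -/
theorem abs_avgMarginal_sub_le {Z : Type*} [Fintype Z] {n : ℕ} (hn : 0 < n) {p : Z → ℝ}
    (hp : ∑ z, p z = 1) (P : (Fin n → Z) → ℝ) (z : Z) :
    |avgMarginal P z - p z| ≤ 2 * tvDist P (iid p n) := by
  have hn' : (0 : ℝ) < n := by exact_mod_cast hn
  have hk : ∀ k : Fin n, |law P (fun x => x k) z - p z| ≤ 2 * tvDist P (iid p n) := by
    intro k
    have h1 := tvDist_law_le P (iid p n) (fun x => x k)
    rw [law_iid_apply hp] at h1
    have h2 := Finset.single_le_sum (f := fun z => |law P (fun x => x k) z - p z|)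
      (fun z _ => abs_nonneg _) (Finset.mem_univ z)
    rw [tvDist] at h1
    linarith
  have h3 : avgMarginal P z - p z = (n : ℝ)⁻¹ * ∑ k : Fin n, (law P (fun x => x k) z - p z) := by
    rw [avgMarginal, Finset.sum_sub_distrib, mul_sub]
    simp [hn'.ne']
  rw [h3, abs_mul, abs_of_nonneg (by positivity)]
  calc (n : ℝ)⁻¹ * |∑ k : Fin n, (law P (fun x => x k) z - p z)|
      ≤ (n : ℝ)⁻¹ * ∑ k : Fin n, 2 * tvDist P (iid p n) := by
        gcongr
        exact (Finset.abs_sum_le_sum_abs _ _).trans (Finset.sum_le_sum fun k _ => hk k)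
    _ = _ := by
        simp only [Finset.sum_const, Finset.card_univ, Fintype.card_fin, nsmul_eq_mul]
        field_simp

/-- The entropy of a block that is close to an i.i.d. block. -/
theorem mul_sum_negMulLog_sub_le {Z : Type*} [Fintype Z] {n : ℕ} {p : Z → ℝ}
    (hp : p ∈ stdSimplex ℝ Z) {P : (Fin n → Z) → ℝ} (hP : P ∈ stdSimplex ℝ (Fin n → Z)) :
    n * ∑ z, negMulLog (p z) - ∑ z, negMulLog (P z)
      ≤ n * (tvDist P (iid p n) * log (Fintype.card Z)) + 1 := by
  have h1 := sum_negMulLog_sub_le hP (iid_mem_stdSimplex hp n)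
  have h2 := sum_negMulLog_prod (fun _ : Fin n => p) (fun _ => hp.2)
  simp only [Finset.sum_const, Finset.card_univ, Fintype.card_fin, nsmul_eq_mul] at h2
  change ∑ z, negMulLog (iid p n z) = _ at h2
  rw [h2, Fintype.card_fun, Fintype.card_fin, Nat.cast_pow, Real.log_pow] at h1
  set d := tvDist P (iid p n) with hd
  -- `log (1/d) ≤ 1/d - 1`. A bounded term suffices here, since the inequality is later divided by
  -- the block length.
  have h3 : negMulLog d + d ≤ 1 := by
    rcases (tvDist_nonneg P (iid p n)).eq_or_lt with h | h
    · rw [hd, ← h]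
      simp
    · rw [← hd] at h
      have h4 := Real.log_le_sub_one_of_pos (x := d⁻¹) (by positivity)
      rw [Real.log_inv] at h4
      have h5 := mul_le_mul_of_nonneg_left h4 h.le
      rw [mul_sub, mul_inv_cancel₀ h.ne'] at h5
      rw [negMulLog]
      linarith
  linarith

theorem log_numBins_le {R₀ : ℝ} (hR : 0 ≤ R₀) (n : ℕ) : log (numBins R₀ n) ≤ n * (R₀ * log 2) := by
  have h1 : (numBins R₀ n : ℝ) ≤ (2 : ℝ) ^ ((n : ℝ) * R₀) := Nat.floor_le (by positivity)
  have h2 : (0 : ℝ) < numBins R₀ n := by exact_mod_cast (half_exp_le_numBins hR n).2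
  refine (Real.log_le_log h2 h1).trans (le_of_eq ?_)
  rw [Real.log_rpow (by norm_num)]
  ring

variable {S X Y T : Type*} [Fintype S] [Fintype X] [Fintype Y] [Fintype T]

/-- The parameters of a mixture of `K` chains. -/
abbrev ChainMixture (S X Y T : Type*) (K : ℕ) : Type _ :=
  (Fin K → ℝ) × (Fin K → S × X → ℝ) × (Fin K → Y → T → ℝ)

/-- The parameters that are probability distributions. -/
def chainMixtures (S X Y T : Type*) [Fintype S] [Fintype X] [Fintype T] (K : ℕ) :
    Set (ChainMixture S X Y T K) :=
  stdSimplex ℝ (Fin K) ×ˢ (Set.univ.pi fun _ => stdSimplex ℝ (S × X)) ×ˢ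
    (Set.univ.pi fun _ => Set.univ.pi fun _ => stdSimplex ℝ T)

/-- The reason for parametrising by weights and chains: the domain is a product of simplices and the
joint law is polynomial in the parameters, whereas Bayes conditionals would be discontinuous at zero
mass. -/
theorem isCompact_chainMixtures (K : ℕ) : IsCompact (chainMixtures S X Y T K) :=
  (isCompact_stdSimplex ℝ _).prod ((isCompact_univ_pi fun _ => isCompact_stdSimplex ℝ _).prod
    (isCompact_univ_pi fun _ => isCompact_univ_pi fun _ => isCompact_stdSimplex ℝ _))

/-- The components of a mixture of chains. -/
def ChainMixture.kernel {K : ℕ} (W : X → Y → ℝ) (q : ChainMixture S X Y T K) (u : Fin K) :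
    S × X × Y × T → ℝ := chain W (q.2.1 u) (q.2.2 u)

theorem continuous_kernel {K : ℕ} (W : X → Y → ℝ) (u : Fin K) :
    Continuous fun q : ChainMixture S X Y T K => q.kernel W u := by
  refine continuous_pi fun z => ?_
  unfold ChainMixture.kernel chain
  fun_prop

theorem continuous_output {K : ℕ} (W : X → Y → ℝ) :
    Continuous fun q : ChainMixture S X Y T K => output q.1 (q.kernel W) := by
  refine continuous_pi fun z => ?_
  unfold output
  refine continuous_finsetSum _ fun u _ => Continuous.mul (by fun_prop) ?_
  exact (continuous_apply z).comp (continuous_kernel W u)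

theorem continuous_sourceInfo {K : ℕ} (W : X → Y → ℝ) :
    Continuous fun q : ChainMixture S X Y T K => sourceInfo q.1 (q.kernel W) := by
  unfold sourceInfo
  refine ((continuous_ent _).comp (continuous_output W)).sub
    (continuous_finsetSum _ fun u _ => Continuous.mul (by fun_prop) ?_)
  exact (continuous_ent _).comp (continuous_kernel W u)

theorem continuous_outputCondInfo {K : ℕ} (W : X → Y → ℝ) :
    Continuous fun q : ChainMixture S X Y T K => outputCondInfo q.1 (q.kernel W) := by
  unfold outputCondInfo
  refine (((continuous_ent _).comp (continuous_output W)).sub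
    ((continuous_ent _).comp (continuous_output W))).sub
    (continuous_finsetSum _ fun u _ => Continuous.mul (by fun_prop) ?_)
  exact ((continuous_ent _).comp (continuous_kernel W u)).sub
    ((continuous_ent _).comp (continuous_kernel W u))

theorem continuous_inputOutputInfo :
    Continuous fun P : S × X × Y × T → ℝ => inputOutputInfo P := by
  unfold inputOutputInfo
  exact ((continuous_ent _).add (continuous_ent _)).sub (continuous_ent _)

/-- The single-letter converse with a bounded auxiliary alphabet. -/
theorem Code.exists_chainMixture [Nonempty S] [Nonempty X] [Nonempty Y] [Nonempty T] {n N : ℕ}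
    (κ : Code S X Y T n N) {PS : S → ℝ} {W : X → Y → ℝ}
    (hn : 0 < n) (hN : 0 < N) (hPS : PS ∈ stdSimplex ℝ S) (hW : ∀ x, W x ∈ stdSimplex ℝ Y) :
    ∃ q ∈ chainMixtures S X Y T (Fintype.card (S × X × Y × T) + 1),
      output q.1 (q.kernel W) = avgMarginal (κ.induced PS W) ∧
      law (output q.1 (q.kernel W)) (fun z => z.1) = PS ∧
      sourceInfo q.1 (q.kernel W) ≤ inputOutputInfo (output q.1 (q.kernel W)) ∧
      n * outputCondInfo q.1 (q.kernel W)
        ≤ log N + n * ent (output q.1 (q.kernel W)) (fun z => z)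
          - ∑ z, negMulLog (κ.induced PS W z) := by
  obtain ⟨w, a, r, hw, ha, hr, hout, hS, h1, h2⟩ := κ.exists_single_letter hn hN hPS hW
  set V := fun u => chain W (a u) (r u) with hV
  -- The mean of `H(SXYŜ|U=u) - H(Y|U=u)` is kept exactly. The mean of `H(S|U=u)` may only grow,
  -- which lowers `I(U;S)`; that inequality goes the right way and saves one atom.
  obtain ⟨w', e, hw', hout', he2, he1⟩ := exists_small_mixture hw
    (V := V) (fun u => (chain_mem_stdSimplex hW (ha u) (hr u)).2)
    (fun u => ent (V u) (fun z => z.1))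
    (fun u => ent (V u) (fun z => z) - ent (V u) (fun z => z.2.2.1))
  have hk : ChainMixture.kernel W (w', (fun j => a (e j)), (fun j => r (e j)))
      = fun j => V (e j) := rfl
  refine ⟨(w', (fun j => a (e j)), (fun j => r (e j))), ⟨hw', fun j _ => ha _,
    fun j _ y _ => hr _ _⟩, ?_, ?_, ?_, ?_⟩
  · rw [hk, hout', hout]
  · rw [hk, hout', hout, hS]
  · rw [hk, hout', hout]
    refine le_trans ?_ h1
    rw [sourceInfo, sourceInfo, hout']
    linarith
  · rw [hk, hout', hout]
    refine le_trans (le_of_eq ?_) h2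
    rw [outputCondInfo, outputCondInfo, hout', he2]

theorem region_subset_outerBound {PS : S → ℝ} (hPS : PS ∈ stdSimplex ℝ S) {W : X → Y → ℝ}
    (hW : ∀ x, W x ∈ stdSimplex ℝ Y) : region T PS W ⊆ outerBound T PS W := by
  rintro ⟨P, R₀⟩ ⟨hP, hR₀, κ, hκ⟩
  dsimp only at hP hR₀ κ hκ
  have hne : Nonempty (S × X × Y × T) := by
    by_contra h
    rw [not_nonempty_iff] at h
    simpa using hP.2
  obtain ⟨s₀, x₀, y₀, t₀⟩ := hne
  have : Nonempty S := ⟨s₀⟩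
  have : Nonempty X := ⟨x₀⟩
  have : Nonempty Y := ⟨y₀⟩
  have : Nonempty T := ⟨t₀⟩
  have hN := fun n => (half_exp_le_numBins hR₀ n).2
  -- Shifted to block length `n + 1`, as the time average is meaningless for the empty block.
  choose q hq hout hqS hq1 hq2 using fun n : ℕ =>
    (κ (n + 1)).exists_chainMixture n.succ_pos (hN (n + 1)) hPS hW
  set d : ℕ → ℝ := fun n => tvDist ((κ (n + 1)).induced PS W) (iid P (n + 1)) with hd
  have hd0 : Filter.Tendsto d Filter.atTop (nhds 0) :=
    hκ.comp (Filter.tendsto_add_atTop_nat 1)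
  have houtlim : Filter.Tendsto (fun n => output (q n).1 ((q n).kernel W)) Filter.atTop
      (nhds P) := by
    rw [tendsto_pi_nhds]
    intro z
    rw [tendsto_iff_dist_tendsto_zero]
    have h2 := hd0.const_mul 2
    rw [mul_zero] at h2
    refine squeeze_zero (fun n => dist_nonneg) (fun n => ?_) h2
    rw [hout, Real.dist_eq]
    exact abs_avgMarginal_sub_le n.succ_pos hP.2 _ z
  -- The rate bound per letter. Every term on the right after `R₀ * log 2` tends to zero.
  have hcond : ∀ n, outputCondInfo (q n).1 ((q n).kernel W) ≤ R₀ * log 2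
      + (ent (output (q n).1 ((q n).kernel W)) (fun z => z) - ent P (fun z => z))
      + d n * log (Fintype.card (S × X × Y × T)) + 1 / ((n : ℝ) + 1) := by
    intro n
    have h1 := hq2 n
    have h2 := log_numBins_le hR₀ (n + 1)
    have h3 := mul_sum_negMulLog_sub_le hP
      ((κ (n + 1)).induced_mem_stdSimplex (hN (n + 1)) hPS hW)
    have h4 : ent P (fun z => z) = ∑ z, negMulLog (P z) := by rw [ent, law_id]
    push_cast at h1 h2 h3
    rw [← h4] at h3
    have hn : (0 : ℝ) < (n : ℝ) + 1 := by positivity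
    refine le_of_mul_le_mul_left ?_ hn
    have h5 : ((n : ℝ) + 1) * (1 / ((n : ℝ) + 1)) = 1 := by field_simp
    rw [mul_add, mul_add, mul_add, mul_sub, h5]
    linarith
  -- The parameters live in one compact set for all block lengths, thanks to support reduction. The
  -- limit satisfies the closed conditions, and its output law is the target `P`.
  obtain ⟨q₀, hq₀, φ, hφ, hlim⟩ := (isCompact_chainMixtures _).tendsto_subseq hq
  have hφ' := hφ.tendsto_atTop
  have houtq : output q₀.1 (q₀.kernel W) = P :=
    tendsto_nhds_unique (((continuous_output W).tendsto q₀).comp hlim) (houtlim.comp hφ')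
  have hr₀ : ∀ u y, q₀.2.2 u y ∈ stdSimplex ℝ T := fun u y =>
    hq₀.2.2 u (Set.mem_univ _) y (Set.mem_univ _)
  have ha₀ : ∀ u, q₀.2.1 u ∈ stdSimplex ℝ (S × X) := fun u => hq₀.2.1 u (Set.mem_univ _)
  have hV₀ : ∀ u, q₀.kernel W u ∈ stdSimplex ℝ (S × X × Y × T) := fun u =>
    chain_mem_stdSimplex hW (ha₀ u) (hr₀ u)
  have hS₀ : law (output q₀.1 (q₀.kernel W)) (fun z => z.1) = PS := by
    funext s
    have h1 := (((continuous_law (fun z : S × X × Y × T => z.1) s).comp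
      (continuous_output W)).tendsto q₀).comp hlim
    refine tendsto_nhds_unique h1 ?_
    have h2 : ∀ n, law (output (q n).1 ((q n).kernel W)) (fun z => z.1) s = PS s :=
      fun n => congrFun (hqS n) s
    simp only [Function.comp_def, h2]
    exact tendsto_const_nhds
  have hI1 : sourceInfo q₀.1 (q₀.kernel W) ≤ inputOutputInfo (output q₀.1 (q₀.kernel W)) :=
    le_of_tendsto_of_tendsto' (((continuous_sourceInfo W).tendsto q₀).comp hlim)
      (((continuous_inputOutputInfo.comp (continuous_output W)).tendsto q₀).comp hlim)
      fun n => hq1 (φ n)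
  have hI2 : outputCondInfo q₀.1 (q₀.kernel W) ≤ R₀ * log 2 := by
    have h1 : Filter.Tendsto (fun n => R₀ * log 2
        + (ent (output (q n).1 ((q n).kernel W)) (fun z => z) - ent P (fun z => z))
        + d n * log (Fintype.card (S × X × Y × T)) + 1 / ((n : ℝ) + 1)) Filter.atTop
        (nhds (R₀ * log 2 + (ent P (fun z => z) - ent P (fun z => z))
          + 0 * log (Fintype.card (S × X × Y × T)) + 0)) :=
      ((tendsto_const_nhds.add ((((continuous_ent _).tendsto P).comp houtlim).sub_const _)).add
        (hd0.mul_const _)).add tendsto_one_div_add_atTop_nhds_zero_nat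
    have h2 := le_of_tendsto_of_tendsto' (((continuous_outputCondInfo W).tendsto q₀).comp hlim)
      (h1.comp hφ') fun n => hcond (φ n)
    simpa using h2
  have hlog : 0 < log 2 := Real.log_pos (by norm_num)
  have haux : AuxFactors PS W (mix q₀.1 (q₀.kernel W)) :=
    auxFactors_of_chain hW hq₀.1 ha₀ hr₀ hS₀
  have hmarg : IsMarginal P (mix q₀.1 (q₀.kernel W)) := fun s x y t => by
    rw [← houtq]
    rfl
  refine ⟨targetFactors_of_auxFactors haux hmarg, Fin (Fintype.card (S × X × Y × T) + 1),
    inferInstance, mix q₀.1 (q₀.kernel W), haux, hmarg, ?_, ?_, ?_⟩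
  · rw [mutualInfo_mix_source hV₀, mutualInfo_mix_inputOutput]
    exact div_le_div_of_nonneg_right hI1 hlog.le
  · rw [condMutualInfo_mix hV₀]
    exact (div_le_iff₀ hlog).2 hI2
  · simp only [Fintype.card_fin, Fintype.card_prod]
    exact le_of_eq (by ring)

end Outer

end StrongCoordination

end

theorem theorem1 {S X Y T : Type*} [Fintype S] [Fintype X] [Fintype Y] [Fintype T]
    (PS : S → ℝ) (hPS : PS ∈ stdSimplex ℝ S)
    (W : X → Y → ℝ) (hW : ∀ x, W x ∈ stdSimplex ℝ Y) :
    StrongCoordination.innerBound T PS W ⊆ StrongCoordination.region T PS W ∧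
      StrongCoordination.region T PS W ⊆ StrongCoordination.outerBound T PS W :=
  ⟨StrongCoordination.innerBound_subset_region hPS hW,
    StrongCoordination.region_subset_outerBound hPS hW⟩
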